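/- **Setting.** Let $\mathcal K$ be a separable complex Hilbert space and let $\mathcal E(t)\subseteq\mathcal K\subseteq\mathcal E'(t)$, $t>0$, be a measurable field of Gelfand triples of Hilbert spaces with norms $\|\cdot\|_+\ge\|\cdot\|\ge\|\cdot\|_-$ (for example $\mathcal E(t)=\mathcal K=\mathcal E'(t)$). A chain is a finite set $\tau\subset\,]0,\infty[$; $|\tau|$ is its number of points and $d\tau$ is Lebesgue measure $dt_1\cdots dt_n$ on $\{0<t_1<\dots<t_n\}$ for each $n$, the empty chain having mass $1$. For $\eta>0$ let $\mathcal G(\eta)$ be the Hilbert space of measurable sections $\varphi$ with $$\|\varphi\|(\eta)^2=\int\eta^{|\tau|}\,\|\varphi(\tau)\|_\pm^2\,d\tau<\infty ,$$ where $\varphi(\tau)\in\bigotimes_{t\in\tau}\mathcal E(t)$ with the norm $\|\cdot\|_+$ if $\eta>1$, and $\varphi(\tau)\in\bigotimes_{t\in\tau}\mathcal E'(t)$ with the norm $\|\cdot\|_-$ if $\eta<1$. Put $\mathcal G^+=\bigcap_{\zeta>1}\mathcal G(\zeta)$ and $\mathcal G_-=\bigcap_{0<\xi<1}\mathcal G(\xi)$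 with the projective limit topologies. The scalar product of the Fock space over $L^2(\mathbb R^+\to\mathcal K)$ extends to the duality $\langle\varphi|\chi\rangle=\int\langle\varphi(\tau)|\chi(\tau)\rangle\,d\tau$ between $\mathcal G(1/\xi)$ and $\mathcal G(\xi)$, $\xi<1$, so that $\mathcal G_\cup=\bigcup_{0<\xi<1}\mathcal G(\xi)\supseteq\mathcal G_-$ is the dual of $\mathcal G^+$. The same notation is used for spaces with one more tensor factor, $\mathcal G^+\otimes\mathcal E(t)=\bigcap_{\zeta>1}\mathcal G(\zeta)\otimes\mathcal E(t)$ and $\mathcal G_\cup\otimes\mathcal E'(t)=\bigcup_{0<\xi<1}\mathcal G(\xi)\otimes\mathcal E'(t)$. Let $\mathbf C(t)$, $t>0$, be a weakly measurable matrix process, that is, a family of linear operators $C^-_+(t):\mathcal G^+\to\mathcal G_\cup$, $C^-_\circ(t):\mathcal G^+\otimes\mathcal E(t)\to\mathcal G_\cup$, $C^\circ_+(t):\mathcal G^+\to\mathcal G_\cup\otimes\mathcal E'(t)$, $C^\circ_\circ(t):\mathcal G^+\otimes\mathcal E(t)\to\mathcal G_\cup\otimes\mathcal E'(t)$; no adaptedness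 is assumed. For an operator $A$ let $\|A\|^\xi_\zeta=\sup_\varphi\|A\varphi\|(\xi)/\|\varphi\|(\zeta)\in[0,\infty]$, and for a component $C$ let $\|C\|^{\xi,p}_{\zeta,t}$ be the $L^p(]0,t])$-norm of $s\mapsto\|C(s)\|^\xi_\zeta$. Say that $\mathbf C$ is $(\zeta,\xi)$-integrable on $]0,t]$ if $\|C^-_+\|^{\xi,1}_{\zeta,t}$, $\|C^-_\circ\|^{\xi,2}_{\zeta,t}$, $\|C^\circ_+\|^{\xi,2}_{\zeta,t}$ and $\|C^\circ_\circ\|^{\xi,\infty}_{\zeta,t}$ are all finite, and locally QS-integrable if for every $\xi\in\,]0,1[$ and $t>0$ there is $\zeta>1$ for which it is $(\zeta,\xi)$-integrable on $]0,t]$. (Then $C(t)$ takes values in $\mathcal G_-$, resp. $\mathcal G_-\otimes\mathcal E'(t)$, for almost all $t$.) For $\varphi\in\mathcal G^+$ put $\varphi^\circ_s(\tau)=\varphi(\tau\sqcup s)$, an element of $\mathcal G^+\otimes\mathcal E(s)$ for almost all $s$. The QS integral is $$\Big(\int_0^tA(\mathbf C,ds)\varphi\Big)(\tau)=\int_0^t\big(C^-_+(s)\varphi+C^-_\circ(s)\varphi^\circ_s\big)(\tau)\,ds+\sum_{s\in\tau,\,s\le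 t}\big(C^\circ_+(s)\varphi+C^\circ_\circ(s)\varphi^\circ_s\big)(\tau\setminus s),$$ where jointly measurable versions of the integrands in $(s,\tau)$ are used. **Theorem.** Let $\mathbf C$ be locally QS-integrable and $t>0$. 1. For every $\varphi\in\mathcal G^+$ the QS integral is defined for almost all $\tau$, does not depend on the versions, and defines a continuous linear operator $\imath_0^t(\mathbf C):\mathcal G^+\to\mathcal G_-$. 2. If $0<\xi<1<\zeta$ and $\mathbf C$ is $(\zeta,\xi)$-integrable on $]0,t]$, then for $0<\varepsilon<\xi$, $0<\eta_-\le\xi-\varepsilon$ and $\eta^+\ge\zeta+\varepsilon$ $$\|\imath_0^t(\mathbf C)\|^{\eta_-}_{\eta^+}\le\|C^-_+\|^{\xi,1}_{\zeta,t}+\frac1{\sqrt\varepsilon}\Big(\|C^-_\circ\|^{\xi,2}_{\zeta,t}+\|C^\circ_+\|^{\xi,2}_{\zeta,t}\Big)+\frac1\varepsilon\|C^\circ_\circ\|^{\xi,\infty}_{\zeta,t}.$$ 3. The process $\mathbf C^\star=\mathbf g\mathbf C^*\mathbf g$ with components $(C^\star)^-_+=(C^-_+)^*$, $(C^\star)^\circ_+=(C^-_\circ)^*$,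 $(C^\star)^-_\circ=(C^\circ_+)^*$, $(C^\star)^\circ_\circ=(C^\circ_\circ)^*$ (adjoints with respect to the duality) exists for almost all $s$ and is weakly measurable. For almost all $s$ and all $\xi<1<\zeta$ the norm $\|\cdot\|^{1/\zeta}_{1/\xi}$ of each of its components at $s$ equals the norm $\|\cdot\|^{\xi}_{\zeta}$ of the component of $\mathbf C(s)$ whose adjoint it is. In particular $\mathbf C^\star$ is $(1/\xi,1/\zeta)$-integrable on $]0,t]$ whenever $\mathbf C$ is $(\zeta,\xi)$-integrable there. 4. The adjoint of $\imath_0^t(\mathbf C)$ is defined on $\mathcal G^+$, which is contained and dense in $\mathcal G_-$, and is there the QS integral of $\mathbf C^\star$: this integral exists on $\mathcal G^+$, with values in $\mathcal G_\cup$, and $$\Big\langle\int_0^tA(\mathbf C^\star,ds)\varphi\,\Big|\,\chi\Big\rangle=\Big\langle\varphi\,\Big|\int_0^tA(\mathbf C,ds)\chi\Big\rangle ,\qquad\varphi,\chi\in\mathcal G^+ .$$ -/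

import Mathlib

open MeasureTheory Set
open scoped ENNReal

noncomputable section

namespace QSC

universe u v w

/-! ### Chains and the Fock scale

A vector of the Fock scale is a measurable section `τ ↦ φ(τ)` over the finite subsets `τ` of the
positive half-line with values in a Hilbert tensor product `⨂_{t ∈ τ} E(t)` (for exponents above
one) or `⨂_{t ∈ τ} E'(t)` (for exponents below one).  It is written here in coordinates: `E(t)`
carries an orthonormal basis `(b_j(t))` indexed by the countable set `J` and measurable in `t`, and
`E'(t)`, the dual of `E(t)` with respect to the scalar product of `K`, carries the dual basis
`(b'_j(t))`.  The coordinates of `φ(τ)` in the product basis depend on `τ` and on a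
map `τ → J`, in other words on a finite set of marked points `(t, j)`.  One-dimensional noise is
the case where `J` has one element. -/

/-- Finite chains with marks in `J`: finite sets of marked points. Only chains whose times are
positive and pairwise distinct matter, see `chainMeasure`. -/
def Chain (J : Type u) : Type u := Finset (ℝ × J)

/-- The chain made of the entries of a tuple. -/
def chainOfTuple (J : Type u) (n : ℕ) (x : Fin n → ℝ × J) : Chain J :=
  open Classical in (Finset.univ.image x : Finset (ℝ × J))

/-- The chain `τ ⊔ p`. -/
def Chain.insert {J : Type u} (p : ℝ × J) (ω : Chain J) : Chain J :=
  open Classical in (Insert.insert p (show Finset (ℝ × J) from ω) : Finset (ℝ × J))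

/-- The chain `τ \ p`. -/
def Chain.erase {J : Type u} (ω : Chain J) (p : ℝ × J) : Chain J :=
  open Classical in (Finset.erase (show Finset (ℝ × J) from ω) p : Finset (ℝ × J))

/-- The set of points of a chain. -/
def Chain.points {J : Type u} (ω : Chain J) : Finset (ℝ × J) := ω

/-- The number of points `|τ|`. -/
def Chain.length {J : Type u} (ω : Chain J) : ℕ := ω.points.card

/-- A set of chains is measurable iff its `n`-point tuples form a measurable set for every `n`. -/
instance chainMeasurableSpace (J : Type u) [MeasurableSpace J] : MeasurableSpace (Chain J) :=
  ⨅ n : ℕ, MeasurableSpace.map (chainOfTuple J n) inferInstance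

/-- The measure `dτ` on chains: for every `n` the Lebesgue measure on `0 < t₁ < … < tₙ` (and the
counting measure on the marks), the empty chain having mass one. -/
def chainMeasure (J : Type u) [MeasurableSpace J] : Measure (Chain J) :=
  Measure.sum fun n : ℕ =>
    ((Measure.pi fun _ : Fin n =>
        (volume.restrict (Ioi (0 : ℝ))).prod (Measure.count : Measure J)).restrict
      {x | StrictMono fun i => (x i).1}).map (chainOfTuple J n)

/-- The measure underlying the spaces `𝒢(η) ⊗ ℓ²(ι)`. -/
def fockMeasure (J : Type u) (ι : Type v) [MeasurableSpace J] [MeasurableSpace ι] :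
    Measure (Chain J × ι) :=
  (chainMeasure J).prod Measure.count

/-- All measurable sections, modulo equality almost everywhere.  With `ι = Unit` these are
sections `τ ↦ φ(τ)`; with `ι = J` they are sections with one more tensor factor `E(t)` (or `E'(t)`)
for a separate `t`. -/
abbrev Sect (J : Type u) (ι : Type v) [MeasurableSpace J] [MeasurableSpace ι] : Type (max u v) :=
  (Chain J × ι) →ₘ[fockMeasure J ι] ℂ

section Scale

variable {J : Type u} {ι : Type v} {κ : Type w}
  [MeasurableSpace J] [MeasurableSpace ι] [MeasurableSpace κ]

/-- The measure `η ^ |τ| dτ`. -/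
def weighted (J : Type u) (ι : Type v) [MeasurableSpace J] [MeasurableSpace ι] (η : ℝ) :
    Measure (Chain J × ι) :=
  (fockMeasure J ι).withDensity fun x => ENNReal.ofReal (η ^ x.1.length)

/-- The norm `‖φ‖(η) = (∫ η ^ |τ| ‖φ(τ)‖² dτ) ^ (1/2)`, possibly infinite. -/
def fockNorm (η : ℝ) (φ : Sect J ι) : ℝ≥0∞ := eLpNorm φ 2 (weighted J ι η)

theorem weighted_ac (η : ℝ) : weighted J ι η ≪ fockMeasure J ι :=
  withDensity_absolutelyContinuous _ _

theorem fockNorm_zero (η : ℝ) : fockNorm η (0 : Sect J ι) = 0 := by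
  unfold fockNorm
  rw [eLpNorm_congr_ae ((weighted_ac η).ae_eq AEEqFun.coeFn_zero)]
  exact eLpNorm_zero

theorem fockNorm_add_le (η : ℝ) (φ ψ : Sect J ι) :
    fockNorm η (φ + ψ) ≤ fockNorm η φ + fockNorm η ψ := by
  unfold fockNorm
  rw [eLpNorm_congr_ae ((weighted_ac η).ae_eq (AEEqFun.coeFn_add φ ψ))]
  exact eLpNorm_add_le (φ.aestronglyMeasurable.mono_ac (weighted_ac η))
    (ψ.aestronglyMeasurable.mono_ac (weighted_ac η)) (by norm_num)

theorem fockNorm_smul (η : ℝ) (c : ℂ) (φ : Sect J ι) :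
    fockNorm η (c • φ) = ‖c‖ₑ * fockNorm η φ := by
  unfold fockNorm
  rw [eLpNorm_congr_ae ((weighted_ac η).ae_eq (AEEqFun.coeFn_smul c φ))]
  exact eLpNorm_const_smul _ _ _ _

theorem fockNorm_mono {η η' : ℝ} (h0 : 0 ≤ η) (h : η ≤ η') (φ : Sect J ι) :
    fockNorm η φ ≤ fockNorm η' φ :=
  eLpNorm_mono_measure _ (withDensity_mono (Filter.Eventually.of_forall fun _ =>
    ENNReal.ofReal_le_ofReal (pow_le_pow_left₀ h0 h _)))

/-- The Hilbert space `𝒢(η)` (`ι = Unit`), respectively `𝒢(η) ⊗ E(t)` or `𝒢(η) ⊗ E'(t)`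
(`ι = J`). -/
def fockSpace (J : Type u) (ι : Type v) [MeasurableSpace J] [MeasurableSpace ι] (η : ℝ) :
    Submodule ℂ (Sect J ι) where
  carrier := {φ | fockNorm η φ < ∞}
  zero_mem' := by simp [fockNorm_zero]
  add_mem' ha hb := (fockNorm_add_le _ _ _).trans_lt (ENNReal.add_lt_top.2 ⟨ha, hb⟩)
  smul_mem' c φ h := by
    change fockNorm η (c • φ) < ∞
    rw [fockNorm_smul]
    exact ENNReal.mul_lt_top enorm_lt_top h

/-- `𝒢⁺ = ⋂_{ζ > 1} 𝒢(ζ)`. -/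
def GPlus (J : Type u) (ι : Type v) [MeasurableSpace J] [MeasurableSpace ι] :
    Submodule ℂ (Sect J ι) :=
  ⨅ ζ : Ioi (1 : ℝ), fockSpace J ι ζ

/-- `𝒢₋ = ⋂_{ξ < 1} 𝒢(ξ)`. -/
def GMinus (J : Type u) (ι : Type v) [MeasurableSpace J] [MeasurableSpace ι] :
    Submodule ℂ (Sect J ι) :=
  ⨅ ξ : Ioo (0 : ℝ) 1, fockSpace J ι ξ

/-- `⋃_{ξ < 1} 𝒢(ξ)`, the dual of `𝒢⁺`; it contains `𝒢₋`. -/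
def GDual (J : Type u) (ι : Type v) [MeasurableSpace J] [MeasurableSpace ι] :
    Submodule ℂ (Sect J ι) where
  carrier := {φ | ∃ ξ ∈ Ioo (0 : ℝ) 1, φ ∈ fockSpace J ι ξ}
  zero_mem' := ⟨1 / 2, by norm_num, Submodule.zero_mem _⟩
  add_mem' := by
    rintro a b ⟨x, hx, ha⟩ ⟨y, hy, hb⟩
    have hm : 0 < min x y := lt_min hx.1 hy.1
    refine ⟨min x y, ⟨hm, (min_le_left _ _).trans_lt hx.2⟩, Submodule.add_mem _ ?_ ?_⟩
    · exact (fockNorm_mono hm.le (min_le_left _ _) a).trans_lt ha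
    · exact (fockNorm_mono hm.le (min_le_right _ _) b).trans_lt hb
  smul_mem' := by
    rintro c a ⟨x, hx, ha⟩
    exact ⟨x, hx, Submodule.smul_mem _ c ha⟩

/-- The norm of `𝒢(η)` as a seminorm on a subspace of it. -/
def fockSeminorm (η : ℝ) (S : Submodule ℂ (Sect J ι)) (hS : S ≤ fockSpace J ι η) :
    Seminorm ℂ S :=
  Seminorm.of (fun φ => (fockNorm η (φ : Sect J ι)).toReal)
    (fun φ ψ => by
      have h1 : fockNorm η (φ : Sect J ι) < ∞ := hS φ.2
      have h2 : fockNorm η (ψ : Sect J ι) < ∞ := hS ψ.2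
      rw [← ENNReal.toReal_add h1.ne h2.ne]
      exact ENNReal.toReal_mono (ENNReal.add_lt_top.2 ⟨h1, h2⟩).ne (fockNorm_add_le _ _ _))
    (fun c φ => by
      rw [Submodule.coe_smul, fockNorm_smul, ENNReal.toReal_mul, toReal_enorm])

/-- The projective limit topology of `𝒢⁺`, given by the norms `‖·‖(ζ)`, `ζ > 1`. -/
instance : TopologicalSpace (GPlus J ι) :=
  (show SeminormFamily ℂ (GPlus J ι) (Ioi (1 : ℝ)) from fun ζ =>
    fockSeminorm ζ (GPlus J ι) (iInf_le _ ζ)).moduleFilterBasis.topology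

instance : Nonempty (Ioo (0 : ℝ) 1) := ⟨⟨1 / 2, by norm_num⟩⟩

/-- The projective limit topology of `𝒢₋`, given by the norms `‖·‖(ξ)`, `0 < ξ < 1`. -/
instance : TopologicalSpace (GMinus J ι) :=
  (show SeminormFamily ℂ (GMinus J ι) (Ioo (0 : ℝ) 1) from fun ξ =>
    fockSeminorm ξ (GMinus J ι) (iInf_le _ ξ)).moduleFilterBasis.topology

/-- The duality `⟨φ | ψ⟩ = ∫ ⟨φ(τ) | ψ(τ)⟩ dτ`, antilinear in the first argument. -/
def pairing (φ ψ : Sect J ι) : ℂ :=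
  ∫ x, (starRingEnd ℂ) (φ x) * ψ x ∂(fockMeasure J ι)

/-- `‖A‖_ζ^ξ = sup_φ ‖A φ‖(ξ) / ‖φ‖(ζ)`, possibly infinite. -/
def opNorm (ζ ξ : ℝ) (A : GPlus J ι → Sect J κ) : ℝ≥0∞ :=
  ⨆ φ : GPlus J ι, fockNorm ξ (A φ) / fockNorm ζ (φ : Sect J ι)

/-- `B` is adjoint to `A`: `⟨B φ | χ⟩ = ⟨φ | A χ⟩`. -/
def IsAdjoint (A : GPlus J ι →ₗ[ℂ] GDual J κ) (B : GPlus J κ →ₗ[ℂ] GDual J ι) : Prop :=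
  ∀ (φ : GPlus J κ) (χ : GPlus J ι),
    pairing (B φ : Sect J ι) (χ : Sect J ι) = pairing (φ : Sect J κ) (A χ : Sect J κ)

/-- The adjoint operator, where there is one (it is then unique), and zero otherwise. -/
def adj (A : GPlus J ι →ₗ[ℂ] GDual J κ) : GPlus J κ →ₗ[ℂ] GDual J ι :=
  open Classical in if h : ∃ B, IsAdjoint A B then h.choose else 0

end Scale

/-! ### Fields of Gelfand triples -/

/-- A measurable field of Gelfand triples `E(t) ⊆ K ⊆ E'(t)` of Hilbert spaces, with `|J|` equal
to the dimension of `K`.  `E(t)` is the range of the injection `emb t : ℓ²(J) → K`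
with the norm carried over from `ℓ²(J)`, so `b_j(t) = emb t e_j` is an orthonormal basis of `E(t)`.
`E'(t)` is the completion of `K` in the norm `‖k‖₋ = sup {|⟨k | x⟩| : x ∈ E(t), ‖x‖₊ ≤ 1}`; the
coordinates of `k` with respect to the dual basis are `⟨b_j(t) | k⟩`. -/
structure GelfandField (J : Type u) (K : Type v) [NormedAddCommGroup K]
    [InnerProductSpace ℂ K] where
  emb : ℝ → (lp (fun _ : J => ℂ) 2 →L[ℂ] K)
  injective : ∀ t, Function.Injective (emb t)
  dense : ∀ t, DenseRange (emb t)
  norm_le : ∀ t x, ‖emb t x‖ ≤ ‖x‖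
  measurable : ∀ x k, Measurable fun t => (inner ℂ k (emb t x) : ℂ)

/-- The matrix `⟨b_i(t) | b_k(t)⟩` of the inclusion `E(t) ⊆ E'(t)`. -/
def GelfandField.gram {J : Type u} {K : Type v} [NormedAddCommGroup K] [InnerProductSpace ℂ K]
    (E : GelfandField J K) (t : ℝ) (i k : J) : ℂ :=
  open Classical in
  inner ℂ (E.emb t (lp.single 2 i (1 : ℂ))) (E.emb t (lp.single 2 k (1 : ℂ)))

/-- The inclusion `𝒢⁺ ⊆ 𝒢₋`, which is the tensor product of the inclusions `E(t) ⊆ E'(t)` over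
the points `t` of the chain. -/
def GelfandField.incl {J : Type u} {K : Type v} [NormedAddCommGroup K] [InnerProductSpace ℂ K]
    [MeasurableSpace J] (E : GelfandField J K) (φ : Sect J Unit) (x : Chain J × Unit) : ℂ :=
  open Classical in
  ∑' k : (x.1.points → J),
    (∏ p : x.1.points, E.gram p.1.1 p.1.2 (k p)) *
      φ ((Finset.univ.image fun p : x.1.points => (p.1.1, k p) : Finset (ℝ × J)), ())

/-! ### Matrix processes and the integral -/

section Integral

variable {J : Type u} [MeasurableSpace J]

/-- Matrix processes `𝐂(t)`, `t > 0`, with the four components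
`C⁻₊(t) : 𝒢⁺ → 𝒢`, `C⁻ₒ(t) : 𝒢⁺ ⊗ E(t) → 𝒢`, `Cᵒ₊(t) : 𝒢⁺ → 𝒢 ⊗ E'(t)` and
`Cᵒₒ(t) : 𝒢⁺ ⊗ E(t) → 𝒢 ⊗ E'(t)`, where `𝒢 = ⋃_{ξ < 1} 𝒢(ξ)` contains `𝒢₋`. -/
structure MatrixProcess (J : Type u) [MeasurableSpace J] where
  time : ℝ → (GPlus J Unit →ₗ[ℂ] GDual J Unit)
  annihilation : ℝ → (GPlus J J →ₗ[ℂ] GDual J Unit)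
  creation : ℝ → (GPlus J Unit →ₗ[ℂ] GDual J J)
  number : ℝ → (GPlus J J →ₗ[ℂ] GDual J J)

/-- Weak measurability of an operator-valued function. -/
def WeaklyMeasurable {ι : Type v} {κ : Type w} [MeasurableSpace ι] [MeasurableSpace κ]
    (A : ℝ → (GPlus J ι →ₗ[ℂ] GDual J κ)) : Prop :=
  ∀ (φ : GPlus J ι) (χ : GPlus J κ),
    AEMeasurable (fun s => pairing (χ : Sect J κ) (A s φ : Sect J κ))
      (volume.restrict (Ioi (0 : ℝ)))

/-- The norm `‖A‖_{ζ,t}^{ξ,p}`: the `L^p` norm on `]0,t]` of `s ↦ ‖A(s)‖_ζ^ξ`. -/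
def procNorm {ι : Type v} {κ : Type w} [MeasurableSpace ι] [MeasurableSpace κ]
    (p : ℝ≥0∞) (ζ ξ t : ℝ) (A : ℝ → (GPlus J ι →ₗ[ℂ] GDual J κ)) : ℝ≥0∞ :=
  eLpNorm (fun s => opNorm ζ ξ fun φ => (A s φ : Sect J κ)) p (volume.restrict (Ioc 0 t))

/-- `‖A‖_{ζ,t}^{ξ,p} < ∞`, where almost every `A(s)` has to be bounded. -/
def LpBounded {ι : Type v} {κ : Type w} [MeasurableSpace ι] [MeasurableSpace κ]
    (p : ℝ≥0∞) (ζ ξ t : ℝ) (A : ℝ → (GPlus J ι →ₗ[ℂ] GDual J κ)) : Prop :=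
  (∀ᵐ s ∂(volume.restrict (Ioc 0 t)), opNorm ζ ξ (fun φ => (A s φ : Sect J κ)) < ∞) ∧
    procNorm p ζ ξ t A < ∞

namespace MatrixProcess

/-- All four components are weakly measurable. -/
def Measurable (C : MatrixProcess J) : Prop :=
  WeaklyMeasurable C.time ∧ WeaklyMeasurable C.annihilation ∧
    WeaklyMeasurable C.creation ∧ WeaklyMeasurable C.number

/-- QS-integrability on `]0,t]` for the pair of norms `ζ`, `ξ`. -/
def IntegrableOn (C : MatrixProcess J) (ζ ξ t : ℝ) : Prop :=
  LpBounded 1 ζ ξ t C.time ∧ LpBounded 2 ζ ξ t C.annihilation ∧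
    LpBounded 2 ζ ξ t C.creation ∧ LpBounded ∞ ζ ξ t C.number

/-- Local QS-integrability: for all `ξ < 1` and `t > 0` there is `ζ > 1` such that the four norms
are finite. -/
def LocallyIntegrable (C : MatrixProcess J) : Prop :=
  C.Measurable ∧ ∀ ξ ∈ Ioo (0 : ℝ) 1, ∀ t > 0, ∃ ζ > 1, C.IntegrableOn ζ ξ t

/-- The process `𝐂⋆ = 𝐠 𝐂* 𝐠`. -/
def star (C : MatrixProcess J) : MatrixProcess J where
  time s := adj (C.time s)
  annihilation s := adj (C.creation s)
  creation s := adj (C.annihilation s)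
  number s := adj (C.number s)

end MatrixProcess

/-- The section `φₛ(τ) = φ(τ ⊔ s)`, an element of `𝒢⁺ ⊗ E(s)` for almost all `s`. -/
def atPoint (φ : GPlus J Unit) (s : ℝ) : GPlus J J :=
  open Classical in
  if h : ∃ ψ : GPlus J J,
      (ψ : Sect J J) =ᵐ[fockMeasure J J] fun x => (φ : Sect J Unit) (x.1.insert (s, x.2), ())
  then h.choose else 0

/-- `a` is a jointly measurable version of `s ↦ A(s)` on `]0,t]`. -/
def IsVersion {ι : Type v} [MeasurableSpace ι] (t : ℝ) (A : ℝ → Sect J ι)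
    (a : ℝ → Chain J × ι → ℂ) : Prop :=
  Measurable (Function.uncurry a) ∧
    ∀ᵐ s ∂(volume.restrict (Ioc 0 t)), a s =ᵐ[fockMeasure J ι] (A s)

/-- `ψ` is the QS integral of `𝐂` over `]0,t]`, applied to `φ`: for almost all chains `τ`,
`ψ(τ) = ∫₀ᵗ (C⁻₊(s) φ + C⁻ₒ(s) φₛ)(τ) ds + ∑_{s ∈ τ, s ≤ t} (Cᵒ₊(s) φ + Cᵒₒ(s) φₛ)(τ \ s)`. -/
def IsQSIntegral (C : MatrixProcess J) (t : ℝ) (φ : GPlus J Unit) (ψ : Sect J Unit) : Prop :=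
  ∃ (a b : ℝ → Chain J × Unit → ℂ) (c d : ℝ → Chain J × J → ℂ),
    IsVersion t (fun s => (C.time s φ : Sect J Unit)) a ∧
    IsVersion t (fun s => (C.annihilation s (atPoint φ s) : Sect J Unit)) b ∧
    IsVersion t (fun s => (C.creation s φ : Sect J J)) c ∧
    IsVersion t (fun s => (C.number s (atPoint φ s) : Sect J J)) d ∧
    (∀ᵐ x ∂(fockMeasure J Unit), IntegrableOn (fun s => a s x + b s x) (Ioc 0 t)) ∧
    ψ =ᵐ[fockMeasure J Unit] fun x =>
      (∫ s in Ioc 0 t, (a s x + b s x)) +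
        ∑ p ∈ x.1.points with p.1 ≤ t,
          (c p.1 (x.1.erase p, p.2) + d p.1 (x.1.erase p, p.2))

end Integral

end QSC

end

open QSC

noncomputable section

namespace QSC

universe u v w

set_option linter.unusedSectionVars false

open Filter Topology

/-! ### Measurability on the space of chains -/

section ChainMeasurability

variable {J : Type u}

/-! The estimates rest on one identity and one inequality. The identity is the sum-integral formula
`lintegral_sum_erase`: integrating over τ the sum of G(p, τ \ p) over p ∈ τ amounts to integrating
G(p, τ) over independent p and τ. It holds because deleting a coordinate of an increasing tuple
leaves an increasing tuple, and a point with a new time fits into exactly one place. The inequality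
is (n + 1) ζⁿ ε ≤ (ζ + ε)ⁿ⁺¹ (`mul_pow_le`): a factor |τ| is absorbed by moving the exponent by ε,
at the price 1/ε. Together they give ∫ ‖φₛ‖(ζ)² ds ≤ ε⁻¹ ‖φ‖(ζ + ε)² (`lintegral_pointVersion_le`)
and the dual bound for the sum over the points of a chain (`eLpNorm_sum_erase_sq_le`). The time term
needs neither, the annihilation and creation terms one of the two, the number term both; hence the
constants 1, ε^(-1/2), ε^(-1/2), ε⁻¹.

For the integral to make sense the integrands need jointly measurable versions. In the separable
Hilbert space 𝒢(ξ) weak measurability implies strong measurability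
(`aestronglyMeasurable_of_inner`), which yields a version (`exists_jointly_measurable`). Since φₛ
itself depends on s, the operator is first moved to the other side of the pairing by its adjoint
(`exists_isVersion_apply`). Two versions agree almost everywhere in (s, τ), and by the sum-integral
formula at all points of almost every chain, so the integral is unique.

Adjoints exist by the Riesz representation with the weight absorbed (`exists_pairing_eq`), and their
norms agree because 𝒢⁺ norms every 𝒢(ξ) (`fockNorm_le_of_pairing`). Pairing the integral with χ ∈ 𝒢⁺
gives four integrals over s (`IsQSIntegral.pairing_eq`) in which χ and φ play symmetric roles,
creation being exchanged with annihilation; this is the adjoint relation.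

The inclusion of 𝒢⁺ in 𝒢₋ acts, at fixed times, by a tensor product of Gram matrices, which is an
injective selfadjoint contraction (`IsGram.pi`). Contractivity makes it well defined,
selfadjointness and injectivity make its range dense. -/

theorem Chain.ext {ω ω' : Chain J} (h : ∀ p, p ∈ ω.points ↔ p ∈ ω'.points) : ω = ω' :=
  Finset.ext h

@[simp] theorem mem_points_chainOfTuple {n : ℕ} {x : Fin n → ℝ × J} {p : ℝ × J} :
    p ∈ (chainOfTuple J n x).points ↔ ∃ i, x i = p := by
  classical
  unfold chainOfTuple Chain.points
  simp

@[simp] theorem mem_points_insert {p q : ℝ × J} {ω : Chain J} :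
    q ∈ (ω.insert p).points ↔ q = p ∨ q ∈ ω.points := by
  classical
  unfold Chain.insert Chain.points
  exact Finset.mem_insert

@[simp] theorem mem_points_erase {p q : ℝ × J} {ω : Chain J} :
    q ∈ (ω.erase p).points ↔ q ≠ p ∧ q ∈ ω.points := by
  classical
  unfold Chain.erase Chain.points
  exact Finset.mem_erase

theorem Chain.insert_erase {p : ℝ × J} {ω : Chain J} (h : p ∈ ω.points) :
    (ω.erase p).insert p = ω := by
  refine Chain.ext fun q => ?_
  by_cases hq : q = p
  · subst hq; simp [h]
  · simp [hq]

theorem Chain.length_erase {p : ℝ × J} {ω : Chain J} (h : p ∈ ω.points) :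
    (ω.erase p).length + 1 = ω.length := by
  classical
  unfold Chain.length Chain.erase Chain.points
  exact Finset.card_erase_add_one h

theorem insert_chainOfTuple {n : ℕ} (p : ℝ × J) (x : Fin n → ℝ × J) :
    (chainOfTuple J n x).insert p = chainOfTuple J (n + 1) (Fin.cons p x) := by
  refine Chain.ext fun q => ?_
  simp only [mem_points_insert, mem_points_chainOfTuple, Fin.exists_fin_succ, Fin.cons_zero,
    Fin.cons_succ, eq_comm]

theorem erase_chainOfTuple {n : ℕ} {x : Fin (n + 1) → ℝ × J} (hx : Function.Injective x)
    (i : Fin (n + 1)) :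
    (chainOfTuple J (n + 1) x).erase (x i) = chainOfTuple J n (fun k => x (i.succAbove k)) := by
  refine Chain.ext fun q => ?_
  simp only [mem_points_erase, mem_points_chainOfTuple]
  constructor
  · rintro ⟨hq, k, rfl⟩
    have hk : k ≠ i := fun h => hq (by rw [h])
    obtain ⟨l, rfl⟩ := Fin.exists_succAbove_eq hk
    exact ⟨l, rfl⟩
  · rintro ⟨k, rfl⟩
    exact ⟨fun h => Fin.succAbove_ne i k (hx h), _, rfl⟩

theorem points_chainOfTuple [DecidableEq (ℝ × J)] {n : ℕ} (x : Fin n → ℝ × J) :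
    (chainOfTuple J n x).points = Finset.univ.image x := by
  ext p; simp

theorem length_chainOfTuple {n : ℕ} {x : Fin n → ℝ × J} (hx : Function.Injective x) :
    (chainOfTuple J n x).length = n := by
  classical
  rw [Chain.length, points_chainOfTuple, Finset.card_image_of_injective _ hx, Finset.card_univ,
    Fintype.card_fin]

theorem sum_points_chainOfTuple {M : Type*} [AddCommMonoid M] {n : ℕ} {x : Fin n → ℝ × J}
    (hx : Function.Injective x) (f : ℝ × J → M) :
    ∑ p ∈ (chainOfTuple J n x).points, f p = ∑ i, f (x i) := by
  classical
  rw [points_chainOfTuple, Finset.sum_image (fun a _ b _ h => hx h)]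

/-- Sorting by an injective function of the marked point, and not by time, reaches every chain, also
those with coinciding times, so no null set has to be set aside. -/
theorem exists_sorted_tuple (e : ℝ × J → ℝ) (he : Function.Injective e) (ω : Chain J) :
    ∃ n, ∃ x : Fin n → ℝ × J, StrictMono (e ∘ x) ∧ chainOfTuple J n x = ω := by
  classical
  have hmem : ∀ i : Fin (ω.points.image e).card,
      ∃ p ∈ ω.points, e p = (ω.points.image e).orderEmbOfFin rfl i := fun i =>
    Finset.mem_image.1 ((ω.points.image e).orderEmbOfFin_mem rfl i)
  choose y hy hey using hmem
  refine ⟨_, y, ?_, ?_⟩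
  · intro i j hij
    simp only [Function.comp, hey]
    exact ((ω.points.image e).orderEmbOfFin rfl).strictMono hij
  · refine Chain.ext fun q => ?_
    rw [mem_points_chainOfTuple]
    constructor
    · rintro ⟨i, rfl⟩; exact hy i
    · intro hq
      have : e q ∈ Set.range ((ω.points.image e).orderEmbOfFin rfl) := by
        rw [Finset.range_orderEmbOfFin]; exact Finset.mem_coe.2 (Finset.mem_image_of_mem e hq)
      obtain ⟨i, hi⟩ := this
      exact ⟨i, he (by rw [hey, hi])⟩

theorem sorted_tuple_unique {e : ℝ × J → ℝ} (he : Function.Injective e) {n : ℕ}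
    {x y : Fin n → ℝ × J} (hx : StrictMono (e ∘ x)) (hy : StrictMono (e ∘ y))
    (h : chainOfTuple J n x = chainOfTuple J n y) : x = y := by
  have hr : range x = range y := by
    ext p
    simpa using (by rw [h] : p ∈ (chainOfTuple J n x).points ↔ p ∈ (chainOfTuple J n y).points)
  have : e ∘ x = e ∘ y := (hx.range_inj hy).1 (by rw [range_comp, range_comp, hr])
  funext i
  exact he (congrFun this i)

/-- The increasing enumeration of a chain with `n` points with respect to an injective
real-valued function. -/
def sortedTuple (e : ℝ × J → ℝ) (n : ℕ) [Nonempty (Fin n → ℝ × J)] (ω : Chain J) :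
    Fin n → ℝ × J :=
  open Classical in
  if h : ∃ x : Fin n → ℝ × J, StrictMono (e ∘ x) ∧ chainOfTuple J n x = ω then h.choose
  else Classical.arbitrary _

theorem chainOfTuple_sortedTuple {e : ℝ × J → ℝ} {n : ℕ} [Nonempty (Fin n → ℝ × J)]
    {ω : Chain J} (h : ∃ x : Fin n → ℝ × J, StrictMono (e ∘ x) ∧ chainOfTuple J n x = ω) :
    StrictMono (e ∘ sortedTuple e n ω) ∧ chainOfTuple J n (sortedTuple e n ω) = ω := by
  rw [sortedTuple, dif_pos h]; exact h.choose_spec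

variable [MeasurableSpace J]

theorem measurableSet_chain {S : Set (Chain J)} :
    MeasurableSet S ↔ ∀ n, MeasurableSet (chainOfTuple J n ⁻¹' S) := by
  change MeasurableSet[⨅ n : ℕ, MeasurableSpace.map (chainOfTuple J n) inferInstance] S ↔ _
  rw [MeasurableSpace.measurableSet_iInf]
  rfl

theorem measurable_chainOfTuple (n : ℕ) : Measurable (chainOfTuple J n) := fun _ hS =>
  measurableSet_chain.1 hS n

variable [Countable J] [DiscreteMeasurableSpace J]

theorem exists_injective_measurable_real :
    ∃ e : ℝ × J → ℝ, Function.Injective e ∧ Measurable e := by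
  have : StandardBorelSpace J := standardBorelSpace_of_discreteMeasurableSpace
  obtain ⟨e, he⟩ := exists_measurableEmbedding_real (ℝ × J)
  exact ⟨e, he.injective, he.measurable⟩

/-- The sorted tuple y can only list entries of x, so y = x ∘ f for one of finitely many index maps
f. This replaces the quantifier over y by a finite union of measurable sets. -/
theorem measurableSet_sorted_preimage {e : ℝ × J → ℝ} (hm : Measurable e)
    (n m : ℕ) {B : Set (Fin m → ℝ × J)} (hB : MeasurableSet B) :
    MeasurableSet {x : Fin n → ℝ × J | ∃ y ∈ B, StrictMono (e ∘ y) ∧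
      chainOfTuple J m y = chainOfTuple J n x} := by
  have : StandardBorelSpace J := standardBorelSpace_of_discreteMeasurableSpace
  have key : {x : Fin n → ℝ × J | ∃ y ∈ B, StrictMono (e ∘ y) ∧
      chainOfTuple J m y = chainOfTuple J n x} = ⋃ f : Fin m → Fin n,
        {x | (fun k => x (f k)) ∈ B} ∩
        ({x | ∀ i j, i < j → e (x (f i)) < e (x (f j))} ∩ {x | ∀ i, ∃ k, x i = x (f k)}) := by
    ext x
    simp only [mem_ofPred_eq, mem_iUnion, mem_inter_iff]
    constructor
    · rintro ⟨y, hyB, hy, hyx⟩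
      have hy' : ∀ k, ∃ i, x i = y k := fun k =>
        mem_points_chainOfTuple.1 (hyx ▸ mem_points_chainOfTuple.2 ⟨k, rfl⟩)
      choose f hf using hy'
      refine ⟨f, ?_, ?_, ?_⟩
      · rwa [show (fun k => x (f k)) = y from funext hf]
      · intro i j hij; rw [hf, hf]; exact hy hij
      · intro i
        obtain ⟨k, hk⟩ := mem_points_chainOfTuple.1 (hyx ▸ mem_points_chainOfTuple.2 ⟨i, rfl⟩)
        exact ⟨k, by rw [hf, hk]⟩
    · rintro ⟨f, hB', hs, hc⟩
      refine ⟨_, hB', fun i j hij => hs i j hij, Chain.ext fun q => ?_⟩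
      simp only [mem_points_chainOfTuple]
      constructor
      · rintro ⟨k, rfl⟩; exact ⟨_, rfl⟩
      · rintro ⟨i, rfl⟩
        obtain ⟨k, hk⟩ := hc i
        exact ⟨k, hk.symm⟩
  rw [key]
  refine MeasurableSet.iUnion fun f => MeasurableSet.inter ?_ (MeasurableSet.inter ?_ ?_)
  · exact (measurable_pi_lambda _ fun k => measurable_pi_apply _) hB
  · simp only [ofPred_forall]
    refine MeasurableSet.iInter fun i => MeasurableSet.iInter fun j => MeasurableSet.iInter fun _ =>
      measurableSet_lt (hm.comp (measurable_pi_apply _)) (hm.comp (measurable_pi_apply _))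
  · simp only [ofPred_forall, ofPred_exists]
    refine MeasurableSet.iInter fun i => MeasurableSet.iUnion fun k =>
      measurableSet_eq_fun (measurable_pi_apply _) (measurable_pi_apply _)

theorem measurableSet_sortable {e : ℝ × J → ℝ} (hm : Measurable e) (m : ℕ) :
    MeasurableSet {ω : Chain J | ∃ y : Fin m → ℝ × J, StrictMono (e ∘ y) ∧
      chainOfTuple J m y = ω} := by
  refine measurableSet_chain.2 fun n => ?_
  have := measurableSet_sorted_preimage (J := J) hm n m MeasurableSet.univ
  simpa using this

theorem measurable_sortedTuple {e : ℝ × J → ℝ} (he : Function.Injective e) (hm : Measurable e)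
    (m : ℕ) [Nonempty (Fin m → ℝ × J)] : Measurable (sortedTuple (J := J) e m) := by
  classical
  intro B hB
  have : sortedTuple (J := J) e m ⁻¹' B =
      {ω | ∃ y ∈ B, StrictMono (e ∘ y) ∧ chainOfTuple J m y = ω} ∪
      ({ω | ∃ y : Fin m → ℝ × J, StrictMono (e ∘ y) ∧ chainOfTuple J m y = ω}ᶜ ∩
        {_ω | Classical.arbitrary (Fin m → ℝ × J) ∈ B}) := by
    ext ω
    simp only [mem_preimage, mem_union, mem_inter_iff, mem_compl_iff]
    by_cases h : ∃ y : Fin m → ℝ × J, StrictMono (e ∘ y) ∧ chainOfTuple J m y = ω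
    · have hs := chainOfTuple_sortedTuple h
      simp only [mem_ofPred_eq, h, not_true, false_and, or_false]
      constructor
      · exact fun hB' => ⟨_, hB', hs⟩
      · rintro ⟨y, hy, hy1, hy2⟩
        rwa [sorted_tuple_unique he hs.1 hy1 (hs.2.trans hy2.symm)]
    · have h' : ¬ ∃ y ∈ B, StrictMono (e ∘ y) ∧ chainOfTuple J m y = ω :=
        fun ⟨y, _, hy⟩ => h ⟨y, hy⟩
      simp only [mem_ofPred_eq, h, h', sortedTuple, dif_neg, not_false_eq_true, true_and, false_or]
  rw [this]
  refine MeasurableSet.union ?_ (MeasurableSet.inter (measurableSet_sortable hm m).compl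
    (MeasurableSet.const _))
  exact measurableSet_chain.2 fun n => measurableSet_sorted_preimage hm n m hB

/-- The σ-algebra on chains is defined by maps out of it, which says nothing about products. Sorting
supplies a measurable section of the tuple map on each of countably many measurable pieces, and
products cause no trouble for sections. -/
theorem measurable_prod_chain {Y Z : Type*} [MeasurableSpace Y] [MeasurableSpace Z]
    {f : Y × Chain J → Z}
    (h : ∀ n, Measurable fun q : Y × (Fin n → ℝ × J) => f (q.1, chainOfTuple J n q.2)) :
    Measurable f := by
  obtain ⟨e, he, hm⟩ := exists_injective_measurable_real (J := J)
  rcases isEmpty_or_nonempty J with hJ | hJ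
  · have : f = fun y => f (y.1, chainOfTuple J 0 Fin.elim0) := by
      funext y
      have : y.2 = chainOfTuple J 0 Fin.elim0 := Chain.ext fun p => isEmptyElim p.2
      rw [← this]
    rw [this]
    exact (h 0).comp (measurable_fst.prodMk measurable_const)
  · intro S hS
    have : f ⁻¹' S = ⋃ m, ((Prod.snd ⁻¹' {ω : Chain J | ∃ y : Fin m → ℝ × J,
        StrictMono (e ∘ y) ∧ chainOfTuple J m y = ω}) ∩
        {y | f (y.1, chainOfTuple J m (sortedTuple e m y.2)) ∈ S}) := by
      ext ⟨y, ω⟩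
      simp only [mem_preimage, mem_iUnion, mem_inter_iff, mem_ofPred_eq]
      constructor
      · intro hf
        obtain ⟨m, x, hx⟩ := exists_sorted_tuple e he ω
        exact ⟨m, ⟨x, hx⟩, by rwa [(chainOfTuple_sortedTuple ⟨x, hx⟩).2]⟩
      · rintro ⟨m, hx, hf⟩
        rwa [(chainOfTuple_sortedTuple hx).2] at hf
    rw [this]
    refine MeasurableSet.iUnion fun m => MeasurableSet.inter
      (measurable_snd (measurableSet_sortable hm m)) ?_
    exact (h m).comp (measurable_fst.prodMk
      ((measurable_sortedTuple he hm m).comp measurable_snd)) hS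

/-- The σ-algebra is pulled back from a countably generated one by the sorted enumerations.
Countable generation makes the spaces 𝒢(η) separable. -/
instance : MeasurableSpace.CountablyGenerated (Chain J) := by
  obtain ⟨e, he, hm⟩ := exists_injective_measurable_real (J := J)
  have : StandardBorelSpace J := standardBorelSpace_of_discreteMeasurableSpace
  rcases isEmpty_or_nonempty J with hJ | hJ
  · have : Subsingleton (Chain J) := ⟨fun a b => Chain.ext fun p => isEmptyElim p.2⟩
    infer_instance
  · classical
    let σ : Chain J → (ℕ → Prop) × (∀ m : ℕ, Fin m → ℝ × J) := fun ω =>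
      (fun m => ∃ y : Fin m → ℝ × J, StrictMono (e ∘ y) ∧ chainOfTuple J m y = ω,
        fun m => sortedTuple e m ω)
    have hσ : Measurable σ := by
      refine Measurable.prodMk (measurable_pi_lambda _ fun m => ?_)
        (measurable_pi_lambda _ fun m => measurable_sortedTuple he hm m)
      exact measurable_to_prop (by simpa [preimage] using measurableSet_sortable hm m)
    have : chainMeasurableSpace J = MeasurableSpace.comap σ inferInstance := by
      refine le_antisymm (fun S hS => ?_) hσ.comap_le
      refine ⟨⋃ m, {z | z.1 m} ∩ {z | chainOfTuple J m (z.2 m) ∈ S}, ?_, ?_⟩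
      · refine MeasurableSet.iUnion fun m => MeasurableSet.inter ?_ ?_
        · exact measurableSet_setOfPred.2 ((measurable_pi_apply m).comp measurable_fst)
        · exact ((measurable_chainOfTuple m).comp
            ((measurable_pi_apply m).comp measurable_snd)) hS
      · ext ω
        simp only [mem_preimage, mem_iUnion, mem_inter_iff, mem_ofPred_eq, σ]
        constructor
        · rintro ⟨m, hx, hf⟩
          rwa [(chainOfTuple_sortedTuple hx).2] at hf
        · intro hf
          obtain ⟨m, x, hx⟩ := exists_sorted_tuple e he ω
          exact ⟨m, ⟨x, hx⟩, by rwa [(chainOfTuple_sortedTuple ⟨x, hx⟩).2]⟩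
    rw [this]
    exact MeasurableSpace.CountablyGenerated.comap _

theorem measurable_insert :
    Measurable fun q : (ℝ × J) × Chain J => q.2.insert q.1 := by
  refine measurable_prod_chain fun n => ?_
  simp only [insert_chainOfTuple]
  refine (measurable_chainOfTuple (n + 1)).comp ?_
  refine measurable_pi_lambda _ fun i => ?_
  refine Fin.cases ?_ (fun k => ?_) i
  · simpa using measurable_fst
  · simpa [Function.comp_def] using (measurable_pi_apply k).comp measurable_snd

theorem measurable_insert_snd :
    Measurable fun q : ℝ × (Chain J × J) => q.2.1.insert (q.1, q.2.2) :=
  measurable_insert.comp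
    ((measurable_fst.prodMk (measurable_snd.comp measurable_snd)).prodMk
      (measurable_fst.comp measurable_snd))

theorem measurable_length : Measurable (Chain.length : Chain J → ℕ) := by
  obtain ⟨e, he, hm⟩ := exists_injective_measurable_real (J := J)
  refine measurable_to_countable' fun m => ?_
  convert measurableSet_sortable hm m using 1
  ext ω
  simp only [mem_preimage, mem_singleton_iff, mem_ofPred_eq]
  constructor
  · rintro rfl
    obtain ⟨m, x, hx, rfl⟩ := exists_sorted_tuple e he ω
    have : (chainOfTuple J m x).length = m := length_chainOfTuple hx.injective.of_comp
    rw [this]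
    exact ⟨x, hx, rfl⟩
  · rintro ⟨x, hx, rfl⟩
    exact length_chainOfTuple hx.injective.of_comp

/-- `τ ↦ ∑_{p ∈ τ} G(p, τ \ p)` is measurable. -/
theorem measurable_of_injective_tuples {M : Type*} [MeasurableSpace M] {F : Chain J → M}
    (hg : ∀ m, ∃ g : (Fin m → ℝ × J) → M, Measurable g ∧
      ∀ x, Function.Injective x → F (chainOfTuple J m x) = g x) : Measurable F := by
  obtain ⟨e, he, hm⟩ := exists_injective_measurable_real (J := J)
  rcases isEmpty_or_nonempty J with hJ | hJ
  · have : Subsingleton (Chain J) := ⟨fun a b => Chain.ext fun p => isEmptyElim p.2⟩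
    exact Measurable.of_discrete
  choose g hg hFg using hg
  intro S hS
  -- Only sorted tuples enter, and these are injective, so the values of `F` at tuples with
  -- repetitions do not matter.
  have : F ⁻¹' S = ⋃ m, ({ω : Chain J | ∃ y : Fin m → ℝ × J,
        StrictMono (e ∘ y) ∧ chainOfTuple J m y = ω} ∩ (sortedTuple e m ⁻¹' (g m ⁻¹' S))) := by
    have key : ∀ (m : ℕ) (ω : Chain J), (∃ y : Fin m → ℝ × J,
        StrictMono (e ∘ y) ∧ chainOfTuple J m y = ω) → F ω = g m (sortedTuple e m ω) := by
      intro m ω h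
      obtain ⟨h1, h2⟩ := chainOfTuple_sortedTuple h
      rw [← hFg m _ h1.injective.of_comp, h2]
    ext ω
    simp only [mem_preimage, mem_iUnion, mem_inter_iff, mem_ofPred_eq]
    constructor
    · intro hf
      obtain ⟨m, x, hx⟩ := exists_sorted_tuple e he ω
      exact ⟨m, ⟨x, hx⟩, by rwa [← key m ω ⟨x, hx⟩]⟩
    · rintro ⟨m, hx, hf⟩
      rwa [key m ω hx]
  rw [this]
  exact MeasurableSet.iUnion fun m => MeasurableSet.inter (measurableSet_sortable hm m)
    (measurable_sortedTuple he hm m (hg m hS))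

/-- On an injective tuple the points are the coordinates and erasing a point deletes a coordinate,
so the sum becomes a finite sum over indices. -/
theorem measurable_sum_erase {M : Type*} [AddCommMonoid M] [MeasurableSpace M] [MeasurableAdd₂ M]
    {G : ℝ × (Chain J × J) → M} (hG : Measurable G) :
    Measurable fun ω : Chain J => ∑ p ∈ ω.points, G (p.1, (ω.erase p, p.2)) := by
  set F : Chain J → M := fun ω => ∑ p ∈ ω.points, G (p.1, (ω.erase p, p.2)) with hF
  refine measurable_of_injective_tuples fun m => ?_
  · cases m with
    | zero =>
      refine ⟨fun _ => 0, measurable_const, fun x hx => ?_⟩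
      simp only [hF]
      rw [sum_points_chainOfTuple hx]
      simp
    | succ m =>
      refine ⟨fun x => ∑ i, G ((x i).1, (chainOfTuple J m fun k => x (i.succAbove k), (x i).2)),
        ?_, fun x hx => ?_⟩
      · refine Finset.measurable_fun_sum _ fun i _ => hG.comp ?_
        exact ((measurable_pi_apply i).fst).prodMk (Measurable.prodMk
          ((measurable_chainOfTuple _).comp (measurable_pi_lambda _ fun k =>
            measurable_pi_apply _)) (measurable_pi_apply i).snd)
      · simp only [hF]
        rw [sum_points_chainOfTuple hx]
        exact Finset.sum_congr rfl fun i _ => by rw [erase_chainOfTuple hx]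

end ChainMeasurability

/-! ### The integral over chains -/

section StrictMonoInsert

theorem strictMono_insertNth_iff {n : ℕ} (i : Fin (n + 1)) (c : ℝ) (t : Fin n → ℝ) :
    StrictMono (i.insertNth c t : Fin (n + 1) → ℝ) ↔ StrictMono t ∧
      (∀ k : Fin n, k.castSucc < i → t k < c) ∧ (∀ k : Fin n, i ≤ k.castSucc → c < t k) := by
  constructor
  · intro h
    refine ⟨fun a b hab => ?_, fun k hk => ?_, fun k hk => ?_⟩
    · have := h (i.strictMono_succAbove hab)
      simpa using this
    · have := h (show i.succAbove k < i by rwa [Fin.succAbove_of_castSucc_lt _ _ hk])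
      simpa using this
    · have := h (show i < i.succAbove k by
        rw [Fin.succAbove_of_le_castSucc _ _ hk]
        exact Fin.lt_def.2 (Nat.lt_succ_of_le hk))
      simpa using this
  · rintro ⟨h1, h2, h3⟩ a b hab
    rcases Fin.eq_self_or_eq_succAbove i a with rfl | ⟨k, rfl⟩
    · rcases Fin.eq_self_or_eq_succAbove a b with rfl | ⟨l, rfl⟩
      · exact absurd hab (lt_irrefl _)
      · simp only [Fin.insertNth_apply_same, Fin.insertNth_apply_succAbove]
        refine h3 l ?_
        by_contra hl
        rw [Fin.succAbove_of_castSucc_lt _ _ (not_le.1 hl)] at hab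
        exact absurd (hab.trans (not_le.1 hl)) (lt_irrefl _)
    · rcases Fin.eq_self_or_eq_succAbove i b with rfl | ⟨l, rfl⟩
      · simp only [Fin.insertNth_apply_same, Fin.insertNth_apply_succAbove]
        refine h2 k ?_
        by_contra hl
        rw [Fin.succAbove_of_le_castSucc _ _ (not_lt.1 hl)] at hab
        have : (k.castSucc : ℕ) + 1 < b := hab
        have h' : (b : ℕ) ≤ k.castSucc := not_lt.1 hl
        omega
      · simp only [Fin.insertNth_apply_succAbove]
        exact h1 ((i.strictMono_succAbove).lt_iff_lt.1 hab)

/-- The place is just before the first entry exceeding c, or the end. This is the combinatorial core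
of the sum-integral formula. -/
theorem existsUnique_strictMono_insertNth {n : ℕ} {c : ℝ} {t : Fin n → ℝ} (ht : StrictMono t)
    (hc : ∀ k, c ≠ t k) : ∃! i : Fin (n + 1), StrictMono (i.insertNth c t : Fin (n + 1) → ℝ) := by
  classical
  have hex : ∃ i : Fin (n + 1), StrictMono (i.insertNth c t : Fin (n + 1) → ℝ) := by
    by_cases h : ∃ k, c < t k
    · obtain ⟨k, hk, hmin⟩ := WellFounded.has_min (wellFounded_lt (α := Fin n)) {k | c < t k} h
      refine ⟨k.castSucc, (strictMono_insertNth_iff _ _ _).2 ⟨ht, fun l hl => ?_, fun l hl => ?_⟩⟩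
      · by_contra hcon
        have hlk : l < k := hl
        exact hmin l (lt_of_le_of_ne (not_lt.1 hcon) (hc l)) hlk
      · exact lt_of_lt_of_le hk (ht.monotone (show k ≤ l from hl))
    · push Not at h
      refine ⟨Fin.last n, (strictMono_insertNth_iff _ _ _).2 ⟨ht, fun l _ => ?_, fun l hl => ?_⟩⟩
      · exact lt_of_le_of_ne (h l) (hc l).symm
      · exact absurd hl (not_le.2 (Fin.castSucc_lt_last l))
  have huniq : ∀ i j : Fin (n + 1), StrictMono (i.insertNth c t : Fin (n + 1) → ℝ) →
      StrictMono (j.insertNth c t : Fin (n + 1) → ℝ) → ¬ i < j := by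
    intro i j hi hj hij
    have hin : (i : ℕ) < n := lt_of_lt_of_le hij (Nat.lt_succ_iff.1 j.2)
    have h1 := ((strictMono_insertNth_iff _ _ _).1 hj).2.1 ⟨i, hin⟩ hij
    have h2 := ((strictMono_insertNth_iff _ _ _).1 hi).2.2 ⟨i, hin⟩ le_rfl
    exact absurd h1 (not_lt.2 h2.le)
  obtain ⟨i, hi⟩ := hex
  exact ⟨i, hi, fun j hj => le_antisymm (not_lt.1 (huniq i j hi hj)) (not_lt.1 (huniq j i hj hi))⟩

end StrictMonoInsert

/-! ### The sum-integral formula for removing a point from a chain. -/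

section Mecke

open scoped ProbabilityTheory

variable {J : Type u} [MeasurableSpace J]

/-- The measure on marked points. -/
def pointMeasure (J : Type u) [MeasurableSpace J] : Measure (ℝ × J) :=
  (volume.restrict (Ioi (0 : ℝ))).prod (Measure.count : Measure J)

/-- Tuples with increasing times. -/
def increasing (J : Type u) (n : ℕ) : Set (Fin n → ℝ × J) :=
  {x | StrictMono fun i => (x i).1}

theorem increasing_injective {n : ℕ} {x : Fin n → ℝ × J} (hx : x ∈ increasing J n) :
    Function.Injective x :=
  Function.Injective.of_comp (f := Prod.fst) (StrictMono.injective hx)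

theorem measurableSet_increasing (n : ℕ) : MeasurableSet (increasing J n) := by
  have : increasing J n = {x | ∀ i j, i < j → (x i).1 < (x j).1} := rfl
  rw [this]
  simp only [ofPred_forall]
  exact MeasurableSet.iInter fun i => MeasurableSet.iInter fun j => MeasurableSet.iInter fun _ =>
      measurableSet_lt (measurable_pi_apply _).fst (measurable_pi_apply _).fst

theorem lintegral_chainMeasure {F : Chain J → ℝ≥0∞} (hF : Measurable F) :
    ∫⁻ ω, F ω ∂(chainMeasure J) = ∑' n : ℕ, ∫⁻ x in increasing J n, F (chainOfTuple J n x)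
      ∂(Measure.pi fun _ : Fin n => pointMeasure J) := by
  rw [chainMeasure, lintegral_sum_measure]
  refine tsum_congr fun n => ?_
  rw [lintegral_map hF (measurable_chainOfTuple n)]
  rfl

variable [Countable J] [DiscreteMeasurableSpace J]

instance : SigmaFinite (pointMeasure J) := by unfold pointMeasure; infer_instance

instance : SFinite (chainMeasure J) := by unfold chainMeasure; infer_instance

/-- Lebesgue measure has no atoms, so the fibre over each tuple is null. -/
theorem ae_ne_times (n : ℕ) (k : Fin n) :
    ∀ᵐ q ∂((pointMeasure J).prod (Measure.pi fun _ : Fin n => pointMeasure J)),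
      q.1.1 ≠ (q.2 k).1 := by
  have hms : MeasurableSet {q : (ℝ × J) × (Fin n → ℝ × J) | q.1.1 = (q.2 k).1} :=
    measurableSet_eq_fun measurable_fst.fst ((measurable_pi_apply k).comp measurable_snd).fst
  rw [ae_iff]
  simp only [not_not]
  rw [Measure.prod_apply_symm hms]
  refine lintegral_eq_zero_of_ae_eq_zero (ae_of_all _ fun y => ?_)
  have : (fun x : ℝ × J => (x, y)) ⁻¹' {q | q.1.1 = (q.2 k).1} = {(y k).1} ×ˢ univ := by
    ext x; simp
  simp only [this, pointMeasure, Measure.prod_prod]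
  simp

/-- Splitting off coordinate i preserves the product measure and sends the increasing tuples to the
pairs (p, y) for which inserting p at place i is increasing. By `existsUnique_strictMono_insertNth`
these n + 1 sets partition, up to a null set, the pairs with y increasing and p arbitrary. -/
theorem lintegral_increasing_sum (n : ℕ) {G : (ℝ × J) × (Fin n → ℝ × J) → ℝ≥0∞}
    (hG : Measurable G) :
    ∫⁻ x in increasing J (n + 1), ∑ i, G (x i, fun k => x (i.succAbove k))
      ∂(Measure.pi fun _ : Fin (n + 1) => pointMeasure J) =
    ∫⁻ p, ∫⁻ y in increasing J n, G (p, y) ∂(Measure.pi fun _ : Fin n => pointMeasure J)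
      ∂(pointMeasure J) := by
  classical
  have h1 : ∀ i : Fin (n + 1),
      ∫⁻ x in increasing J (n + 1), G (x i, fun k => x (i.succAbove k))
        ∂(Measure.pi fun _ : Fin (n + 1) => pointMeasure J) =
      ∫⁻ q, {q : (ℝ × J) × (Fin n → ℝ × J) |
          StrictMono (i.insertNth q.1.1 (fun k => (q.2 k).1) : Fin (n + 1) → ℝ)}.indicator G q
        ∂((pointMeasure J).prod (Measure.pi fun _ : Fin n => pointMeasure J)) := by
    intro i
    rw [← lintegral_indicator (measurableSet_increasing _),
      ← (measurePreserving_piFinSuccAbove (fun _ : Fin (n + 1) => pointMeasure J) i).lintegral_comp_emb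
        (MeasurableEquiv.measurableEmbedding _)]
    refine lintegral_congr fun x => ?_
    have hx : (i.insertNth (x i).1 (fun k => (x (i.succAbove k)).1) : Fin (n + 1) → ℝ) =
        fun k => (x k).1 := by
      funext k
      rcases Fin.eq_self_or_eq_succAbove i k with rfl | ⟨l, rfl⟩ <;> simp
    change _ = indicator _ G (x i, fun k => x (i.succAbove k))
    simp only [indicator, mem_ofPred_eq, hx]
    by_cases h : StrictMono fun k => (x k).1
    · rw [if_pos h, if_pos (show x ∈ increasing J (n + 1) from h)]
    · rw [if_neg h, if_neg (show x ∉ increasing J (n + 1) from h)]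
  have hms : ∀ i : Fin (n + 1), Measurable fun x : Fin (n + 1) → ℝ × J =>
      G (x i, fun k => x (i.succAbove k)) := fun i => hG.comp
    ((measurable_pi_apply i).prodMk (measurable_pi_lambda _ fun k => measurable_pi_apply _))
  have hms2 : ∀ i : Fin (n + 1), MeasurableSet {q : (ℝ × J) × (Fin n → ℝ × J) |
          StrictMono (i.insertNth q.1.1 (fun k => (q.2 k).1) : Fin (n + 1) → ℝ)} := by
    intro i
    have : {q : (ℝ × J) × (Fin n → ℝ × J) |
          StrictMono (i.insertNth q.1.1 (fun k => (q.2 k).1) : Fin (n + 1) → ℝ)} =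
        {q | ∀ a b : Fin (n + 1), a < b →
          (i.insertNth q.1.1 (fun k => (q.2 k).1) : Fin (n + 1) → ℝ) a <
          (i.insertNth q.1.1 (fun k => (q.2 k).1) : Fin (n + 1) → ℝ) b} := rfl
    have hm : ∀ a, Measurable fun q : (ℝ × J) × (Fin n → ℝ × J) =>
        (i.insertNth q.1.1 (fun k => (q.2 k).1) : Fin (n + 1) → ℝ) a := by
      intro a
      rcases Fin.eq_self_or_eq_succAbove i a with rfl | ⟨l, rfl⟩
      · simpa using measurable_fst.fst
      · simp only [Fin.insertNth_apply_succAbove]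
        exact ((measurable_pi_apply l).comp measurable_snd).fst
    rw [this]
    simp only [ofPred_forall]
    exact MeasurableSet.iInter fun i => MeasurableSet.iInter fun j => MeasurableSet.iInter fun _ =>
      measurableSet_lt (hm _) (hm _)
  rw [lintegral_finsetSum _ fun i _ => hms i]
  simp only [h1]
  rw [← lintegral_finsetSum _ fun i _ => hG.indicator (hms2 i)]
  have h2 : ∀ p : ℝ × J, ∫⁻ y in increasing J n, G (p, y)
      ∂(Measure.pi fun _ : Fin n => pointMeasure J) =
      ∫⁻ y, (univ ×ˢ increasing J n).indicator G (p, y)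
        ∂(Measure.pi fun _ : Fin n => pointMeasure J) := by
    intro p
    rw [← lintegral_indicator (measurableSet_increasing _)]
    refine lintegral_congr fun y => ?_
    simp [indicator]
  simp only [h2]
  rw [← lintegral_prod _ (hG.indicator
    (MeasurableSet.univ.prod (measurableSet_increasing n))).aemeasurable]
  refine lintegral_congr_ae ?_
  filter_upwards [ae_all_iff.2 fun k => ae_ne_times (J := J) n k] with q hq
  by_cases hy : StrictMono fun k => (q.2 k).1
  · obtain ⟨i, hi, hu⟩ := existsUnique_strictMono_insertNth hy hq
    rw [Finset.sum_eq_single i]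
    · rw [indicator_of_mem hi, indicator_of_mem (show q ∈ univ ×ˢ increasing J n from ⟨trivial, hy⟩)]
    · exact fun j _ hj => indicator_of_notMem (fun h => hj (hu j h)) _
    · simp
  · rw [indicator_of_notMem (fun h => hy h.2)]
    exact Finset.sum_eq_zero fun i _ => indicator_of_notMem
      (fun h => hy ((strictMono_insertNth_iff _ _ _).1 h).1) _

theorem lintegral_chain_sum {G : (ℝ × J) × Chain J → ℝ≥0∞} (hG : Measurable G) :
    ∫⁻ ω, ∑ p ∈ ω.points, G (p, ω.erase p) ∂(chainMeasure J) =
      ∫⁻ p, ∫⁻ ω, G (p, ω) ∂(chainMeasure J) ∂(pointMeasure J) := by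
  have hm : Measurable fun ω : Chain J => ∑ p ∈ ω.points, G (p, ω.erase p) :=
    measurable_sum_erase (G := fun q : ℝ × (Chain J × J) => G ((q.1, q.2.2), q.2.1))
      (hG.comp ((measurable_fst.prodMk measurable_snd.snd).prodMk measurable_snd.fst))
  -- Removing a point lowers the length by one: length n + 1 on the left matches length n on the
  -- right, and the empty chain contributes nothing.
  rw [lintegral_chainMeasure hm, tsum_eq_zero_add' ENNReal.summable]
  have h0 : ∫⁻ x in increasing J 0, ∑ p ∈ (chainOfTuple J 0 x).points,
      G (p, (chainOfTuple J 0 x).erase p) ∂(Measure.pi fun _ : Fin 0 => pointMeasure J) = 0 := by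
    refine (lintegral_congr fun x => ?_).trans lintegral_zero
    rw [sum_points_chainOfTuple (Function.injective_of_subsingleton x)]
    simp
  have h1 : ∀ n : ℕ, ∫⁻ x in increasing J (n + 1), ∑ p ∈ (chainOfTuple J (n + 1) x).points,
      G (p, (chainOfTuple J (n + 1) x).erase p)
        ∂(Measure.pi fun _ : Fin (n + 1) => pointMeasure J) =
      ∫⁻ p, ∫⁻ y in increasing J n, G (p, chainOfTuple J n y)
        ∂(Measure.pi fun _ : Fin n => pointMeasure J) ∂(pointMeasure J) := by
    intro n
    have hG' : Measurable fun q : (ℝ × J) × (Fin n → ℝ × J) => G (q.1, chainOfTuple J n q.2) :=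
      hG.comp (measurable_fst.prodMk ((measurable_chainOfTuple n).comp measurable_snd))
    rw [← lintegral_increasing_sum n hG']
    refine setLIntegral_congr_fun (measurableSet_increasing _) fun x hx => ?_
    have hinj := increasing_injective hx
    simp only
    rw [sum_points_chainOfTuple hinj]
    exact Finset.sum_congr rfl fun i _ => by rw [erase_chainOfTuple hinj]
  rw [h0, zero_add]
  simp only [h1]
  rw [← lintegral_tsum]
  · refine lintegral_congr fun p => ?_
    rw [lintegral_chainMeasure (F := fun ω => G (p, ω)) (hG.comp measurable_prodMk_left)]
  · intro n
    have hG' : Measurable fun q : (ℝ × J) × (Fin n → ℝ × J) => G (q.1, chainOfTuple J n q.2) :=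
      hG.comp (measurable_fst.prodMk ((measurable_chainOfTuple n).comp measurable_snd))
    exact hG'.lintegral_prod_right'.aemeasurable

instance {ι : Type v} [MeasurableSpace ι] [Countable ι] [DiscreteMeasurableSpace ι] :
    SFinite (fockMeasure J ι) := by unfold fockMeasure; infer_instance

theorem lintegral_fockMeasure_unit {F : Chain J × Unit → ℝ≥0∞} (hF : Measurable F) :
    ∫⁻ x, F x ∂(fockMeasure J Unit) = ∫⁻ ω, F (ω, ()) ∂(chainMeasure J) := by
  rw [fockMeasure, lintegral_prod _ hF.aemeasurable]
  simp [lintegral_count]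

/-- The formula `∫ ∑_{p ∈ τ} G(p, τ \ p) dτ = ∫ ∫ G(p, τ) dτ dp`. -/
theorem lintegral_sum_erase {G : ℝ × (Chain J × J) → ℝ≥0∞} (hG : Measurable G) :
    ∫⁻ x, ∑ p ∈ x.1.points, G (p.1, (x.1.erase p, p.2)) ∂(fockMeasure J Unit) =
      ∫⁻ z, G z ∂((volume.restrict (Ioi (0 : ℝ))).prod (fockMeasure J J)) := by
  have hm := measurable_sum_erase hG
  have h0 := lintegral_fockMeasure_unit (J := J) (hm.comp measurable_fst)
  simp only [Function.comp] at h0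
  rw [h0]
  have hG' : Measurable fun q : (ℝ × J) × Chain J => G (q.1.1, (q.2, q.1.2)) :=
    hG.comp (measurable_fst.fst.prodMk (measurable_snd.prodMk measurable_fst.snd))
  have := lintegral_chain_sum hG'
  simp only at this
  rw [this, pointMeasure, lintegral_prod _ hG'.lintegral_prod_right'.aemeasurable,
    lintegral_prod _ hG.aemeasurable]
  refine lintegral_congr fun s => ?_
  rw [fockMeasure, lintegral_prod_symm (fun y => G (s, y))
    (hG.comp measurable_prodMk_left).aemeasurable]

theorem lintegral_sum_erase_le {G : ℝ × (Chain J × J) → ℝ≥0∞} (hG : Measurable G) (t : ℝ) :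
    ∫⁻ x, ∑ p ∈ x.1.points with p.1 ≤ t, G (p.1, (x.1.erase p, p.2)) ∂(fockMeasure J Unit) =
      ∫⁻ z, G z ∂((volume.restrict (Ioc 0 t)).prod (fockMeasure J J)) := by
  have hS : MeasurableSet ((Iic t) ×ˢ (univ : Set (Chain J × J))) :=
    measurableSet_Iic.prod MeasurableSet.univ
  have := lintegral_sum_erase (hG.indicator hS)
  rw [lintegral_indicator hS, ← Measure.prod_restrict, Measure.restrict_univ,
    Measure.restrict_restrict measurableSet_Iic, inter_comm, Ioi_inter_Iic] at this
  rw [← this]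
  refine lintegral_congr fun x => ?_
  rw [Finset.sum_filter]
  refine Finset.sum_congr rfl fun p _ => ?_
  simp [indicator]

theorem measurable_sum_erase_le {M : Type*} [AddCommMonoid M] [MeasurableSpace M]
    [MeasurableAdd₂ M] {G : ℝ × (Chain J × J) → M} (hG : Measurable G) (t : ℝ) :
    Measurable fun x : Chain J × Unit =>
      ∑ p ∈ x.1.points with p.1 ≤ t, G (p.1, (x.1.erase p, p.2)) := by
  have hS : MeasurableSet ((Iic t) ×ˢ (univ : Set (Chain J × J))) :=
    measurableSet_Iic.prod MeasurableSet.univ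
  convert (measurable_sum_erase (hG.indicator hS)).comp measurable_fst using 2 with x
  rw [Finset.sum_filter]
  refine Finset.sum_congr rfl fun p _ => ?_
  simp [indicator]

/-- Apply the sum-integral formula to the indicator of the exceptional set: the number of
exceptional points has integral zero. It makes the sum over the points of a chain insensitive to the
choice of version. -/
theorem ae_forall_points {P : ℝ × (Chain J × J) → Prop} {t : ℝ}
    (h : ∀ᵐ z ∂((volume.restrict (Ioc 0 t)).prod (fockMeasure J J)), P z) :
    ∀ᵐ x ∂(fockMeasure J Unit), ∀ p ∈ x.1.points, p.1 ≤ t → P (p.1, (x.1.erase p, p.2)) := by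
  obtain ⟨S, hPS, hS, hS0⟩ := exists_measurable_superset_of_null (ae_iff.1 h)
  have h1 := lintegral_sum_erase_le (J := J) (measurable_const.indicator hS (f := fun _ => (1 : ℝ≥0∞))) t
  rw [lintegral_indicator hS, setLIntegral_one, hS0, lintegral_eq_zero_iff] at h1
  · filter_upwards [h1] with x hx p hp hpt
    by_contra hcon
    have := (Finset.sum_eq_zero_iff.1 hx) p (Finset.mem_filter.2 ⟨hp, hpt⟩)
    rw [indicator_of_mem (hPS hcon)] at this
    exact one_ne_zero this
  · exact measurable_sum_erase_le (measurable_const.indicator hS) t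

/-- The sum-integral formula with G the indicator of an inserted null set gives zero, since erasing
p and inserting it again returns τ. Hence φ(τ ⊔ s) is well defined for classes of sections. -/
theorem quasiMeasurePreserving_insert :
    Measure.QuasiMeasurePreserving
      (fun z : ℝ × (Chain J × J) => (z.2.1.insert (z.1, z.2.2), ()))
      ((volume.restrict (Ioi (0 : ℝ))).prod (fockMeasure J J)) (fockMeasure J Unit) := by
  have hm : Measurable (fun z : ℝ × (Chain J × J) => (z.2.1.insert (z.1, z.2.2), ())) :=
    measurable_insert_snd.prodMk measurable_const
  refine ⟨hm, Measure.AbsolutelyContinuous.mk fun S hS hS0 => ?_⟩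
  rw [Measure.map_apply hm hS, ← lintegral_indicator_one (hm hS),
    ← lintegral_sum_erase (measurable_one.indicator (hm hS))]
  refine lintegral_eq_zero_of_ae_eq_zero ?_
  filter_upwards [measure_eq_zero_iff_ae_notMem.1 hS0] with x hx
  refine Finset.sum_eq_zero fun p hp => ?_
  rw [indicator_of_notMem]
  simp only [mem_preimage, Chain.insert_erase hp]
  exact hx

/-- The kernel which sends a chain `τ` to the sum of the unit masses at `(p, τ \ p)`, where
`p ∈ τ` has time at most `t`. -/
def eraseKernel (J : Type u) [MeasurableSpace J] [Countable J] [DiscreteMeasurableSpace J] (t : ℝ) :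
    ProbabilityTheory.Kernel (Chain J × Unit) (ℝ × (Chain J × J)) where
  toFun x := ∑ p ∈ x.1.points with p.1 ≤ t, Measure.dirac (p.1, (x.1.erase p, p.2))
  measurable' := by
    refine Measure.measurable_of_measurable_coe _ fun S hS => ?_
    have := measurable_sum_erase_le (J := J)
      (measurable_const.indicator hS (f := fun _ => (1 : ℝ≥0∞))) t
    convert this using 2 with x
    simp only [Measure.coe_finsetSum, Finset.sum_apply, Measure.dirac_apply' _ hS]
    rfl

/-- In this form the sum-integral formula is a composition of a kernel with a measure, so the theory
of Bochner integrals along such compositions yields the complex-valued version directly. -/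
theorem eraseKernel_comp (t : ℝ) :
    ((eraseKernel J t) ∘ₖ (ProbabilityTheory.Kernel.const Unit (fockMeasure J Unit))) () =
      (volume.restrict (Ioc 0 t)).prod (fockMeasure J J) := by
  ext S hS
  rw [ProbabilityTheory.Kernel.comp_apply' _ _ _ hS, ProbabilityTheory.Kernel.const_apply]
  have := lintegral_sum_erase_le (J := J)
      (measurable_const.indicator hS (f := fun _ => (1 : ℝ≥0∞))) t
  rw [lintegral_indicator hS, setLIntegral_one] at this
  rw [← this]
  refine lintegral_congr fun x => ?_
  simp only [eraseKernel, ProbabilityTheory.Kernel.coe_mk, Measure.coe_finsetSum,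
    Finset.sum_apply, Measure.dirac_apply' _ hS]
  rfl

theorem integrable_sum_erase_le {G : ℝ × (Chain J × J) → ℂ} {t : ℝ}
    (hGm : Measurable G)
    (hG : Integrable G ((volume.restrict (Ioc 0 t)).prod (fockMeasure J J))) :
    Integrable (fun x => ∑ p ∈ x.1.points with p.1 ≤ t, G (p.1, (x.1.erase p, p.2)))
      (fockMeasure J Unit) ∧
    ∫ x, ∑ p ∈ x.1.points with p.1 ≤ t, G (p.1, (x.1.erase p, p.2)) ∂(fockMeasure J Unit) =
      ∫ z, G z ∂((volume.restrict (Ioc 0 t)).prod (fockMeasure J J)) := by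
  rw [← eraseKernel_comp] at hG ⊢
  have h1 := hG.integral_comp
  have h2 := ProbabilityTheory.Kernel.integral_comp hG
  have h3 : ∀ x : Chain J × Unit, ∫ z, G z ∂(eraseKernel J t x) =
      ∑ p ∈ x.1.points with p.1 ≤ t, G (p.1, (x.1.erase p, p.2)) := by
    intro x
    simp only [eraseKernel, ProbabilityTheory.Kernel.coe_mk]
    rw [integral_finsetSum_measure]
    · exact Finset.sum_congr rfl fun p _ => integral_dirac' _ _ hGm.stronglyMeasurable
    · exact fun p _ => integrable_dirac' hGm.stronglyMeasurable (by simp)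
  simp only [h3, ProbabilityTheory.Kernel.const_apply] at h1 h2
  exact ⟨h1, h2.symm⟩

end Mecke

/-! ### Norms and duality on the Fock scale -/

section Norms

variable {J : Type u} {ι : Type v} {κ : Type w}
  [MeasurableSpace J] [MeasurableSpace ι] [MeasurableSpace κ]
  [Countable J] [DiscreteMeasurableSpace J]

theorem measurable_weight (η : ℝ) :
    Measurable fun x : Chain J × ι => ENNReal.ofReal (η ^ x.1.length) := by
  have h : Measurable fun n : ℕ => ENNReal.ofReal (η ^ n) := Measurable.of_discrete
  exact h.comp (measurable_length.comp measurable_fst)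

theorem measurable_pow_length (η : ℝ) :
    Measurable fun x : Chain J × ι => ((η ^ x.1.length : ℝ) : ℂ) := by
  have h : Measurable fun n : ℕ => ((η ^ n : ℝ) : ℂ) := Measurable.of_discrete
  exact h.comp (measurable_length.comp measurable_fst)

theorem measurableSet_length_le (n : ℕ) :
    MeasurableSet {x : Chain J × ι | x.1.length ≤ n} :=
  measurableSet_le (measurable_length.comp measurable_fst) measurable_const

theorem lintegral_weighted (η : ℝ) (f : Chain J × ι → ℝ≥0∞) :
    ∫⁻ x, f x ∂(weighted J ι η) =
      ∫⁻ x, ENNReal.ofReal (η ^ x.1.length) * f x ∂(fockMeasure J ι) := by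
  rw [weighted, lintegral_withDensity_eq_lintegral_mul_non_measurable _ (measurable_weight η)
    (ae_of_all _ fun _ => ENNReal.ofReal_lt_top)]
  rfl

theorem eLpNorm_weighted (η : ℝ) (f : Chain J × ι → ℂ) :
    eLpNorm f 2 (weighted J ι η) =
      (∫⁻ x, ENNReal.ofReal (η ^ x.1.length) * ‖f x‖ₑ ^ 2 ∂(fockMeasure J ι)) ^ (1 / 2 : ℝ) := by
  rw [eLpNorm_eq_lintegral_rpow_enorm_toReal (by norm_num) (by norm_num), lintegral_weighted]
  simp

theorem eLpNorm_weighted_sq (η : ℝ) (f : Chain J × ι → ℂ) :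
    eLpNorm f 2 (weighted J ι η) ^ 2 =
      ∫⁻ x, ENNReal.ofReal (η ^ x.1.length) * ‖f x‖ₑ ^ 2 ∂(fockMeasure J ι) := by
  rw [eLpNorm_weighted, ← ENNReal.rpow_natCast, ← ENNReal.rpow_mul]
  norm_num

theorem fockMeasure_ac {η : ℝ} (hη : 0 < η) : fockMeasure J ι ≪ weighted J ι η :=
  withDensity_absolutelyContinuous' (measurable_weight η).aemeasurable
    (ae_of_all _ fun _ => (ENNReal.ofReal_pos.2 (pow_pos hη _)).ne')

theorem fockNorm_eq_of_ae {η : ℝ} {φ : Sect J ι} {f : Chain J × ι → ℂ}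
    (h : φ =ᵐ[fockMeasure J ι] f) : fockNorm η φ = eLpNorm f 2 (weighted J ι η) :=
  eLpNorm_congr_ae ((weighted_ac η).ae_eq h)

theorem fockNorm_eq_zero {η : ℝ} (hη : 0 < η) {φ : Sect J ι} (h : fockNorm η φ = 0) : φ = 0 := by
  rw [fockNorm, eLpNorm_eq_zero_iff (φ.aestronglyMeasurable.mono_ac (weighted_ac η))
    (by norm_num)] at h
  exact AEEqFun.ext (((fockMeasure_ac hη).ae_eq h).trans AEEqFun.coeFn_zero.symm)

theorem mem_GPlus {φ : Sect J ι} : φ ∈ GPlus J ι ↔ ∀ ζ > 1, fockNorm ζ φ < ∞ := by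
  simp only [GPlus, Submodule.mem_iInf]
  exact ⟨fun h ζ hζ => h ⟨ζ, hζ⟩, fun h ζ => h ζ ζ.2⟩

theorem mem_GMinus {φ : Sect J ι} : φ ∈ GMinus J ι ↔ ∀ ξ ∈ Ioo (0 : ℝ) 1, fockNorm ξ φ < ∞ := by
  simp only [GMinus, Submodule.mem_iInf]
  exact ⟨fun h ζ hζ => h ⟨ζ, hζ⟩, fun h ζ => h ζ ζ.2⟩

theorem fockNorm_lt_top (φ : GPlus J ι) {η : ℝ} (hη : 0 ≤ η) : fockNorm η (φ : Sect J ι) < ∞ :=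
  (fockNorm_mono hη (le_max_left η 2) _).trans_lt
    (mem_GPlus.1 φ.2 _ (lt_of_lt_of_le one_lt_two (le_max_right η 2)))

/-- Cauchy–Schwarz after distributing the weights as square roots of η^(-|τ|) and η^|τ|, whose
product is one. -/
theorem lintegral_enorm_mul_le {η : ℝ} (hη : 0 < η) {f g : Chain J × ι → ℂ}
    (hf : AEStronglyMeasurable f (fockMeasure J ι))
    (hg : AEStronglyMeasurable g (fockMeasure J ι)) :
    ∫⁻ x, ‖f x‖ₑ * ‖g x‖ₑ ∂(fockMeasure J ι) ≤
      eLpNorm f 2 (weighted J ι η⁻¹) * eLpNorm g 2 (weighted J ι η) := by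
  have hw : ∀ η : ℝ, Measurable fun x : Chain J × ι => ENNReal.ofReal (√(η ^ x.1.length)) := by
    intro η
    have h : Measurable fun n : ℕ => ENNReal.ofReal (√(η ^ n)) := Measurable.of_discrete
    exact h.comp (measurable_length.comp measurable_fst)
  have h2 : ∀ (η : ℝ) (_ : 0 < η) (f : Chain J × ι → ℂ),
      (∫⁻ x, (ENNReal.ofReal (√(η ^ x.1.length)) * ‖f x‖ₑ) ^ (2 : ℝ) ∂(fockMeasure J ι)) ^
        (1 / 2 : ℝ) = eLpNorm f 2 (weighted J ι η) := by
    intro η hη f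
    rw [eLpNorm_weighted]
    congr 1
    refine lintegral_congr fun x => ?_
    rw [ENNReal.rpow_two, mul_pow, ← ENNReal.ofReal_pow (Real.sqrt_nonneg _),
      Real.sq_sqrt (pow_nonneg hη.le _)]
  rw [← h2 η hη g, ← h2 η⁻¹ (inv_pos.2 hη) f]
  refine le_trans (le_of_eq ?_) (ENNReal.lintegral_mul_le_Lp_mul_Lq (fockMeasure J ι)
    Real.HolderConjugate.two_two ((hw η⁻¹).aemeasurable.mul hf.enorm)
    ((hw η).aemeasurable.mul hg.enorm))
  refine lintegral_congr fun x => ?_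
  simp only [Pi.mul_apply]
  rw [mul_mul_mul_comm, ← ENNReal.ofReal_mul (Real.sqrt_nonneg _),
    ← Real.sqrt_mul (pow_nonneg (inv_pos.2 hη).le _), ← mul_pow, inv_mul_cancel₀ hη.ne']
  simp

theorem enorm_pairing_le {η : ℝ} (hη : 0 < η) (φ ψ : Sect J ι) :
    ‖pairing φ ψ‖ₑ ≤ fockNorm η⁻¹ φ * fockNorm η ψ := by
  refine le_trans (enorm_integral_le_lintegral_enorm _) ?_
  refine le_trans (le_of_eq ?_) (lintegral_enorm_mul_le hη φ.aestronglyMeasurable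
    ψ.aestronglyMeasurable)
  exact lintegral_congr fun x => by rw [enorm_mul, RCLike.enorm_conj]

theorem integrable_conj_mul {η : ℝ} (hη : 0 < η) {f g : Chain J × ι → ℂ}
    (hf : AEStronglyMeasurable f (fockMeasure J ι))
    (hg : AEStronglyMeasurable g (fockMeasure J ι))
    (hf' : eLpNorm f 2 (weighted J ι η⁻¹) < ∞) (hg' : eLpNorm g 2 (weighted J ι η) < ∞) :
    Integrable (fun x => (starRingEnd ℂ) (f x) * g x) (fockMeasure J ι) := by
  refine ⟨(RCLike.continuous_conj.comp_aestronglyMeasurable hf).mul hg, ?_⟩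
  refine lt_of_le_of_lt (le_trans (le_of_eq ?_) (lintegral_enorm_mul_le hη hf hg))
    (ENNReal.mul_lt_top hf' hg')
  exact lintegral_congr fun x => by rw [enorm_mul, RCLike.enorm_conj]

theorem integrable_pairing (φ : GPlus J ι) {ψ : Sect J ι} (hψ : ψ ∈ GDual J ι) :
    Integrable (fun x => (starRingEnd ℂ) ((φ : Sect J ι) x) * ψ x) (fockMeasure J ι) := by
  obtain ⟨ξ, hξ, h⟩ := hψ
  exact integrable_conj_mul hξ.1 (φ : Sect J ι).aestronglyMeasurable ψ.aestronglyMeasurable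
    (fockNorm_lt_top φ (inv_pos.2 hξ.1).le) h

theorem pairing_conj (φ ψ : Sect J ι) : (starRingEnd ℂ) (pairing φ ψ) = pairing ψ φ := by
  rw [pairing, ← integral_conj]
  exact integral_congr_ae (ae_of_all _ fun x => by simp [mul_comm])

theorem pairing_add (φ : GPlus J ι) {ψ ψ' : Sect J ι} (h : ψ ∈ GDual J ι) (h' : ψ' ∈ GDual J ι) :
    pairing (φ : Sect J ι) (ψ + ψ') = pairing (φ : Sect J ι) ψ + pairing (φ : Sect J ι) ψ' := by
  simp only [pairing]
  rw [← integral_add (integrable_pairing φ h) (integrable_pairing φ h')]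
  refine integral_congr_ae ?_
  filter_upwards [AEEqFun.coeFn_add ψ ψ'] with x hx
  rw [hx, Pi.add_apply, mul_add]

theorem pairing_add_right {ψ : Sect J ι} (h : ψ ∈ GDual J ι) (φ φ' : GPlus J ι) :
    pairing ψ ((φ : Sect J ι) + (φ' : Sect J ι)) =
      pairing ψ (φ : Sect J ι) + pairing ψ (φ' : Sect J ι) := by
  have hi : ∀ φ : GPlus J ι, Integrable (fun x => (starRingEnd ℂ) (ψ x) * (φ : Sect J ι) x)
      (fockMeasure J ι) := fun φ => by
    obtain ⟨ξ, hξ, h⟩ := h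
    refine integrable_conj_mul (inv_pos.2 hξ.1) ψ.aestronglyMeasurable
      (φ : Sect J ι).aestronglyMeasurable ?_ (fockNorm_lt_top φ (inv_pos.2 hξ.1).le)
    rwa [inv_inv]
  simp only [pairing]
  rw [← integral_add (hi φ) (hi φ')]
  refine integral_congr_ae ?_
  filter_upwards [AEEqFun.coeFn_add (φ : Sect J ι) (φ' : Sect J ι)] with x hx
  rw [hx, Pi.add_apply, mul_add]

theorem pairing_smul (φ ψ : Sect J ι) (c : ℂ) : pairing φ (c • ψ) = c * pairing φ ψ := by
  simp only [pairing]
  rw [← integral_const_mul]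
  refine integral_congr_ae ?_
  filter_upwards [AEEqFun.coeFn_smul c ψ] with x hx
  rw [hx, Pi.smul_apply, smul_eq_mul]
  ring

theorem pairing_congr {φ ψ : Sect J ι} {f g : Chain J × ι → ℂ}
    (hf : φ =ᵐ[fockMeasure J ι] f) (hg : ψ =ᵐ[fockMeasure J ι] g) :
    pairing φ ψ = ∫ x, (starRingEnd ℂ) (f x) * g x ∂(fockMeasure J ι) := by
  refine integral_congr_ae ?_
  filter_upwards [hf, hg] with x h1 h2
  rw [h1, h2]

/-- The section `τ ↦ η ^ |τ| φ(τ)` restricted to the chains with at most `n` points in `S`. -/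
def cutoff (n : ℕ) (η : ℝ) (φ : Sect J ι) : Sect J ι :=
  AEEqFun.mk ({x : Chain J × ι | x.1.length ≤ n}.indicator
    fun x => ((η ^ x.1.length : ℝ) : ℂ) * φ x)
    (((measurable_pow_length η).aestronglyMeasurable.mul φ.aestronglyMeasurable).indicator
      (measurableSet_length_le n))

theorem coeFn_cutoff (n : ℕ) (η : ℝ) (φ : Sect J ι) :
    cutoff n η φ =ᵐ[fockMeasure J ι] {x : Chain J × ι | x.1.length ≤ n}.indicator
      fun x => ((η ^ x.1.length : ℝ) : ℂ) * φ x := AEEqFun.coeFn_mk _ _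

/-- A section bounded by a multiple of an element of `𝒢(ξ)` and supported on chains with a bounded
number of points belongs to `𝒢⁺`. -/
theorem mem_GPlus_of_bounded_length {ξ : ℝ} (hξ : 0 < ξ) {φ ψ : Sect J ι}
    (hψ : fockNorm ξ ψ < ∞) (n : ℕ) (c : ℕ → ℝ)
    (h : ∀ᵐ x ∂(fockMeasure J ι), (n < x.1.length → φ x = 0) ∧
      ‖φ x‖ ≤ c x.1.length * ‖ψ x‖) : φ ∈ GPlus J ι := by
  refine mem_GPlus.2 fun ζ hζ => ?_
  have hζ0 : (0 : ℝ) < ζ := one_pos.trans hζ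
  -- Only finitely many lengths occur, so the sum of the ratios of the two weights over these
  -- lengths is a constant that dominates each of them.
  set C : ℝ := ∑ k ∈ Finset.range (n + 1), ζ ^ k * (c k) ^ 2 * (ξ ^ k)⁻¹
  have hC : ∀ k ≤ n, ζ ^ k * (c k) ^ 2 ≤ C * ξ ^ k := by
    intro k hk
    have h1 : ζ ^ k * (c k) ^ 2 * (ξ ^ k)⁻¹ ≤ C :=
      Finset.single_le_sum (f := fun k => ζ ^ k * (c k) ^ 2 * (ξ ^ k)⁻¹)
        (fun i _ => by positivity) (Finset.mem_range.2 (Nat.lt_succ_of_le hk))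
    calc ζ ^ k * (c k) ^ 2 = ζ ^ k * (c k) ^ 2 * (ξ ^ k)⁻¹ * ξ ^ k := by
          field_simp
      _ ≤ C * ξ ^ k := mul_le_mul_of_nonneg_right h1 (pow_nonneg hξ.le _)
  have hC0 : 0 ≤ C := Finset.sum_nonneg fun i _ => by positivity
  have hle : fockNorm ζ φ ^ 2 ≤ ENNReal.ofReal C * fockNorm ξ ψ ^ 2 := by
    rw [fockNorm, fockNorm, eLpNorm_weighted_sq, eLpNorm_weighted_sq,
      ← lintegral_const_mul' _ _ ENNReal.ofReal_ne_top]
    refine lintegral_mono_ae ?_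
    filter_upwards [h] with x hx
    by_cases hn : x.1.length ≤ n
    · have h1 : ‖φ x‖ₑ ^ 2 ≤ ENNReal.ofReal (c x.1.length ^ 2) * ‖ψ x‖ₑ ^ 2 := by
        rw [← ofReal_norm, ← ofReal_norm, ← ENNReal.ofReal_pow (norm_nonneg _),
          ← ENNReal.ofReal_pow (norm_nonneg _), ← ENNReal.ofReal_mul (sq_nonneg _), ← mul_pow]
        exact ENNReal.ofReal_le_ofReal (pow_le_pow_left₀ (norm_nonneg _) hx.2 2)
      calc ENNReal.ofReal (ζ ^ x.1.length) * ‖φ x‖ₑ ^ 2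
          ≤ ENNReal.ofReal (ζ ^ x.1.length) *
            (ENNReal.ofReal (c x.1.length ^ 2) * ‖ψ x‖ₑ ^ 2) := by gcongr
        _ = ENNReal.ofReal (ζ ^ x.1.length * c x.1.length ^ 2) * ‖ψ x‖ₑ ^ 2 := by
            rw [ENNReal.ofReal_mul (pow_nonneg hζ0.le _), mul_assoc]
        _ ≤ ENNReal.ofReal (C * ξ ^ x.1.length) * ‖ψ x‖ₑ ^ 2 := by
            exact mul_le_mul_left (ENNReal.ofReal_le_ofReal (hC _ hn)) _
        _ = _ := by rw [ENNReal.ofReal_mul hC0, mul_assoc]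
    · rw [hx.1 (not_le.1 hn)]; simp
  by_contra hcon
  rw [not_lt, top_le_iff] at hcon
  rw [hcon] at hle
  have : ENNReal.ofReal C * fockNorm ξ ψ ^ 2 < ∞ :=
    ENNReal.mul_lt_top ENNReal.ofReal_lt_top (ENNReal.pow_lt_top hψ)
  exact absurd hle (not_le.2 (by simpa using this))

theorem cutoff_mem_GPlus {ξ : ℝ} (hξ : 0 < ξ) {η : ℝ} (hη : 0 ≤ η) (n : ℕ) {ψ : Sect J ι}
    (hψ : fockNorm ξ ψ < ∞) : cutoff n η ψ ∈ GPlus J ι := by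
  refine mem_GPlus_of_bounded_length hξ hψ n (fun k => η ^ k) ?_
  filter_upwards [coeFn_cutoff n η ψ] with x hx
  rw [hx]
  refine ⟨fun h => indicator_of_notMem (s := {x : Chain J × ι | x.1.length ≤ n})
    (fun h' => absurd h (not_lt.2 h')) _, ?_⟩
  refine (norm_indicator_le_norm_self _ _).trans (le_of_eq ?_)
  rw [norm_mul, Complex.norm_real, Real.norm_of_nonneg (pow_nonneg hη _)]

theorem fockNorm_sq_eq_iSup (η : ℝ) (ψ : Sect J ι) : fockNorm η ψ ^ 2 =
    ⨆ n : ℕ, ∫⁻ x in {x : Chain J × ι | x.1.length ≤ n},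
      ENNReal.ofReal (η ^ x.1.length) * ‖ψ x‖ₑ ^ 2 ∂(fockMeasure J ι) := by
  rw [fockNorm, eLpNorm_weighted_sq]
  have hU : (⋃ n : ℕ, {x : Chain J × ι | x.1.length ≤ n}) = univ := by
    ext x; simp only [mem_iUnion, mem_ofPred_eq, mem_univ, iff_true]; exact ⟨_, le_rfl⟩
  rw [← setLIntegral_univ, ← hU]
  refine setLIntegral_iUnion_of_directed _ (Monotone.directed_le ?_)
  intro a b hab x hx
  exact le_trans (show x.1.length ≤ a from hx) hab

/-- Since η^(-k) (η^k)² = η^k, the truncation of η^|τ| ψ(τ) has the same squared norm as its pairing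
with ψ (`pairing_cutoff`). It is the extremal vector for the duality bound. -/
theorem fockNorm_cutoff_sq {η : ℝ} (hη : 0 < η) (n : ℕ) (ψ : Sect J ι) :
    fockNorm η⁻¹ (cutoff n η ψ) ^ 2 = ∫⁻ x in {x : Chain J × ι | x.1.length ≤ n},
      ENNReal.ofReal (η ^ x.1.length) * ‖ψ x‖ₑ ^ 2 ∂(fockMeasure J ι) := by
  rw [fockNorm, eLpNorm_weighted_sq, ← lintegral_indicator (measurableSet_length_le n)]
  refine lintegral_congr_ae ?_
  filter_upwards [coeFn_cutoff n η ψ] with x hx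
  rw [hx]
  by_cases h : x ∈ {x : Chain J × ι | x.1.length ≤ n}
  · rw [indicator_of_mem h, indicator_of_mem h, enorm_mul, mul_pow, ← mul_assoc]
    congr 1
    rw [← ofReal_norm, Complex.norm_real, Real.norm_of_nonneg (pow_nonneg hη.le _),
      ← ENNReal.ofReal_pow (pow_nonneg hη.le _),
      ← ENNReal.ofReal_mul (pow_nonneg (inv_pos.2 hη).le _)]
    congr 1
    rw [inv_pow, sq, ← mul_assoc, inv_mul_cancel₀ (pow_pos hη _).ne', one_mul]
  · rw [indicator_of_notMem h, indicator_of_notMem h]; simp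

theorem pairing_cutoff {η : ℝ} (hη : 0 < η) (n : ℕ) (ψ : Sect J ι) :
    pairing (cutoff n η ψ) ψ = ((∫⁻ x in {x : Chain J × ι | x.1.length ≤ n},
      ENNReal.ofReal (η ^ x.1.length) * ‖ψ x‖ₑ ^ 2 ∂(fockMeasure J ι)).toReal : ℂ) := by
  rw [pairing_congr (coeFn_cutoff n η ψ) (EventuallyEq.refl _ ψ),
    ← lintegral_indicator (measurableSet_length_le n), ← integral_toReal]
  · rw [← integral_complex_ofReal]
    refine integral_congr_ae (ae_of_all _ fun x => ?_)
    by_cases h : x ∈ {x : Chain J × ι | x.1.length ≤ n}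
    · simp only [indicator_of_mem h, ENNReal.toReal_mul, ENNReal.toReal_pow, toReal_enorm,
        ENNReal.toReal_ofReal (pow_nonneg hη.le x.1.length)]
      rw [map_mul, Complex.conj_ofReal, mul_assoc, Complex.conj_mul']
      push_cast
      ring
    · simp [indicator_of_notMem h]
  · exact (((measurable_weight η).aemeasurable.mul
      (ψ.aestronglyMeasurable.enorm.pow_const 2)).indicator (measurableSet_length_le n))
  · refine ae_of_all _ fun x => ?_
    refine (indicator_le_self _ _ x).trans_lt ?_
    exact ENNReal.mul_lt_top ENNReal.ofReal_lt_top (by simp)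

/-- The norm of `𝒢(ξ)` is dual to the norm of `𝒢(1/ξ)`. -/
theorem fockNorm_le_of_pairing {ξ : ℝ} (hξ : 0 < ξ) {ψ : Sect J ι} (hψ : ψ ∈ GDual J ι)
    (c : ℝ≥0∞)
    (h : ∀ χ : GPlus J ι, ‖pairing (χ : Sect J ι) ψ‖ₑ ≤ c * fockNorm ξ⁻¹ (χ : Sect J ι)) :
    fockNorm ξ ψ ≤ c := by
  obtain ⟨ξ', hξ', hψ'⟩ := hψ
  have key : fockNorm ξ ψ ^ 2 ≤ c ^ 2 := by
    rw [fockNorm_sq_eq_iSup]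
    refine iSup_le fun n => ?_
    set a := ∫⁻ x in {x : Chain J × ι | x.1.length ≤ n},
      ENNReal.ofReal (ξ ^ x.1.length) * ‖ψ x‖ₑ ^ 2 ∂(fockMeasure J ι) with ha
    -- That ψ has finite norm in 𝒢(ξ) is not yet known; membership in some 𝒢(ξ') and bounded length
    -- are enough to have a test vector in 𝒢⁺.
    have hmem := cutoff_mem_GPlus hξ'.1 hξ.le n hψ'
    have h1 := h ⟨_, hmem⟩
    have h2 := fockNorm_cutoff_sq hξ n ψ
    rw [pairing_cutoff hξ] at h1
    rw [← ha] at h1 h2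
    have h3 : fockNorm ξ⁻¹ (cutoff n ξ ψ) < ∞ := fockNorm_lt_top ⟨_, hmem⟩ (inv_pos.2 hξ).le
    have ha' : a ≠ ∞ := by rw [← h2]; exact (ENNReal.pow_lt_top h3).ne
    rw [← ofReal_norm, Complex.norm_real, Real.norm_of_nonneg ENNReal.toReal_nonneg,
      ENNReal.ofReal_toReal ha', ← h2, sq] at h1
    rw [← h2]
    change _ ≤ c * fockNorm ξ⁻¹ (cutoff n ξ ψ) at h1
    -- What has been reached is x² ≤ c x for the norm x of the test vector; x is finite and cancels
    -- unless it is zero.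
    rcases eq_or_ne (fockNorm ξ⁻¹ (cutoff n ξ ψ)) 0 with h0 | h0
    · rw [h0]; simp
    · exact pow_le_pow_left₀ (zero_le) ((ENNReal.mul_le_mul_iff_left h0 h3.ne).1 h1) 2
  exact (ENNReal.pow_le_pow_left_iff (by norm_num)).1 key

theorem eq_zero_of_pairing {ψ : Sect J ι} (hψ : ψ ∈ GDual J ι)
    (h : ∀ χ : GPlus J ι, pairing (χ : Sect J ι) ψ = 0) : ψ = 0 := by
  refine fockNorm_eq_zero one_pos (le_antisymm (fockNorm_le_of_pairing one_pos hψ 0 fun χ => ?_)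
    (zero_le))
  rw [h χ]; simp

theorem fockNorm_le_opNorm (A : GPlus J ι →ₗ[ℂ] GDual J κ) {ζ : ℝ} (hζ : 0 < ζ) (ξ : ℝ)
    (φ : GPlus J ι) : fockNorm ξ (A φ : Sect J κ) ≤
      opNorm ζ ξ (fun φ => (A φ : Sect J κ)) * fockNorm ζ (φ : Sect J ι) := by
  -- The quotient in `opNorm` carries no information when the denominator vanishes, but then φ = 0
  -- and linearity applies.
  rcases eq_or_ne (fockNorm ζ (φ : Sect J ι)) 0 with h0 | h0
  · have : φ = 0 := Subtype.ext (fockNorm_eq_zero hζ h0)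
    subst this
    rw [map_zero]
    exact (fockNorm_zero ξ).le.trans zero_le
  · have h1 : fockNorm ξ (A φ : Sect J κ) / fockNorm ζ (φ : Sect J ι) ≤
        opNorm ζ ξ (fun φ => (A φ : Sect J κ)) :=
      le_iSup (fun φ : GPlus J ι => fockNorm ξ (A φ : Sect J κ) / fockNorm ζ (φ : Sect J ι)) φ
    rwa [ENNReal.div_le_iff h0 (fockNorm_lt_top φ hζ.le).ne] at h1

theorem opNorm_le {A : GPlus J ι → Sect J κ} {ζ ξ : ℝ} {c : ℝ≥0∞}
    (h : ∀ φ : GPlus J ι, fockNorm ξ (A φ) ≤ c * fockNorm ζ (φ : Sect J ι)) :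
    opNorm ζ ξ A ≤ c :=
  iSup_le fun φ => ENNReal.div_le_of_le_mul (h φ)

theorem IsAdjoint.symm {A : GPlus J ι →ₗ[ℂ] GDual J κ} {B : GPlus J κ →ₗ[ℂ] GDual J ι}
    (h : IsAdjoint A B) : IsAdjoint B A := fun φ χ => by
  rw [← pairing_conj, ← h χ φ, pairing_conj]

/-- The norm of Bφ in 𝒢(1/ζ) is tested against 𝒢⁺ and B is moved across the pairing. As the adjoint
relation is symmetric, the same bound for B gives equality in `IsAdjoint.opNorm_eq`. -/
theorem IsAdjoint.opNorm_le {A : GPlus J ι →ₗ[ℂ] GDual J κ} {B : GPlus J κ →ₗ[ℂ] GDual J ι}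
    (h : IsAdjoint A B) {ζ ξ : ℝ} (hζ : 0 < ζ) (hξ : 0 < ξ) :
    opNorm ξ⁻¹ ζ⁻¹ (fun φ => (B φ : Sect J ι)) ≤ opNorm ζ ξ (fun φ => (A φ : Sect J κ)) := by
  refine QSC.opNorm_le fun φ => fockNorm_le_of_pairing (inv_pos.2 hζ) (B φ).2 _ fun χ => ?_
  rw [← h.symm χ φ |> fun _ => pairing_conj (B φ : Sect J ι) (χ : Sect J ι), RCLike.enorm_conj,
    h φ χ, inv_inv]
  refine (enorm_pairing_le hξ _ _).trans ?_
  rw [mul_comm, mul_right_comm]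
  gcongr
  exact fockNorm_le_opNorm A hζ ξ χ

theorem IsAdjoint.opNorm_eq {A : GPlus J ι →ₗ[ℂ] GDual J κ} {B : GPlus J κ →ₗ[ℂ] GDual J ι}
    (h : IsAdjoint A B) {ζ ξ : ℝ} (hζ : 0 < ζ) (hξ : 0 < ξ) :
    opNorm ξ⁻¹ ζ⁻¹ (fun φ => (B φ : Sect J ι)) = opNorm ζ ξ (fun φ => (A φ : Sect J κ)) := by
  refine le_antisymm (h.opNorm_le hζ hξ) ?_
  have := h.symm.opNorm_le (inv_pos.2 hξ) (inv_pos.2 hζ)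
  rwa [inv_inv, inv_inv] at this

end Norms

/-! ### Riesz representation and existence of adjoints. -/

section Adjoint

variable {J : Type u} {ι : Type v} {κ : Type w}
  [MeasurableSpace J] [MeasurableSpace ι] [MeasurableSpace κ]
  [Countable J] [DiscreteMeasurableSpace J]

theorem memLp_weighted {η : ℝ} {φ : Sect J ι} (h : fockNorm η φ < ∞) :
    MemLp φ 2 (weighted J ι η) := ⟨φ.aestronglyMeasurable.mono_ac (weighted_ac η), h⟩

/-- The inclusion of `𝒢⁺` into the Hilbert space `𝒢(η)`. -/
def GPlus.toL2 (J : Type u) (ι : Type v) [MeasurableSpace J] [MeasurableSpace ι]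
    [Countable J] [DiscreteMeasurableSpace J] {η : ℝ} (hη : 0 < η) :
    GPlus J ι →ₗ[ℂ] Lp ℂ 2 (weighted J ι η) where
  toFun φ := (memLp_weighted (fockNorm_lt_top φ hη.le)).toLp _
  map_add' φ ψ := by
    rw [← MemLp.toLp_add]
    exact MemLp.toLp_congr _ _ ((weighted_ac η).ae_eq
      (AEEqFun.coeFn_add (φ : Sect J ι) (ψ : Sect J ι)))
  map_smul' c φ := by
    rw [RingHom.id_apply, ← MemLp.toLp_const_smul]
    exact MemLp.toLp_congr _ _ ((weighted_ac η).ae_eq (AEEqFun.coeFn_smul c (φ : Sect J ι)))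

theorem GPlus.coeFn_toL2 {η : ℝ} (hη : 0 < η) (φ : GPlus J ι) :
    GPlus.toL2 J ι hη φ =ᵐ[weighted J ι η] (φ : Sect J ι) :=
  MemLp.coeFn_toLp (memLp_weighted (fockNorm_lt_top φ hη.le))

theorem GPlus.enorm_toL2 {η : ℝ} (hη : 0 < η) (φ : GPlus J ι) :
    ‖GPlus.toL2 J ι hη φ‖ₑ = fockNorm η (φ : Sect J ι) := by
  rw [Lp.enorm_def]
  exact eLpNorm_congr_ae (GPlus.coeFn_toL2 hη φ)

theorem GPlus.toL2_injective {η : ℝ} (hη : 0 < η) :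
    Function.Injective (GPlus.toL2 J ι hη) := by
  rw [injective_iff_map_eq_zero]
  intro φ h
  refine Subtype.ext (fockNorm_eq_zero hη ?_)
  rw [← GPlus.enorm_toL2 hη, h, enorm_zero]

/-- Multiplication by η^|τ| is isometric from 𝒢(η) to 𝒢(1/η); it carries the Riesz identification
over to the pairing. -/
theorem fockNorm_mul_weight {η : ℝ} (hη : 0 < η) {g : Sect J ι} {h : Chain J × ι → ℂ}
    (hg : g =ᵐ[fockMeasure J ι] fun x => ((η ^ x.1.length : ℝ) : ℂ) * h x) :
    fockNorm η⁻¹ g = eLpNorm h 2 (weighted J ι η) := by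
  rw [fockNorm, eLpNorm_weighted, eLpNorm_weighted]
  congr 1
  refine lintegral_congr_ae ?_
  filter_upwards [hg] with x hx
  rw [hx, enorm_mul, mul_pow, ← mul_assoc]
  congr 1
  rw [← ofReal_norm, Complex.norm_real, Real.norm_of_nonneg (pow_nonneg hη.le _),
    ← ENNReal.ofReal_pow (pow_nonneg hη.le _),
    ← ENNReal.ofReal_mul (pow_nonneg (inv_pos.2 hη).le _)]
  congr 1
  rw [inv_pow, sq, ← mul_assoc, inv_mul_cancel₀ (pow_pos hη _).ne', one_mul]

theorem inner_weighted {η : ℝ} (hη : 0 ≤ η) (f g : Lp ℂ 2 (weighted J ι η)) :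
    inner ℂ f g = ∫ x, (starRingEnd ℂ) (((η ^ x.1.length : ℝ) : ℂ) * f x) * g x
      ∂(fockMeasure J ι) := by
  rw [L2.inner_def]
  change ∫ x, inner ℂ (f x) (g x) ∂((fockMeasure J ι).withDensity
    fun x => ENNReal.ofReal (η ^ x.1.length)) = _
  rw [integral_withDensity_eq_integral_toReal_smul (measurable_weight η)
    (ae_of_all _ fun _ => ENNReal.ofReal_lt_top)]
  refine integral_congr_ae (ae_of_all _ fun x => ?_)
  simp only [ENNReal.toReal_ofReal (pow_nonneg hη x.1.length), RCLike.inner_apply, map_mul,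
    Complex.conj_ofReal, Complex.real_smul]
  ring

/-- The Riesz representation on the Fock scale. -/
theorem exists_pairing_eq {η : ℝ} (hη : 0 < η) (f : GPlus J ι →ₗ[ℂ] ℂ) (c : ℝ)
    (hf : ∀ χ : GPlus J ι, ‖f χ‖ ≤ c * (fockNorm η (χ : Sect J ι)).toReal) :
    ∃ g : Sect J ι, fockNorm η⁻¹ g < ∞ ∧ ∀ χ : GPlus J ι, pairing g (χ : Sect J ι) = f χ := by
  let T := GPlus.toL2 J ι hη
  let e := LinearEquiv.ofInjective T (GPlus.toL2_injective hη)
  have hnorm : ∀ χ, ‖T χ‖ = (fockNorm η (χ : Sect J ι)).toReal := fun χ => by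
    rw [← GPlus.enorm_toL2 hη, toReal_enorm]
  let f0 : LinearMap.range T →ₗ[ℂ] ℂ := f ∘ₗ e.symm.toLinearMap
  let f1 : LinearMap.range T →L[ℂ] ℂ := f0.mkContinuous c (fun y => by
    obtain ⟨χ, rfl⟩ := e.surjective y
    simp only [f0, LinearMap.comp_apply, LinearEquiv.coe_coe, LinearEquiv.symm_apply_apply]
    refine (hf χ).trans (le_of_eq ?_)
    rw [← hnorm]
    rfl)
  -- By Hahn–Banach no density of 𝒢⁺ in 𝒢(η) is needed: any extension gives a representing vector.
  obtain ⟨F, hF, -⟩ := exists_extension_norm_eq (LinearMap.range T) f1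
  let h := (InnerProductSpace.toDual ℂ (Lp ℂ 2 (weighted J ι η))).symm F
  -- The scalar product of 𝒢(η) contains the weight, the pairing does not; so the weight goes into
  -- the representing section.
  have hm : AEStronglyMeasurable (fun x : Chain J × ι => ((η ^ x.1.length : ℝ) : ℂ) * h x)
      (fockMeasure J ι) := (measurable_pow_length η).aestronglyMeasurable.mul
        ((Lp.aestronglyMeasurable h).mono_ac (fockMeasure_ac hη))
  refine ⟨AEEqFun.mk _ hm, ?_, fun χ => ?_⟩
  · rw [fockNorm_mul_weight hη (AEEqFun.coeFn_mk _ hm)]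
    exact (Lp.memLp h).2
  · rw [pairing_congr (AEEqFun.coeFn_mk _ hm)
      ((fockMeasure_ac hη).ae_eq (GPlus.coeFn_toL2 hη χ)).symm, ← inner_weighted hη.le,
      InnerProductSpace.toDual_symm_apply]
    have := hF (e χ)
    change F (e χ : Lp ℂ 2 (weighted J ι η)) = f χ
    rw [this]
    simp only [f1, f0, LinearMap.mkContinuous_apply, LinearMap.comp_apply, LinearEquiv.coe_coe,
      LinearEquiv.symm_apply_apply]

/-- For fixed φ the functional χ ↦ ⟨φ | Aχ⟩ is bounded in the norm of 𝒢(ζ), hence represented by an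
element of 𝒢(1/ζ), which lies in the dual because ζ > 1. Linearity in φ follows from uniqueness, as
𝒢⁺ separates the points of its dual. -/
theorem exists_isAdjoint {A : GPlus J ι →ₗ[ℂ] GDual J κ} {ζ ξ : ℝ} (hζ : 1 < ζ) (hξ : 0 < ξ)
    (h : opNorm ζ ξ (fun φ => (A φ : Sect J κ)) < ∞) : ∃ B, IsAdjoint A B := by
  have hζ0 : 0 < ζ := one_pos.trans hζ
  have hex : ∀ φ : GPlus J κ, ∃ g : Sect J ι, fockNorm ζ⁻¹ g < ∞ ∧
      ∀ χ : GPlus J ι, pairing g (χ : Sect J ι) = pairing (φ : Sect J κ) (A χ : Sect J κ) := by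
    intro φ
    let f : GPlus J ι →ₗ[ℂ] ℂ :=
      { toFun := fun χ => pairing (φ : Sect J κ) (A χ : Sect J κ)
        map_add' := fun χ χ' => by
          rw [map_add]
          exact pairing_add φ (A χ).2 (A χ').2
        map_smul' := fun c χ => by
          rw [map_smul]
          exact pairing_smul _ _ c }
    have hφ := fockNorm_lt_top φ (inv_pos.2 hξ).le
    refine exists_pairing_eq hζ0 f ((fockNorm ξ⁻¹ (φ : Sect J κ)).toReal *
      (opNorm ζ ξ (fun φ => (A φ : Sect J κ))).toReal) fun χ => ?_
    rw [← toReal_enorm, ← ENNReal.toReal_mul, ← ENNReal.toReal_mul]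
    refine ENNReal.toReal_mono ?_ ?_
    · exact (ENNReal.mul_lt_top (ENNReal.mul_lt_top hφ h) (fockNorm_lt_top χ hζ0.le)).ne
    · refine (enorm_pairing_le hξ _ _).trans ?_
      rw [mul_assoc]
      gcongr
      exact fockNorm_le_opNorm A hζ0 ξ χ
  choose g hg hgA using hex
  have hmem : ∀ φ, g φ ∈ GDual J ι := fun φ =>
    ⟨ζ⁻¹, ⟨inv_pos.2 hζ0, inv_lt_one_of_one_lt₀ hζ⟩, hg φ⟩
  have huniq : ∀ {ψ ψ' : Sect J ι}, ψ ∈ GDual J ι → ψ' ∈ GDual J ι →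
      (∀ χ : GPlus J ι, pairing (χ : Sect J ι) ψ = pairing (χ : Sect J ι) ψ') → ψ = ψ' := by
    intro ψ ψ' h1 h2 h3
    have h2' : (-1 : ℂ) • ψ' ∈ GDual J ι := Submodule.smul_mem _ _ h2
    have h0 : ψ + (-1 : ℂ) • ψ' = 0 := eq_zero_of_pairing (Submodule.add_mem _ h1 h2')
      fun χ => by rw [pairing_add χ h1 h2', pairing_smul, h3]; ring
    rw [← sub_eq_zero, ← h0]
    module
  have hgA' : ∀ φ (χ : GPlus J ι), pairing (χ : Sect J ι) (g φ) =
      pairing (A χ : Sect J κ) (φ : Sect J κ) := fun φ χ => by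
    rw [← pairing_conj, hgA, pairing_conj]
  refine ⟨{ toFun := fun φ => ⟨g φ, hmem φ⟩, map_add' := ?_, map_smul' := ?_ }, hgA⟩
  · intro φ φ'
    refine Subtype.ext (huniq (hmem _) (Submodule.add_mem _ (hmem φ) (hmem φ')) fun χ => ?_)
    refine Eq.trans ?_ (pairing_add χ (hmem φ) (hmem φ')).symm
    rw [hgA', hgA', hgA']
    exact pairing_add_right (A χ).2 φ φ'
  · intro c φ
    refine Subtype.ext (huniq (hmem _) (Submodule.smul_mem _ c (hmem φ)) fun χ => ?_)
    refine Eq.trans ?_ (pairing_smul (χ : Sect J ι) (g φ) c).symm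
    rw [hgA', hgA']
    exact pairing_smul _ _ _

end Adjoint

/-! ### Measurable versions -/

section Versions

/-- Pettis' theorem for a separable Hilbert space: f is the limit of its finite expansions in a
countable orthonormal basis, whose coefficients are measurable by assumption. -/
theorem aestronglyMeasurable_of_inner {α H : Type*} [MeasurableSpace α] {μ : Measure α}
    [NormedAddCommGroup H] [InnerProductSpace ℂ H] [CompleteSpace H] [SecondCountableTopology H]
    {f : α → H} (hf : ∀ h : H, AEMeasurable (fun s => (inner ℂ h (f s) : ℂ)) μ) :
    AEStronglyMeasurable f μ := by
  obtain ⟨w, b, hb⟩ := exists_hilbertBasis ℂ H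
  -- Orthonormal vectors are √2 apart, so the balls of radius 1/2 around them are disjoint, and a
  -- separable space holds only countably many such balls.
  have hw : Countable w := by
    refine (Set.countable_univ_iff (α := w)).1 (Set.PairwiseDisjoint.countable_of_isOpen
      (s := fun i : w => Metric.ball (b i) (1 / 2)) (a := univ) ?_ ?_ ?_)
    · intro i _ j _ hij
      refine Metric.ball_disjoint_ball ?_
      have h1 : ‖b i - b j‖ ^ 2 = 2 := by
        rw [@norm_sub_sq ℂ, b.orthonormal.1 i, b.orthonormal.1 j, b.orthonormal.2 hij]
        norm_num
      rw [dist_eq_norm]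
      nlinarith [norm_nonneg (b i - b j)]
    · exact fun _ _ => Metric.isOpen_ball
    · exact fun _ _ => Metric.nonempty_ball.2 (by norm_num)
  have : Countable (Finset w) := Finset.countable
  refine aestronglyMeasurable_of_tendsto_ae (atTop : Filter (Finset w))
    (f := fun F s => ∑ i ∈ F, (inner ℂ (b i) (f s) : ℂ) • b i) (fun F => ?_)
    (ae_of_all _ fun s => ?_)
  · exact Finset.aestronglyMeasurable_fun_sum _ fun i _ =>
      (hf (b i)).aestronglyMeasurable.smul_const (b i)
  · have := b.hasSum_repr (f s)
    simp only [b.repr_apply_apply] at this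
    exact this

/-- Approximate g(s) within 2⁻ⁿ by the first suitable member of a fixed dense sequence. The index is
a measurable function of s and each member has a fixed measurable representative, so the
approximations are jointly measurable. They converge geometrically in L², hence pointwise almost
everywhere for almost every s. -/
theorem exists_jointly_measurable {α X : Type*} [MeasurableSpace α] [MeasurableSpace X]
    {m : Measure α} {ν : Measure X} [SecondCountableTopology (Lp ℂ 2 ν)] {g : α → Lp ℂ 2 ν}
    (hg : AEStronglyMeasurable g m) :
    ∃ a : α → X → ℂ, Measurable (Function.uncurry a) ∧ ∀ᵐ s ∂m, a s =ᵐ[ν] g s := by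
  classical
  obtain ⟨g', hg', hgg'⟩ := hg
  let d : ℕ → Lp ℂ 2 ν := TopologicalSpace.denseSeq (Lp ℂ 2 ν)
  have hex : ∀ (n : ℕ) (s : α), ∃ k, ‖d k - g' s‖ₑ < 2⁻¹ ^ n := by
    intro n s
    obtain ⟨k, hk⟩ := (TopologicalSpace.denseRange_denseSeq (Lp ℂ 2 ν)).exists_mem_open
      (Metric.isOpen_eball (x := g' s) (ε := 2⁻¹ ^ n))
      ⟨g' s, Metric.mem_eball_self (ENNReal.pow_pos (by norm_num) n)⟩
    exact ⟨k, by rw [← edist_eq_enorm_sub]; exact hk⟩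
  let N : ℕ → α → ℕ := fun n s => Nat.find (hex n s)
  have hN : ∀ n, Measurable (N n) := fun n => measurable_find (hex n) fun k =>
    measurableSet_lt ((stronglyMeasurable_const.sub hg').enorm) measurable_const
  have hNs : ∀ n s, ‖d (N n s) - g' s‖ₑ < 2⁻¹ ^ n := fun n s => Nat.find_spec (hex n s)
  let f : ℕ → α → X → ℂ := fun n s x => d (N n s) x
  have hf : ∀ n, Measurable (Function.uncurry (f n)) := by
    intro n
    have h1 : Measurable fun q : ℕ × X => (d q.1 : X → ℂ) q.2 :=
      measurable_from_prod_countable_right fun k => (Lp.stronglyMeasurable (d k)).measurable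
    exact h1.comp (((hN n).comp measurable_fst).prodMk measurable_snd)
  -- `limUnder` is measurable everywhere, whatever value it takes where the sequence diverges.
  refine ⟨fun s x => limUnder atTop (fun n => f n s x), ?_, ?_⟩
  · exact (StronglyMeasurable.limUnder (l := atTop) (f := fun n => Function.uncurry (f n))
      fun n => (hf n).stronglyMeasurable).measurable
  · filter_upwards [hgg'] with s hs
    rw [hs]
    have hfae : ∀ n, AEStronglyMeasurable (f n s) ν := fun n => Lp.aestronglyMeasurable _
    have hdist : ∀ n, eLpNorm (f n s - (g' s : X → ℂ)) 2 ν ≤ 2⁻¹ ^ n := fun n => by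
      refine le_trans (le_of_eq ?_) (hNs n s).le
      rw [Lp.enorm_def]
      exact eLpNorm_congr_ae (Lp.coeFn_sub _ _).symm
    have hlt : ∀ k : ℕ, (2⁻¹ : ℝ≥0∞) ^ k ≠ ∞ := fun k => by simp
    -- The distance is at most 2 · 2⁻ᴷ; the factor 4 only makes the inequality strict.
    have hcau : ∀ K n m : ℕ, K ≤ n → K ≤ m →
        eLpNorm (f n s - f m s) 2 ν < 4 * 2⁻¹ ^ K := by
      intro K n m hn hm
      have h1 : f n s - f m s = (f n s - (g' s : X → ℂ)) - (f m s - (g' s : X → ℂ)) := by abel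
      have h2 : ∀ n, K ≤ n → (2⁻¹ : ℝ≥0∞) ^ n ≤ 2⁻¹ ^ K := fun n hn =>
        pow_le_pow_of_le_one zero_le (by norm_num) hn
      calc eLpNorm (f n s - f m s) 2 ν
          ≤ eLpNorm (f n s - (g' s : X → ℂ)) 2 ν + eLpNorm (f m s - (g' s : X → ℂ)) 2 ν := by
            rw [h1]
            exact eLpNorm_sub_le ((hfae n).sub (Lp.aestronglyMeasurable _))
              ((hfae m).sub (Lp.aestronglyMeasurable _)) (by norm_num)
        _ ≤ 2⁻¹ ^ K + 2⁻¹ ^ K := add_le_add ((hdist n).trans (h2 n hn)) ((hdist m).trans (h2 m hm))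
        _ = 2 * 2⁻¹ ^ K := by rw [two_mul]
        _ < 4 * 2⁻¹ ^ K := by
            refine (ENNReal.mul_lt_mul_iff_left (ENNReal.pow_pos (by norm_num) K).ne' (hlt K)).2 ?_
            norm_num
    have hB : ∑' i : ℕ, (4 * 2⁻¹ ^ i : ℝ≥0∞) ≠ ∞ := by
      rw [ENNReal.tsum_mul_left, ENNReal.tsum_geometric]
      simp [ENNReal.mul_eq_top]
    have h1 := Lp.ae_tendsto_of_cauchy_eLpNorm hfae (by norm_num) hB hcau
    have h2 : TendstoInMeasure ν (fun n => f n s) atTop (g' s) := by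
      refine tendstoInMeasure_of_tendsto_eLpNorm (by norm_num) hfae (Lp.aestronglyMeasurable _)
        (tendsto_of_tendsto_of_tendsto_of_le_of_le tendsto_const_nhds
          (ENNReal.tendsto_pow_atTop_nhds_zero_of_lt_one (by norm_num)) (fun _ => zero_le) hdist)
    obtain ⟨ns, hns, h3⟩ := h2.exists_seq_tendsto_ae
    filter_upwards [h1, h3] with x ⟨l, hl⟩ hx
    rw [hl.limUnder_eq]
    exact tendsto_nhds_unique (hl.comp hns.tendsto_atTop) hx

variable {J : Type u} {ι : Type v} {κ : Type w}
  [MeasurableSpace J] [MeasurableSpace ι] [MeasurableSpace κ]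
  [Countable J] [DiscreteMeasurableSpace J] [Countable ι] [DiscreteMeasurableSpace ι]
  [Countable κ] [DiscreteMeasurableSpace κ]

instance (η : ℝ) : SFinite (weighted J ι η) := by unfold weighted; infer_instance

instance : Fact ((2 : ℝ≥0∞) ≠ ∞) := ⟨by norm_num⟩

theorem fockNorm_mk {η : ℝ} {h : Chain J × ι → ℂ}
    (hm : AEStronglyMeasurable h (fockMeasure J ι)) :
    fockNorm η (AEEqFun.mk h hm : Sect J ι) = eLpNorm h 2 (weighted J ι η) :=
  fockNorm_eq_of_ae (AEEqFun.coeFn_mk _ _)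

/-- A weakly measurable function with values in `𝒢(ξ)` has a jointly measurable version. -/
theorem exists_isVersion {A : ℝ → Sect J ι} {ξ t : ℝ} (hξ : 0 < ξ)
    (hfin : ∀ᵐ s ∂(volume.restrict (Ioc 0 t)), fockNorm ξ (A s) < ∞)
    (hmeas : ∀ χ : GPlus J ι,
      AEMeasurable (fun s => pairing (χ : Sect J ι) (A s)) (volume.restrict (Ioc 0 t))) :
    ∃ a, IsVersion t A a := by
  classical
  let g : ℝ → Lp ℂ 2 (weighted J ι ξ) := fun s =>
    if h : fockNorm ξ (A s) < ∞ then (memLp_weighted h).toLp _ else 0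
  have hg : ∀ᵐ s ∂(volume.restrict (Ioc 0 t)), g s =ᵐ[fockMeasure J ι] (A s) := by
    filter_upwards [hfin] with s hs
    simp only [g, dif_pos hs]
    exact (fockMeasure_ac hξ).ae_eq (MemLp.coeFn_toLp _)
  have hgm : AEStronglyMeasurable g (volume.restrict (Ioc 0 t)) := by
    refine aestronglyMeasurable_of_inner fun h => ?_
    have hm : AEStronglyMeasurable h (fockMeasure J ι) :=
      (Lp.aestronglyMeasurable h).mono_ac (fockMeasure_ac hξ)
    let h' : Sect J ι := AEEqFun.mk h hm
    have hh' : h' =ᵐ[fockMeasure J ι] h := AEEqFun.coeFn_mk _ _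
    have hfin' : fockNorm ξ h' < ∞ := by
      rw [fockNorm_mk]; exact (Lp.memLp h).2
    -- Weak measurability is assumed against 𝒢⁺ only. These truncations of ξ^|τ| h(τ) belong to 𝒢⁺,
    -- and their pairings with A(s) tend to the scalar product of h and g(s) in 𝒢(ξ).
    let χ : ℕ → GPlus J ι := fun n => ⟨cutoff n ξ h', cutoff_mem_GPlus hξ hξ.le n hfin'⟩
    refine aemeasurable_of_tendsto_metrizable_ae atTop (fun n => hmeas (χ n)) ?_
    filter_upwards [hg, hfin] with s hs hsfin
    have hU : (⋃ n : ℕ, {x : Chain J × ι | x.1.length ≤ n}) = univ := by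
      ext x; simp only [mem_iUnion, mem_ofPred_eq, mem_univ, iff_true]; exact ⟨_, le_rfl⟩
    set F : Chain J × ι → ℂ := fun x =>
      (starRingEnd ℂ) (((ξ ^ x.1.length : ℝ) : ℂ) * h x) * (A s) x
    have hp : ∀ n, pairing (χ n : Sect J ι) (A s) =
        ∫ x in {x : Chain J × ι | x.1.length ≤ n}, F x ∂(fockMeasure J ι) := by
      intro n
      rw [pairing_congr (coeFn_cutoff n ξ h') (EventuallyEq.refl _ (A s)),
        ← integral_indicator (measurableSet_length_le n)]
      refine integral_congr_ae ?_
      filter_upwards [hh'] with x hx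
      by_cases hn : x ∈ {x : Chain J × ι | x.1.length ≤ n}
      · simp only [indicator_of_mem hn, F, hx]
      · simp only [indicator_of_notMem hn, map_zero, zero_mul]
    have hlim : (inner ℂ h (g s) : ℂ) = ∫ x, F x ∂(fockMeasure J ι) := by
      rw [inner_weighted hξ.le]
      refine integral_congr_ae ?_
      filter_upwards [hs] with x hx
      simp only [F, hx]
    simp only [hp]
    rw [hlim, ← setIntegral_univ, ← hU]
    refine tendsto_setIntegral_of_monotone (fun n => measurableSet_length_le n) ?_ ?_
    · intro a b hab x hx
      exact le_trans (show x.1.length ≤ a from hx) hab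
    · rw [hU, integrableOn_univ]
      refine integrable_conj_mul hξ ((measurable_pow_length ξ).aestronglyMeasurable.mul hm)
        (A s).aestronglyMeasurable ?_ hsfin
      have := fockNorm_mul_weight hξ
        (AEEqFun.coeFn_mk _ ((measurable_pow_length ξ).aestronglyMeasurable.mul hm))
      rw [fockNorm_mk] at this
      exact this.le.trans_lt (Lp.memLp h).2
  obtain ⟨a, ha, ha'⟩ := exists_jointly_measurable hgm
  refine ⟨a, ha, ?_⟩
  filter_upwards [ha', hg] with s h1 h2
  exact ((fockMeasure_ac hξ).ae_eq h1).trans h2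

theorem isAdjoint_adj {A : GPlus J ι →ₗ[ℂ] GDual J κ} {ζ ξ : ℝ} (hζ : 1 < ζ) (hξ : 0 < ξ)
    (h : opNorm ζ ξ (fun φ => (A φ : Sect J κ)) < ∞) : IsAdjoint A (adj A) := by
  have hex := exists_isAdjoint hζ hξ h
  rw [adj, dif_pos hex]
  exact hex.choose_spec

theorem measurable_pairing_version {a b : ℝ → Chain J × ι → ℂ}
    (ha : Measurable (Function.uncurry a)) (hb : Measurable (Function.uncurry b)) :
    Measurable fun s => ∫ x, (starRingEnd ℂ) (a s x) * b s x ∂(fockMeasure J ι) := by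
  have h : StronglyMeasurable (Function.uncurry fun s x =>
      (starRingEnd ℂ) (a s x) * b s x) :=
    ((RCLike.continuous_conj.measurable.comp ha).mul hb).stronglyMeasurable
  exact h.integral_prod_right.measurable

/-- Weak measurability of A concerns a fixed vector, whereas f(s) moves with s. For fixed χ,
however, s ↦ A(s)*χ is weakly measurable and has a jointly measurable version, so ⟨χ | A(s) f(s)⟩ =
⟨A(s)*χ | f(s)⟩ is the τ-integral of a jointly measurable function. -/
theorem exists_isVersion_apply {A : ℝ → (GPlus J ι →ₗ[ℂ] GDual J κ)} (hA : WeaklyMeasurable A)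
    {ζ ξ t : ℝ} (hζ : 1 < ζ) (hξ : 0 < ξ)
    (hfin : ∀ᵐ s ∂(volume.restrict (Ioc 0 t)), opNorm ζ ξ (fun φ => (A s φ : Sect J κ)) < ∞)
    {f : ℝ → GPlus J ι} {b : ℝ → Chain J × ι → ℂ}
    (hf : IsVersion t (fun s => (f s : Sect J ι)) b) :
    ∃ a, IsVersion t (fun s => (A s (f s) : Sect J κ)) a := by
  have hζ0 : 0 < ζ := one_pos.trans hζ
  have hle : volume.restrict (Ioc 0 t) ≤ volume.restrict (Ioi (0 : ℝ)) :=
    Measure.restrict_mono (fun x hx => hx.1) le_rfl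
  refine exists_isVersion hξ ?_ fun χ => ?_
  · filter_upwards [hfin] with s hs
    exact (fockNorm_le_opNorm (A s) hζ0 ξ (f s)).trans_lt
      (ENNReal.mul_lt_top hs (fockNorm_lt_top _ hζ0.le))
  · obtain ⟨c, hc, hc'⟩ := exists_isVersion (A := fun s => (adj (A s) χ : Sect J ι)) (t := t)
      (inv_pos.2 hζ0) (by
        filter_upwards [hfin] with s hs
        refine (fockNorm_le_opNorm (adj (A s)) (inv_pos.2 hξ) _ χ).trans_lt
          (ENNReal.mul_lt_top ?_ (fockNorm_lt_top _ (inv_pos.2 hξ).le))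
        exact ((isAdjoint_adj hζ hξ hs).opNorm_le hζ0 hξ).trans_lt hs) (fun φ => by
        refine ((RCLike.continuous_conj.measurable.comp_aemeasurable
          ((hA φ χ).mono_measure hle))).congr ?_
        filter_upwards [hfin] with s hs
        simp only [Function.comp]
        rw [← isAdjoint_adj hζ hξ hs χ φ, pairing_conj])
    refine (measurable_pairing_version hc hf.1).aemeasurable.congr ?_
    filter_upwards [hfin, hc', hf.2] with s hs h1 h2
    rw [← isAdjoint_adj hζ hξ hs χ (f s)]
    exact (pairing_congr h1.symm h2.symm).symm

/-- One term of the binomial expansion. It trades the number of points of a chain for a shift of the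
exponent, which is where all powers of 1/ε come from. -/
theorem mul_pow_le (ζ ε : ℝ) (hζ : 0 ≤ ζ) (hε : 0 ≤ ε) (n : ℕ) :
    (n + 1) * ζ ^ n * ε ≤ (ζ + ε) ^ (n + 1) := by
  -- The induction needs the leading term of the expansion as well.
  have h : ∀ n : ℕ, ζ ^ (n + 1) + (n + 1) * ζ ^ n * ε ≤ (ζ + ε) ^ (n + 1) := by
    intro n
    induction n with
    | zero => simp
    | succ n ih =>
      calc ζ ^ (n + 1 + 1) + (((n + 1 : ℕ) : ℝ) + 1) * ζ ^ (n + 1) * ε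
          ≤ (ζ ^ (n + 1) + (n + 1) * ζ ^ n * ε) * (ζ + ε) := by
            have : 0 ≤ (n + 1 : ℝ) * ζ ^ n * ε * ε := by positivity
            push_cast
            simp only [pow_succ]
            nlinarith
        _ ≤ (ζ + ε) ^ (n + 1) * (ζ + ε) := mul_le_mul_of_nonneg_right ih (add_nonneg hζ hε)
        _ = _ := (pow_succ _ _).symm
  exact (le_add_of_nonneg_left (pow_nonneg hζ _)).trans (h n)

/-- The jointly measurable version of `s ↦ φ(· ⊔ s)`. -/
def pointVersion (φ : Sect J Unit) (s : ℝ) (x : Chain J × J) : ℂ :=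
  φ (x.1.insert (s, x.2), ())

theorem measurable_pointVersion (φ : Sect J Unit) :
    Measurable (Function.uncurry (pointVersion φ)) :=
  φ.measurable.comp (measurable_insert_snd.prodMk measurable_const)

/-- By the sum-integral formula the left side is ∫ |τ| ζ^(|τ| - 1) ‖φ(τ)‖² dτ, because each of the
|τ| points contributes the same amount; then `mul_pow_le` applies. -/
theorem lintegral_pointVersion_le (φ : Sect J Unit) {ζ ε : ℝ} (hζ : 0 ≤ ζ) (hε : 0 < ε) :
    ∫⁻ s in Ioi (0 : ℝ), eLpNorm (pointVersion φ s) 2 (weighted J J ζ) ^ 2 ≤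
      ENNReal.ofReal (1 / ε) * fockNorm (ζ + ε) φ ^ 2 := by
  have hm : Measurable fun z : ℝ × (Chain J × J) =>
      ENNReal.ofReal (ζ ^ z.2.1.length) * ‖pointVersion φ z.1 z.2‖ₑ ^ 2 :=
    ((measurable_weight ζ).comp measurable_snd).mul ((measurable_pointVersion φ).enorm.pow_const 2)
  simp only [eLpNorm_weighted_sq]
  rw [← lintegral_prod _ hm.aemeasurable, ← lintegral_sum_erase hm, fockNorm, eLpNorm_weighted_sq,
    ← lintegral_const_mul' _ _ ENNReal.ofReal_ne_top]
  refine lintegral_mono fun x => ?_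
  have h1 : ∀ p ∈ x.1.points, ENNReal.ofReal (ζ ^ (x.1.erase p).length) *
      ‖pointVersion φ p.1 (x.1.erase p, p.2)‖ₑ ^ 2 =
      ENNReal.ofReal (ζ ^ (x.1.length - 1)) * ‖φ x‖ₑ ^ 2 := by
    intro p hp
    have h2 : (x.1.erase p).length = x.1.length - 1 := by
      rw [← Chain.length_erase hp]; rfl
    rw [h2, pointVersion]
    simp only [Prod.mk.eta]
    rw [Chain.insert_erase hp]
  simp only
  rw [Finset.sum_congr rfl h1, Finset.sum_const, nsmul_eq_mul, ← mul_assoc, ← mul_assoc]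
  refine mul_le_mul_left ?_ _
  change ((x.1.length : ℕ) : ℝ≥0∞) * _ ≤ _
  rcases Nat.eq_zero_or_pos x.1.length with h0 | h0
  · rw [h0]; simp
  · obtain ⟨n, hn⟩ := Nat.exists_eq_succ_of_ne_zero h0.ne'
    rw [hn, ← ENNReal.ofReal_natCast, ← ENNReal.ofReal_mul (Nat.cast_nonneg _),
      ← ENNReal.ofReal_mul (by positivity)]
    refine ENNReal.ofReal_le_ofReal ?_
    rw [one_div, inv_mul_eq_div, le_div_iff₀ hε]
    have := mul_pow_le ζ ε hζ hε.le n
    simpa using this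

theorem pointVersion_ae_eq {φ : Sect J Unit} {f : Chain J × Unit → ℂ}
    (h : φ =ᵐ[fockMeasure J Unit] f) :
    ∀ᵐ s ∂(volume.restrict (Ioi (0 : ℝ))), pointVersion φ s =ᵐ[fockMeasure J J]
      fun x => f (x.1.insert (s, x.2), ()) :=
  Measure.ae_ae_of_ae_prod (quasiMeasurePreserving_insert.ae h)

theorem atPoint_ae_eq (φ : GPlus J Unit) :
    ∀ᵐ s ∂(volume.restrict (Ioi (0 : ℝ))),
      (atPoint φ s : Sect J J) =ᵐ[fockMeasure J J] pointVersion (φ : Sect J Unit) s := by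
  have hms : ∀ s, AEStronglyMeasurable (pointVersion (φ : Sect J Unit) s) (fockMeasure J J) :=
    fun s => ((measurable_pointVersion (φ : Sect J Unit)).comp
      measurable_prodMk_left).aestronglyMeasurable
  -- Integer exponents suffice as the norms increase with the exponent, and they leave only
  -- countably many null sets.
  have h1 : ∀ n : ℕ, ∀ᵐ s ∂(volume.restrict (Ioi (0 : ℝ))),
      eLpNorm (pointVersion (φ : Sect J Unit) s) 2 (weighted J J n) < ∞ := by
    intro n
    have h2 := (lintegral_pointVersion_le (φ : Sect J Unit) (Nat.cast_nonneg n) one_pos).trans_lt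
      (ENNReal.mul_lt_top ENNReal.ofReal_lt_top
        (ENNReal.pow_lt_top (fockNorm_lt_top φ (by positivity : (0 : ℝ) ≤ n + 1))))
    have hm : Measurable fun s : ℝ =>
        eLpNorm (pointVersion (φ : Sect J Unit) s) 2 (weighted J J n) ^ 2 := by
      simp only [eLpNorm_weighted_sq]
      have hm : Measurable fun z : ℝ × (Chain J × J) => ENNReal.ofReal ((n : ℝ) ^ z.2.1.length) *
          ‖pointVersion (φ : Sect J Unit) z.1 z.2‖ₑ ^ 2 :=
        ((measurable_weight (n : ℝ)).comp measurable_snd).mul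
          ((measurable_pointVersion (φ : Sect J Unit)).enorm.pow_const 2)
      exact hm.lintegral_prod_right'
    filter_upwards [ae_lt_top hm h2.ne] with s hs
    simpa using hs
  filter_upwards [ae_all_iff.2 h1] with s hs
  have hex : ∃ ψ : GPlus J J, (ψ : Sect J J) =ᵐ[fockMeasure J J]
      fun x => (φ : Sect J Unit) (x.1.insert (s, x.2), ()) := by
    refine ⟨⟨AEEqFun.mk _ (hms s), mem_GPlus.2 fun ζ hζ => ?_⟩, AEEqFun.coeFn_mk _ (hms s)⟩
    obtain ⟨n, hn⟩ := exists_nat_ge ζ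
    refine (fockNorm_mono (one_pos.trans hζ).le hn _).trans_lt ?_
    rw [fockNorm_mk]
    exact hs n
  rw [atPoint, dif_pos hex]
  exact hex.choose_spec

theorem isVersion_atPoint (φ : GPlus J Unit) (t : ℝ) :
    IsVersion t (fun s => (atPoint φ s : Sect J J)) (pointVersion (φ : Sect J Unit)) :=
  ⟨measurable_pointVersion _, by
    filter_upwards [ae_restrict_of_ae_restrict_of_subset (fun x (hx : x ∈ Ioc 0 t) => hx.1)
      (atPoint_ae_eq φ)] with s hs using hs.symm⟩

end Versions

/-! ### Estimates -/

section Estimates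

/-- Minkowski's integral inequality in L²: write the square as a double integral over (s, r),
exchange the integrals and apply Cauchy–Schwarz in x. -/
theorem lintegral_sq_lintegral_le {α X : Type*} [MeasurableSpace α] [MeasurableSpace X]
    {m : Measure α} {ν : Measure X} [SFinite m] [SFinite ν] {a : α → X → ℂ}
    (ha : Measurable (Function.uncurry a)) :
    ∫⁻ x, (∫⁻ s, ‖a s x‖ₑ ∂m) ^ 2 ∂ν ≤ (∫⁻ s, eLpNorm (a s) 2 ν ∂m) ^ 2 := by
  have hf : Measurable fun z : α × X => ‖a z.1 z.2‖ₑ := ha.enorm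
  have hfs : ∀ s, Measurable fun x => ‖a s x‖ₑ := fun s => hf.comp measurable_prodMk_left
  have hfx : ∀ x, Measurable fun s => ‖a s x‖ₑ := fun x => hf.comp measurable_prodMk_right
  have hfin : ∀ s r, ∫⁻ x, ‖a s x‖ₑ * ‖a r x‖ₑ ∂ν ≤ eLpNorm (a s) 2 ν * eLpNorm (a r) 2 ν := by
    intro s r
    have := ENNReal.lintegral_mul_le_Lp_mul_Lq ν Real.HolderConjugate.two_two
      (hfs s).aemeasurable (hfs r).aemeasurable
    rw [eLpNorm_eq_lintegral_rpow_enorm_toReal (by norm_num) (by norm_num),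
      eLpNorm_eq_lintegral_rpow_enorm_toReal (by norm_num) (by norm_num)]
    simpa using this
  have hN : Measurable fun s => eLpNorm (a s) 2 ν := by
    simp only [eLpNorm_eq_lintegral_rpow_enorm_toReal (two_ne_zero) (ENNReal.ofNat_ne_top)]
    exact ((hf.pow_const _).lintegral_prod_right').pow_const _
  calc ∫⁻ x, (∫⁻ s, ‖a s x‖ₑ ∂m) ^ 2 ∂ν
      = ∫⁻ x, ∫⁻ s, ∫⁻ r, ‖a s x‖ₑ * ‖a r x‖ₑ ∂m ∂m ∂ν := by
        refine lintegral_congr fun x => ?_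
        rw [sq, ← lintegral_mul_const _ (hfx x)]
        exact lintegral_congr fun s => (lintegral_const_mul _ (hfx x)).symm
    _ = ∫⁻ s, ∫⁻ r, ∫⁻ x, ‖a s x‖ₑ * ‖a r x‖ₑ ∂ν ∂m ∂m := by
        have h1 : Measurable fun q : (X × α) × α => ‖a q.1.2 q.1.1‖ₑ * ‖a q.2 q.1.1‖ₑ :=
          (hf.comp (measurable_fst.snd.prodMk measurable_fst.fst)).mul
            (hf.comp (measurable_snd.prodMk measurable_fst.fst))
        rw [lintegral_lintegral_swap (h1.lintegral_prod_right').aemeasurable]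
        refine lintegral_congr fun s => ?_
        refine lintegral_lintegral_swap (Measurable.aemeasurable ?_)
        exact h1.comp ((measurable_fst.prodMk measurable_const).prodMk measurable_snd)
    _ ≤ ∫⁻ s, ∫⁻ r, eLpNorm (a s) 2 ν * eLpNorm (a r) 2 ν ∂m ∂m :=
        lintegral_mono fun s => lintegral_mono fun r => hfin s r
    _ = (∫⁻ s, eLpNorm (a s) 2 ν ∂m) ^ 2 := by
        rw [sq, ← lintegral_mul_const _ hN]
        exact lintegral_congr fun s => lintegral_const_mul _ hN

/-- Cauchy–Schwarz with a factor N that need not be measurable; in the application it is an operator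
norm, a supremum over an uncountable family. It is therefore applied to the measurable quotient f /
g, which is at most N. -/
theorem lintegral_le_of_le_mul {α : Type*} [MeasurableSpace α] {m : Measure α}
    {f N g : α → ℝ≥0∞} (hf : AEMeasurable f m) (hg : AEMeasurable g m)
    (h : ∀ᵐ s ∂m, f s ≤ N s * g s) (hfin : ∀ᵐ s ∂m, g s < ∞) :
    ∫⁻ s, f s ∂m ≤ eLpNorm N 2 m * (∫⁻ s, g s ^ 2 ∂m) ^ (1 / 2 : ℝ) := by
  have h1 := ENNReal.lintegral_mul_le_Lp_mul_Lq m Real.HolderConjugate.two_two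
      (hf.div hg) hg
  rw [eLpNorm_eq_lintegral_rpow_enorm_toReal (by norm_num) (by norm_num)]
  refine le_trans (lintegral_mono_ae ?_) (h1.trans (mul_le_mul' ?_ (le_of_eq (by simp))))
  · filter_upwards [h, hfin] with s hs hs'
    simp only [Pi.mul_apply, Pi.div_apply]
    rcases eq_or_ne (g s) 0 with h0 | h0
    · rw [h0, mul_zero] at hs
      exact hs.trans zero_le
    · rw [ENNReal.div_mul_cancel h0 hs'.ne]
  · simp only [ENNReal.toReal_ofNat, enorm_eq_self, Pi.div_apply]
    refine ENNReal.rpow_le_rpow (lintegral_mono_ae ?_) (by norm_num)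
    filter_upwards [h] with s hs
    exact ENNReal.rpow_le_rpow (ENNReal.div_le_of_le_mul hs) (by norm_num)

variable {J : Type u} [MeasurableSpace J] [Countable J] [DiscreteMeasurableSpace J]

theorem measurable_eLpNorm_version {ι : Type v} [MeasurableSpace ι] [Countable ι]
    [DiscreteMeasurableSpace ι] {a : ℝ → Chain J × ι → ℂ}
    (ha : Measurable (Function.uncurry a)) (η : ℝ) :
    Measurable fun s => eLpNorm (a s) 2 (weighted J ι η) := by
  have hm : Measurable fun z : ℝ × (Chain J × ι) =>
      ENNReal.ofReal (η ^ z.2.1.length) * ‖a z.1 z.2‖ₑ ^ 2 :=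
    ((measurable_weight η).comp measurable_snd).mul (ha.enorm.pow_const 2)
  simp only [eLpNorm_weighted]
  exact (hm.lintegral_prod_right').pow_const _

theorem eLpNorm_integral_le {a : ℝ → Chain J × Unit → ℂ} (ha : Measurable (Function.uncurry a))
    (η t : ℝ) :
    eLpNorm (fun x => ∫ s in Ioc 0 t, a s x) 2 (weighted J Unit η) ≤
      ∫⁻ s in Ioc 0 t, eLpNorm (a s) 2 (weighted J Unit η) := by
  refine (ENNReal.pow_le_pow_left_iff (two_ne_zero)).1 (le_trans ?_
    (lintegral_sq_lintegral_le (m := volume.restrict (Ioc 0 t)) (ν := weighted J Unit η) ha))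
  rw [eLpNorm_weighted_sq, lintegral_weighted]
  refine lintegral_mono fun x => ?_
  gcongr
  exact enorm_integral_le_lintegral_enorm _

theorem ae_integrableOn_of_lintegral {a : ℝ → Chain J × Unit → ℂ}
    (ha : Measurable (Function.uncurry a)) {η : ℝ} (hη : 0 < η) (t : ℝ)
    (h : ∫⁻ s in Ioc 0 t, eLpNorm (a s) 2 (weighted J Unit η) < ∞) :
    ∀ᵐ x ∂(fockMeasure J Unit), IntegrableOn (fun s => a s x) (Ioc 0 t) := by
  have h1 := (lintegral_sq_lintegral_le (m := volume.restrict (Ioc 0 t))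
    (ν := weighted J Unit η) ha).trans_lt (ENNReal.pow_lt_top h)
  have hm : Measurable fun x : Chain J × Unit => (∫⁻ s in Ioc 0 t, ‖a s x‖ₑ) ^ 2 :=
    (ha.enorm.lintegral_prod_left').pow_const 2
  filter_upwards [(fockMeasure_ac hη).ae_le (ae_lt_top hm h1.ne)] with x hx
  refine ⟨(ha.comp measurable_prodMk_right).aestronglyMeasurable, ?_⟩
  simpa [HasFiniteIntegral] using hx

/-- Cauchy–Schwarz over the at most |τ| summands costs a factor |τ|. After the sum-integral formula
the weight is (n + 1)(ξ - ε)ⁿ⁺¹ with n the length of τ \ p. By `mul_pow_le` it is at most ε⁻¹ ξⁿ⁺¹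
(ξ - ε), and ξ ≤ 1 reduces this to ε⁻¹ ξⁿ. -/
theorem eLpNorm_sum_erase_sq_le {c : ℝ → Chain J × J → ℂ} (hc : Measurable (Function.uncurry c))
    {ξ ε : ℝ} (hξ : ξ ≤ 1) (hε : 0 < ε) (hεξ : ε < ξ) (t : ℝ) :
    eLpNorm (fun x : Chain J × Unit => ∑ p ∈ x.1.points with p.1 ≤ t, c p.1 (x.1.erase p, p.2)) 2
        (weighted J Unit (ξ - ε)) ^ 2 ≤
      ENNReal.ofReal (1 / ε) * ∫⁻ s in Ioc 0 t, eLpNorm (c s) 2 (weighted J J ξ) ^ 2 := by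
  have hη : 0 ≤ ξ - ε := sub_nonneg.2 hεξ.le
  have hξ0 : 0 ≤ ξ := hε.le.trans hεξ.le
  let G : ℝ × (Chain J × J) → ℝ≥0∞ := fun z =>
    ENNReal.ofReal ((z.2.1.length + 1 : ℕ) * (ξ - ε) ^ (z.2.1.length + 1)) * ‖c z.1 z.2‖ₑ ^ 2
  have hG : Measurable G := by
    have h : Measurable fun n : ℕ => ENNReal.ofReal ((n + 1 : ℕ) * (ξ - ε) ^ (n + 1)) :=
      Measurable.of_discrete
    exact (h.comp (measurable_length.comp measurable_snd.fst)).mul (hc.enorm.pow_const 2)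
  have hm : Measurable fun z : ℝ × (Chain J × J) =>
      ENNReal.ofReal (ξ ^ z.2.1.length) * ‖c z.1 z.2‖ₑ ^ 2 :=
    ((measurable_weight ξ).comp measurable_snd).mul (hc.enorm.pow_const 2)
  simp only [eLpNorm_weighted_sq]
  calc ∫⁻ x, ENNReal.ofReal ((ξ - ε) ^ x.1.length) *
        ‖∑ p ∈ x.1.points with p.1 ≤ t, c p.1 (x.1.erase p, p.2)‖ₑ ^ 2 ∂(fockMeasure J Unit)
      ≤ ∫⁻ x, ∑ p ∈ x.1.points with p.1 ≤ t, G (p.1, (x.1.erase p, p.2))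
          ∂(fockMeasure J Unit) := by
        refine lintegral_mono fun x => ?_
        have h1 : ‖∑ p ∈ x.1.points with p.1 ≤ t, c p.1 (x.1.erase p, p.2)‖ₑ ^ 2 ≤
            (x.1.length : ℝ≥0∞) * ∑ p ∈ x.1.points with p.1 ≤ t,
              ‖c p.1 (x.1.erase p, p.2)‖ₑ ^ 2 := by
          have h2 : ‖∑ p ∈ x.1.points with p.1 ≤ t, c p.1 (x.1.erase p, p.2)‖ ^ 2 ≤
              (x.1.length : ℝ) * ∑ p ∈ x.1.points with p.1 ≤ t,
                ‖c p.1 (x.1.erase p, p.2)‖ ^ 2 := by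
            refine (pow_le_pow_left₀ (norm_nonneg _) (norm_sum_le _ _) 2).trans
              (sq_sum_le_card_mul_sum_sq.trans ?_)
            refine mul_le_mul_of_nonneg_right ?_ (Finset.sum_nonneg fun _ _ => by positivity)
            exact_mod_cast Finset.card_filter_le _ _
          rw [← ofReal_norm, ← ENNReal.ofReal_pow (norm_nonneg _)]
          refine (ENNReal.ofReal_le_ofReal h2).trans (le_of_eq ?_)
          rw [ENNReal.ofReal_mul (Nat.cast_nonneg _), ENNReal.ofReal_natCast,
            ENNReal.ofReal_sum_of_nonneg fun _ _ => by positivity]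
          congr 1
          refine Finset.sum_congr rfl fun p _ => ?_
          rw [ENNReal.ofReal_pow (norm_nonneg _), ofReal_norm]
        refine (mul_le_mul_right h1 _).trans (le_of_eq ?_)
        rw [← mul_assoc, Finset.mul_sum]
        refine Finset.sum_congr rfl fun p hp => ?_
        have hl := Chain.length_erase (Finset.mem_filter.1 hp).1
        simp only [G]
        rw [hl, ENNReal.ofReal_mul (Nat.cast_nonneg _), ENNReal.ofReal_natCast]
        ring
    _ = ∫⁻ z, G z ∂((volume.restrict (Ioc 0 t)).prod (fockMeasure J J)) :=
        lintegral_sum_erase_le hG t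
    _ ≤ ∫⁻ z, ENNReal.ofReal (1 / ε) * (ENNReal.ofReal (ξ ^ z.2.1.length) * ‖c z.1 z.2‖ₑ ^ 2)
          ∂((volume.restrict (Ioc 0 t)).prod (fockMeasure J J)) := by
        refine lintegral_mono fun z => ?_
        simp only [G]
        rw [← mul_assoc]
        refine mul_le_mul_left ?_ _
        rw [← ENNReal.ofReal_mul (by positivity)]
        refine ENNReal.ofReal_le_ofReal ?_
        rw [one_div, inv_mul_eq_div, le_div_iff₀ hε]
        generalize z.2.1.length = n
        have h1 := mul_pow_le (ξ - ε) ε hη hε.le n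
        rw [sub_add_cancel] at h1
        have h2 : ξ ^ (n + 1) * (ξ - ε) ≤ ξ ^ n := by
          rw [pow_succ, mul_assoc]
          refine mul_le_of_le_one_right (pow_nonneg hξ0 _) ?_
          exact mul_le_one₀ hξ hη (by linarith)
        push_cast
        calc ((n : ℝ) + 1) * (ξ - ε) ^ (n + 1) * ε
            = ((n : ℝ) + 1) * (ξ - ε) ^ n * ε * (ξ - ε) := by ring
          _ ≤ ξ ^ (n + 1) * (ξ - ε) := mul_le_mul_of_nonneg_right h1 hη
          _ ≤ ξ ^ n := h2
    _ = ENNReal.ofReal (1 / ε) * ∫⁻ s in Ioc 0 t, ∫⁻ x, ENNReal.ofReal (ξ ^ x.1.length) *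
          ‖c s x‖ₑ ^ 2 ∂(fockMeasure J J) := by
        rw [lintegral_const_mul _ hm, lintegral_prod _ hm.aemeasurable]

theorem ofReal_one_div_sqrt_sq {ε : ℝ} (hε : 0 < ε) :
    ENNReal.ofReal (1 / √ε) ^ 2 = ENNReal.ofReal (1 / ε) := by
  rw [← ENNReal.ofReal_pow (by positivity), div_pow, one_pow, Real.sq_sqrt hε.le]

theorem eLpNorm_sum_erase_le {c : ℝ → Chain J × J → ℂ} (hc : Measurable (Function.uncurry c))
    {ξ ε : ℝ} (hξ : ξ ≤ 1) (hε : 0 < ε) (hεξ : ε < ξ) (t : ℝ) {B : ℝ≥0∞}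
    (h : ∫⁻ s in Ioc 0 t, eLpNorm (c s) 2 (weighted J J ξ) ^ 2 ≤ B ^ 2) :
    eLpNorm (fun x : Chain J × Unit => ∑ p ∈ x.1.points with p.1 ≤ t, c p.1 (x.1.erase p, p.2)) 2
        (weighted J Unit (ξ - ε)) ≤ ENNReal.ofReal (1 / √ε) * B := by
  refine (ENNReal.pow_le_pow_left_iff (two_ne_zero)).1 ?_
  rw [mul_pow, ofReal_one_div_sqrt_sq hε]
  exact (eLpNorm_sum_erase_sq_le hc hξ hε hεξ t).trans (by gcongr)

theorem lintegral_atPoint_le (φ : GPlus J Unit) (t : ℝ) {ζ ε : ℝ} (hζ : 0 ≤ ζ) (hε : 0 < ε) :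
    ∫⁻ s in Ioc 0 t, eLpNorm (pointVersion (φ : Sect J Unit) s) 2 (weighted J J ζ) ^ 2 ≤
      (ENNReal.ofReal (1 / √ε) * fockNorm (ζ + ε) (φ : Sect J Unit)) ^ 2 := by
  rw [mul_pow, ofReal_one_div_sqrt_sq hε]
  exact (lintegral_mono_set fun x hx => hx.1).trans
    (lintegral_pointVersion_le (φ : Sect J Unit) hζ hε)

end Estimates

/-! ### Bounds for the four terms and existence of the integral. -/

section Integral

variable {J : Type u} [MeasurableSpace J] [Countable J] [DiscreteMeasurableSpace J]
  {ι : Type v} {κ : Type w} [MeasurableSpace ι] [MeasurableSpace κ]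

theorem IsVersion.eLpNorm_le {t ζ ξ : ℝ} (hζ : 0 < ζ) {A : ℝ → (GPlus J ι →ₗ[ℂ] GDual J κ)}
    {f : ℝ → GPlus J ι} {a : ℝ → Chain J × κ → ℂ}
    (ha : IsVersion t (fun s => (A s (f s) : Sect J κ)) a) :
    ∀ᵐ s ∂(volume.restrict (Ioc 0 t)), eLpNorm (a s) 2 (weighted J κ ξ) ≤
      opNorm ζ ξ (fun φ => (A s φ : Sect J κ)) * fockNorm ζ (f s : Sect J ι) := by
  filter_upwards [ha.2] with s hs
  rw [← fockNorm_eq_of_ae hs.symm]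
  exact fockNorm_le_opNorm (A s) hζ ξ (f s)

theorem IsVersion.fockNorm_eq {t ζ : ℝ} {A : ℝ → Sect J ι} {a : ℝ → Chain J × ι → ℂ}
    (ha : IsVersion t A a) :
    ∀ᵐ s ∂(volume.restrict (Ioc 0 t)), fockNorm ζ (A s) = eLpNorm (a s) 2 (weighted J ι ζ) := by
  filter_upwards [ha.2] with s hs using fockNorm_eq_of_ae hs.symm

theorem isVersion_const (φ : Sect J ι) (t : ℝ) :
    IsVersion t (fun _ => φ) (fun _ => φ) :=
  ⟨φ.measurable.comp measurable_snd, ae_of_all _ fun _ => EventuallyEq.rfl⟩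

theorem procNorm_one (ζ ξ t : ℝ) (A : ℝ → (GPlus J ι →ₗ[ℂ] GDual J κ)) :
    procNorm 1 ζ ξ t A = ∫⁻ s in Ioc 0 t, opNorm ζ ξ fun φ => (A s φ : Sect J κ) := by
  rw [procNorm, eLpNorm_one_eq_lintegral_enorm]
  simp

theorem procNorm_two_sq (ζ ξ t : ℝ) (A : ℝ → (GPlus J ι →ₗ[ℂ] GDual J κ)) :
    procNorm 2 ζ ξ t A ^ 2 =
      ∫⁻ s in Ioc 0 t, (opNorm ζ ξ fun φ => (A s φ : Sect J κ)) ^ 2 := by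
  rw [procNorm, eLpNorm_eq_lintegral_rpow_enorm_toReal (by norm_num) (by norm_num),
    ← ENNReal.rpow_natCast, ← ENNReal.rpow_mul]
  norm_num

theorem opNorm_le_procNorm_top (ζ ξ t : ℝ) (A : ℝ → (GPlus J ι →ₗ[ℂ] GDual J κ)) :
    ∀ᵐ s ∂(volume.restrict (Ioc 0 t)),
      opNorm ζ ξ (fun φ => (A s φ : Sect J κ)) ≤ procNorm ∞ ζ ξ t A := by
  rw [procNorm, eLpNorm_exponent_top]
  filter_upwards [enorm_ae_le_eLpNormEssSup
    (fun s => opNorm ζ ξ fun φ => (A s φ : Sect J κ)) (volume.restrict (Ioc 0 t))] with s hs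
  simpa using hs

/-- The bound for the QS integral. -/
def qsBound (C : MatrixProcess J) (ζ ξ t ε : ℝ) : ℝ≥0∞ :=
  procNorm 1 ζ ξ t C.time +
    ENNReal.ofReal (1 / √ε) * (procNorm 2 ζ ξ t C.annihilation + procNorm 2 ζ ξ t C.creation) +
    ENNReal.ofReal (1 / ε) * procNorm ∞ ζ ξ t C.number

theorem qsBound_lt_top {C : MatrixProcess J} {ζ ξ t : ℝ} (h : C.IntegrableOn ζ ξ t) (ε : ℝ) :
    qsBound C ζ ξ t ε < ∞ :=
  ENNReal.add_lt_top.2 ⟨ENNReal.add_lt_top.2 ⟨h.1.2, ENNReal.mul_lt_top ENNReal.ofReal_lt_top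
    (ENNReal.add_lt_top.2 ⟨h.2.1.2, h.2.2.1.2⟩)⟩,
    ENNReal.mul_lt_top ENNReal.ofReal_lt_top h.2.2.2.2⟩

section Bounds

variable {C : MatrixProcess J} {ζ ξ t : ℝ} {φ : GPlus J Unit}

theorem lintegral_time_le (hζ : 0 < ζ) {a : ℝ → Chain J × Unit → ℂ}
    (ha : IsVersion t (fun s => (C.time s φ : Sect J Unit)) a) :
    ∫⁻ s in Ioc 0 t, eLpNorm (a s) 2 (weighted J Unit ξ) ≤
      procNorm 1 ζ ξ t C.time * fockNorm ζ (φ : Sect J Unit) := by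
  rw [procNorm_one, ← lintegral_mul_const' _ _ (fockNorm_lt_top φ hζ.le).ne]
  exact lintegral_mono_ae (ha.eLpNorm_le hζ)

/-- Cauchy–Schwarz in s separates the operator norms from the norms of φₛ, and the latter bring in
the factor ε^(-1/2). -/
theorem lintegral_annihilation_le (hζ : 0 < ζ) {ε : ℝ} (hε : 0 < ε) {b : ℝ → Chain J × Unit → ℂ}
    (hb : IsVersion t (fun s => (C.annihilation s (atPoint φ s) : Sect J Unit)) b) :
    ∫⁻ s in Ioc 0 t, eLpNorm (b s) 2 (weighted J Unit ξ) ≤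
      ENNReal.ofReal (1 / √ε) * procNorm 2 ζ ξ t C.annihilation *
        fockNorm (ζ + ε) (φ : Sect J Unit) := by
  have hv := isVersion_atPoint φ t
  have h1 := lintegral_le_of_le_mul (m := volume.restrict (Ioc 0 t))
    (f := fun s => eLpNorm (b s) 2 (weighted J Unit ξ))
    (g := fun s => eLpNorm (pointVersion (φ : Sect J Unit) s) 2 (weighted J J ζ))
    (N := fun s => opNorm ζ ξ fun φ => (C.annihilation s φ : Sect J Unit))
    (measurable_eLpNorm_version hb.1 ξ).aemeasurable
    (measurable_eLpNorm_version hv.1 ζ).aemeasurable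
    (by
      filter_upwards [hb.eLpNorm_le (ξ := ξ) hζ, hv.fockNorm_eq (ζ := ζ)] with s h1 h2
      rwa [h2] at h1)
    (by
      filter_upwards [hv.fockNorm_eq (ζ := ζ)] with s h2
      rw [← h2]
      exact fockNorm_lt_top _ hζ.le)
  refine h1.trans ?_
  rw [mul_comm (ENNReal.ofReal _), mul_assoc]
  refine mul_le_mul_right ?_ _
  refine (ENNReal.rpow_le_rpow (lintegral_atPoint_le φ t hζ.le hε) (by norm_num)).trans ?_
  rw [← ENNReal.rpow_natCast, ← ENNReal.rpow_mul]
  norm_num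

theorem lintegral_creation_le (hζ : 0 < ζ) {c : ℝ → Chain J × J → ℂ}
    (hc : IsVersion t (fun s => (C.creation s φ : Sect J J)) c) :
    ∫⁻ s in Ioc 0 t, eLpNorm (c s) 2 (weighted J J ξ) ^ 2 ≤
      (procNorm 2 ζ ξ t C.creation * fockNorm ζ (φ : Sect J Unit)) ^ 2 := by
  rw [mul_pow, procNorm_two_sq,
    ← lintegral_mul_const' _ _ (ENNReal.pow_lt_top (fockNorm_lt_top φ hζ.le)).ne]
  refine lintegral_mono_ae ?_
  filter_upwards [hc.eLpNorm_le (ξ := ξ) hζ] with s hs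
  rw [← mul_pow]
  exact pow_le_pow_left₀ zero_le hs 2

/-- One factor ε^(-1/2) arises here from φₛ; the other comes from summing over the points of the
chain in `eLpNorm_sum_erase_le`. -/
theorem lintegral_number_le (hζ : 0 < ζ) {ε : ℝ} (hε : 0 < ε) {d : ℝ → Chain J × J → ℂ}
    (hd : IsVersion t (fun s => (C.number s (atPoint φ s) : Sect J J)) d)
    (hfin : procNorm ∞ ζ ξ t C.number < ∞) :
    ∫⁻ s in Ioc 0 t, eLpNorm (d s) 2 (weighted J J ξ) ^ 2 ≤
      (procNorm ∞ ζ ξ t C.number *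
        (ENNReal.ofReal (1 / √ε) * fockNorm (ζ + ε) (φ : Sect J Unit))) ^ 2 := by
  have hv := isVersion_atPoint φ t
  calc ∫⁻ s in Ioc 0 t, eLpNorm (d s) 2 (weighted J J ξ) ^ 2
      ≤ ∫⁻ s in Ioc 0 t, procNorm ∞ ζ ξ t C.number ^ 2 *
          eLpNorm (pointVersion (φ : Sect J Unit) s) 2 (weighted J J ζ) ^ 2 := by
        refine lintegral_mono_ae ?_
        filter_upwards [hd.eLpNorm_le (ξ := ξ) hζ, hv.fockNorm_eq (ζ := ζ),
          opNorm_le_procNorm_top ζ ξ t C.number] with s h1 h2 h3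
        rw [← mul_pow, ← h2]
        exact pow_le_pow_left₀ zero_le (h1.trans (mul_le_mul_left h3 _)) 2
    _ = procNorm ∞ ζ ξ t C.number ^ 2 *
          ∫⁻ s in Ioc 0 t, eLpNorm (pointVersion (φ : Sect J Unit) s) 2 (weighted J J ζ) ^ 2 :=
        lintegral_const_mul' _ _ (ENNReal.pow_lt_top hfin).ne
    _ ≤ _ := by
        rw [mul_pow (procNorm ∞ ζ ξ t C.number)]
        exact mul_le_mul_right (lintegral_atPoint_le φ t hζ.le hε) _

end Bounds

/-- The section ψ is fixed before ε, so one integral satisfies all the estimates at once; they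
follow from the triangle inequality and the four separate bounds. -/
theorem exists_isQSIntegral {C : MatrixProcess J} (hC : C.Measurable) {ξ ζ t : ℝ}
    (hξ : ξ ∈ Ioo (0 : ℝ) 1) (hζ : 1 < ζ) (h : C.IntegrableOn ζ ξ t) (φ : GPlus J Unit) :
    ∃ ψ : Sect J Unit, IsQSIntegral C t φ ψ ∧ ∀ ε : ℝ, 0 < ε → ε < ξ →
      fockNorm (ξ - ε) ψ ≤ qsBound C ζ ξ t ε * fockNorm (ζ + ε) (φ : Sect J Unit) := by
  have hζ0 : 0 < ζ := one_pos.trans hζ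
  obtain ⟨a, ha⟩ := exists_isVersion_apply hC.1 hζ hξ.1 h.1.1 (isVersion_const (φ : Sect J Unit) t)
  obtain ⟨b, hb⟩ := exists_isVersion_apply hC.2.1 hζ hξ.1 h.2.1.1 (isVersion_atPoint φ t)
  obtain ⟨c, hc⟩ := exists_isVersion_apply hC.2.2.1 hζ hξ.1 h.2.2.1.1
    (isVersion_const (φ : Sect J Unit) t)
  obtain ⟨d, hd⟩ := exists_isVersion_apply hC.2.2.2 hζ hξ.1 h.2.2.2.1 (isVersion_atPoint φ t)
  have hφ := fockNorm_lt_top φ hζ0.le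
  have ha1 := lintegral_time_le (ξ := ξ) hζ0 ha
  have hb1 := fun (ε : ℝ) (hε : 0 < ε) => lintegral_annihilation_le (ξ := ξ) hζ0 hε hb
  have hai := ae_integrableOn_of_lintegral ha.1 hξ.1 t
    (ha1.trans_lt (ENNReal.mul_lt_top h.1.2 hφ))
  -- Only finiteness matters here, so ε = 1 will do.
  have hbi := ae_integrableOn_of_lintegral hb.1 hξ.1 t
    ((hb1 1 one_pos).trans_lt (ENNReal.mul_lt_top (ENNReal.mul_lt_top ENNReal.ofReal_lt_top
      h.2.1.2) (fockNorm_lt_top φ (by positivity))))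
  have hint : ∀ {a : ℝ → Chain J × Unit → ℂ}, Measurable (Function.uncurry a) →
      AEStronglyMeasurable (fun x => ∫ s in Ioc 0 t, a s x) (fockMeasure J Unit) := fun ha =>
    (ha.stronglyMeasurable.integral_prod_left (μ := volume.restrict (Ioc 0 t))).aestronglyMeasurable
  have hsum : ∀ {c : ℝ → Chain J × J → ℂ}, Measurable (Function.uncurry c) →
      AEStronglyMeasurable (fun x : Chain J × Unit =>
        ∑ p ∈ x.1.points with p.1 ≤ t, c p.1 (x.1.erase p, p.2)) (fockMeasure J Unit) := fun hc =>
    (measurable_sum_erase_le hc t).aestronglyMeasurable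
  set F : Chain J × Unit → ℂ :=
    ((fun x => ∫ s in Ioc 0 t, a s x) + fun x => ∫ s in Ioc 0 t, b s x) +
      ((fun x => ∑ p ∈ x.1.points with p.1 ≤ t, c p.1 (x.1.erase p, p.2)) +
        fun x => ∑ p ∈ x.1.points with p.1 ≤ t, d p.1 (x.1.erase p, p.2)) with hF
  have hFm : AEStronglyMeasurable F (fockMeasure J Unit) :=
    ((hint ha.1).add (hint hb.1)).add ((hsum hc.1).add (hsum hd.1))
  refine ⟨AEEqFun.mk F hFm, ⟨a, b, c, d, ha, hb, hc, hd, ?_, ?_⟩, fun ε hε hεξ => ?_⟩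
  · filter_upwards [hai, hbi] with x h1 h2 using h1.add h2
  · filter_upwards [AEEqFun.coeFn_mk F hFm, hai, hbi] with x hx h1 h2
    rw [hx, integral_add h1 h2, Finset.sum_add_distrib]
    rfl
  · rw [fockNorm_mk]
    have hη : 0 < ξ - ε := sub_pos.2 hεξ
    have hηξ : ξ - ε ≤ ξ := by linarith
    have hac := weighted_ac (J := J) (ι := Unit) (ξ - ε)
    have hmono : ∀ a : ℝ → Chain J × Unit → ℂ,
        ∫⁻ s in Ioc 0 t, eLpNorm (a s) 2 (weighted J Unit (ξ - ε)) ≤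
        ∫⁻ s in Ioc 0 t, eLpNorm (a s) 2 (weighted J Unit ξ) := fun a => lintegral_mono fun s =>
      eLpNorm_mono_measure _ (withDensity_mono (ae_of_all _ fun _ =>
        ENNReal.ofReal_le_ofReal (pow_le_pow_left₀ hη.le hηξ _)))
    have hφm : fockNorm ζ (φ : Sect J Unit) ≤ fockNorm (ζ + ε) (φ : Sect J Unit) :=
      fockNorm_mono hζ0.le (by linarith) _
    have e1 := (eLpNorm_integral_le ha.1 (ξ - ε) t).trans ((hmono a).trans
      (ha1.trans (mul_le_mul_right hφm _)))
    have e2 := (eLpNorm_integral_le hb.1 (ξ - ε) t).trans ((hmono b).trans (hb1 ε hε))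
    have e3 := (eLpNorm_sum_erase_le hc.1 hξ.2.le hε hεξ t
      (lintegral_creation_le (ξ := ξ) hζ0 hc)).trans
        (mul_le_mul_right (mul_le_mul_right hφm _) _)
    have e4 := eLpNorm_sum_erase_le hd.1 hξ.2.le hε hεξ t
      (lintegral_number_le (ξ := ξ) hζ0 hε hd h.2.2.2.2)
    have h1 : (1 : ℝ≥0∞) ≤ 2 := by norm_num
    refine (eLpNorm_add_le (((hint ha.1).add (hint hb.1)).mono_ac hac)
      (((hsum hc.1).add (hsum hd.1)).mono_ac hac) h1).trans ?_
    refine (add_le_add (eLpNorm_add_le ((hint ha.1).mono_ac hac) ((hint hb.1).mono_ac hac) h1)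
      (eLpNorm_add_le ((hsum hc.1).mono_ac hac) ((hsum hd.1).mono_ac hac) h1)).trans ?_
    refine (add_le_add (add_le_add e1 e2) (add_le_add e3 e4)).trans (le_of_eq ?_)
    rw [qsBound, ← ofReal_one_div_sqrt_sq hε]
    ring

end Integral

/-! ### Uniqueness, linearity and duality of the integral -/

section Uniqueness

variable {J : Type u} [MeasurableSpace J] [Countable J] [DiscreteMeasurableSpace J]
  {ι : Type v} {κ : Type w} [MeasurableSpace ι] [MeasurableSpace κ]
  [Countable ι] [DiscreteMeasurableSpace ι]

theorem IsVersion.ae_eq {t : ℝ} {A : ℝ → Sect J ι} {a a' : ℝ → Chain J × ι → ℂ}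
    (h : IsVersion t A a) (h' : IsVersion t A a') :
    ∀ᵐ z ∂((volume.restrict (Ioc 0 t)).prod (fockMeasure J ι)), a z.1 z.2 = a' z.1 z.2 := by
  have hS : MeasurableSet {z : ℝ × (Chain J × ι) | a z.1 z.2 = a' z.1 z.2} :=
    measurableSet_eq_fun h.1 h'.1
  refine (Measure.ae_prod_iff_ae_ae hS).2 ?_
  filter_upwards [h.2, h'.2] with s h1 h2
  exact h1.trans h2.symm

theorem IsVersion.ae_ae_eq {t : ℝ} {A : ℝ → Sect J ι} {a a' : ℝ → Chain J × ι → ℂ}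
    (h : IsVersion t A a) (h' : IsVersion t A a') :
    ∀ᵐ x ∂(fockMeasure J ι), ∀ᵐ s ∂(volume.restrict (Ioc 0 t)), a s x = a' s x := by
  have hS : MeasurableSet {z : ℝ × (Chain J × ι) | a z.1 z.2 = a' z.1 z.2} :=
    measurableSet_eq_fun h.1 h'.1
  exact (Measure.ae_ae_comm (p := fun s x => a s x = a' s x) hS).1
    (Measure.ae_ae_of_ae_prod (h.ae_eq h'))

/-- Versions agree almost everywhere in (s, τ). Fubini carries this to the time integral for almost
every τ, and `ae_forall_points` to every summand of the sum over the points. -/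
theorem IsQSIntegral.unique {C : MatrixProcess J} {t : ℝ} {φ : GPlus J Unit}
    {ψ ψ' : Sect J Unit} (h : IsQSIntegral C t φ ψ) (h' : IsQSIntegral C t φ ψ') : ψ = ψ' := by
  obtain ⟨a, b, c, d, ha, hb, hc, hd, -, hψ⟩ := h
  obtain ⟨a', b', c', d', ha', hb', hc', hd', -, hψ'⟩ := h'
  refine AEEqFun.ext ?_
  filter_upwards [hψ, hψ', ha.ae_ae_eq ha', hb.ae_ae_eq hb', ae_forall_points (hc.ae_eq hc'),
    ae_forall_points (hd.ae_eq hd')] with x h1 h2 h3 h4 h5 h6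
  rw [h1, h2]
  congr 1
  · refine integral_congr_ae ?_
    filter_upwards [h3, h4] with s h7 h8
    rw [h7, h8]
  · refine Finset.sum_congr rfl fun p hp => ?_
    rw [Finset.mem_filter] at hp
    rw [h5 p hp.1 hp.2, h6 p hp.1 hp.2]

theorem IsVersion.add {t : ℝ} {A A' B : ℝ → Sect J ι} {a a' : ℝ → Chain J × ι → ℂ}
    (h : IsVersion t A a) (h' : IsVersion t A' a')
    (hB : ∀ᵐ s ∂(volume.restrict (Ioc 0 t)), B s = A s + A' s) :
    IsVersion t B fun s x => a s x + a' s x := by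
  refine ⟨h.1.add h'.1, ?_⟩
  filter_upwards [h.2, h'.2, hB] with s h1 h2 h3
  rw [h3]
  filter_upwards [h1, h2, AEEqFun.coeFn_add (A s) (A' s)] with x h4 h5 h6
  rw [h6, Pi.add_apply, h4, h5]

theorem IsVersion.smul {t : ℝ} {A B : ℝ → Sect J ι} {a : ℝ → Chain J × ι → ℂ} (r : ℂ)
    (h : IsVersion t A a) (hB : ∀ᵐ s ∂(volume.restrict (Ioc 0 t)), B s = r • A s) :
    IsVersion t B fun s x => r * a s x := by
  refine ⟨h.1.const_mul r, ?_⟩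
  filter_upwards [h.2, hB] with s h1 h3
  rw [h3]
  filter_upwards [h1, AEEqFun.coeFn_smul r (A s)] with x h4 h6
  rw [h6, Pi.smul_apply, h4, smul_eq_mul]

theorem ae_Ioc_of_ae_Ioi {P : ℝ → Prop} {t : ℝ}
    (h : ∀ᵐ s ∂(volume.restrict (Ioi (0 : ℝ))), P s) : ∀ᵐ s ∂(volume.restrict (Ioc 0 t)), P s :=
  ae_restrict_of_ae_restrict_of_subset (fun _ hx => hx.1) h

theorem atPoint_add (φ φ' : GPlus J Unit) :
    ∀ᵐ s ∂(volume.restrict (Ioi (0 : ℝ))), atPoint (φ + φ') s = atPoint φ s + atPoint φ' s := by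
  filter_upwards [atPoint_ae_eq φ, atPoint_ae_eq φ', atPoint_ae_eq (φ + φ'),
    pointVersion_ae_eq (AEEqFun.coeFn_add (φ : Sect J Unit) (φ' : Sect J Unit))] with s h1 h2 h3 h4
  refine Subtype.ext (AEEqFun.ext ?_)
  refine h3.trans (h4.trans (EventuallyEq.trans ?_ (AEEqFun.coeFn_add (atPoint φ s : Sect J J)
    (atPoint φ' s : Sect J J)).symm))
  exact (h1.add h2).symm

theorem atPoint_smul (r : ℂ) (φ : GPlus J Unit) :
    ∀ᵐ s ∂(volume.restrict (Ioi (0 : ℝ))), atPoint (r • φ) s = r • atPoint φ s := by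
  filter_upwards [atPoint_ae_eq φ, atPoint_ae_eq (r • φ),
    pointVersion_ae_eq (AEEqFun.coeFn_smul r (φ : Sect J Unit))] with s h1 h3 h4
  refine Subtype.ext (AEEqFun.ext ?_)
  refine h3.trans (h4.trans (EventuallyEq.trans ?_
    (AEEqFun.coeFn_smul r (atPoint φ s : Sect J J)).symm))
  exact (h1.const_smul r).symm

theorem IsQSIntegral.add {C : MatrixProcess J} {t : ℝ} {φ φ' : GPlus J Unit}
    {ψ ψ' : Sect J Unit} (h : IsQSIntegral C t φ ψ) (h' : IsQSIntegral C t φ' ψ') :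
    IsQSIntegral C t (φ + φ') (ψ + ψ') := by
  obtain ⟨a, b, c, d, ha, hb, hc, hd, hi, hψ⟩ := h
  obtain ⟨a', b', c', d', ha', hb', hc', hd', hi', hψ'⟩ := h'
  have hat := ae_Ioc_of_ae_Ioi (t := t) (atPoint_add φ φ')
  refine ⟨_, _, _, _, ha.add ha' (ae_of_all _ fun s => by rw [map_add]; rfl),
    hb.add hb' (hat.mono fun s hs => by rw [hs, map_add]; rfl),
    hc.add hc' (ae_of_all _ fun s => by rw [map_add]; rfl),
    hd.add hd' (hat.mono fun s hs => by rw [hs, map_add]; rfl), ?_, ?_⟩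
  · filter_upwards [hi, hi'] with x h1 h2
    refine (h1.add h2).congr (ae_of_all _ fun s => ?_)
    simp only [Pi.add_apply]
    ring
  · filter_upwards [hi, hi', hψ, hψ', AEEqFun.coeFn_add ψ ψ'] with x h1 h2 h3 h4 h5
    rw [h5, Pi.add_apply, h3, h4, add_add_add_comm, ← integral_add h1 h2,
      ← Finset.sum_add_distrib]
    congr 1
    · exact integral_congr_ae (ae_of_all _ fun s => by ring)
    · exact Finset.sum_congr rfl fun p _ => by ring

theorem IsQSIntegral.smul {C : MatrixProcess J} {t : ℝ} (r : ℂ) {φ : GPlus J Unit}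
    {ψ : Sect J Unit} (h : IsQSIntegral C t φ ψ) : IsQSIntegral C t (r • φ) (r • ψ) := by
  obtain ⟨a, b, c, d, ha, hb, hc, hd, hi, hψ⟩ := h
  have hat := ae_Ioc_of_ae_Ioi (t := t) (atPoint_smul r φ)
  refine ⟨_, _, _, _, ha.smul r (ae_of_all _ fun s => by rw [map_smul]; rfl),
    hb.smul r (hat.mono fun s hs => by rw [hs, map_smul]; rfl),
    hc.smul r (ae_of_all _ fun s => by rw [map_smul]; rfl),
    hd.smul r (hat.mono fun s hs => by rw [hs, map_smul]; rfl), ?_, ?_⟩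
  · filter_upwards [hi] with x h1
    refine (h1.const_mul r).congr (ae_of_all _ fun s => ?_)
    ring
  · filter_upwards [hi, hψ, AEEqFun.coeFn_smul r ψ] with x h1 h3 h5
    rw [h5, Pi.smul_apply, h3, smul_eq_mul, mul_add, ← integral_const_mul, Finset.mul_sum]
    congr 1
    · exact integral_congr_ae (ae_of_all _ fun s => by ring)
    · exact Finset.sum_congr rfl fun p _ => by ring

/-- If the QS integral exists on `𝒢⁺` with values in `S`, it is a linear operator. -/
theorem exists_linearMap_isQSIntegral {C : MatrixProcess J} {t : ℝ}
    (S : Submodule ℂ (Sect J Unit))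
    (h : ∀ φ : GPlus J Unit, ∃ ψ ∈ S, IsQSIntegral C t φ ψ) :
    ∃ I : GPlus J Unit →ₗ[ℂ] S, ∀ (φ : GPlus J Unit) (ψ : Sect J Unit),
      IsQSIntegral C t φ ψ ↔ ψ = (I φ : Sect J Unit) := by
  choose I hI hI' using h
  refine ⟨{ toFun := fun φ => ⟨I φ, hI φ⟩, map_add' := ?_, map_smul' := ?_ }, fun φ ψ =>
    ⟨fun h => h.unique (hI' φ), fun h => h ▸ hI' φ⟩⟩
  · exact fun φ φ' => Subtype.ext ((hI' _).unique ((hI' φ).add (hI' φ')))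
  · exact fun r φ => Subtype.ext ((hI' _).unique ((hI' φ).smul r))

end Uniqueness

/-! ### Pairing the integral with a test vector. -/

section Duality

variable {J : Type u} [MeasurableSpace J] [Countable J] [DiscreteMeasurableSpace J]

theorem integral_conj_mul_integral (χ : GPlus J Unit) {a : ℝ → Chain J × Unit → ℂ}
    (ha : Measurable (Function.uncurry a)) {ξ t : ℝ} (hξ : 0 < ξ)
    (h : ∫⁻ s in Ioc 0 t, eLpNorm (a s) 2 (weighted J Unit ξ) < ∞) :
    Integrable (fun x => (starRingEnd ℂ) ((χ : Sect J Unit) x) * ∫ s in Ioc 0 t, a s x)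
      (fockMeasure J Unit) ∧
    ∫ x, (starRingEnd ℂ) ((χ : Sect J Unit) x) * (∫ s in Ioc 0 t, a s x) ∂(fockMeasure J Unit) =
      ∫ s in Ioc 0 t, ∫ x, (starRingEnd ℂ) ((χ : Sect J Unit) x) * a s x
        ∂(fockMeasure J Unit) := by
  have hm : Measurable (Function.uncurry fun s x =>
      (starRingEnd ℂ) ((χ : Sect J Unit) x) * a s x) :=
    (RCLike.continuous_conj.measurable.comp ((χ : Sect J Unit).measurable.comp
      measurable_snd)).mul ha
  have hi : Integrable (Function.uncurry fun s x => (starRingEnd ℂ) ((χ : Sect J Unit) x) * a s x)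
      ((volume.restrict (Ioc 0 t)).prod (fockMeasure J Unit)) := by
    refine ⟨hm.aestronglyMeasurable, ?_⟩
    rw [HasFiniteIntegral, lintegral_prod _ hm.enorm.aemeasurable]
    have hχ := fockNorm_lt_top χ (inv_pos.2 hξ).le
    refine lt_of_le_of_lt (lintegral_mono fun s => ?_)
      ((lintegral_const_mul' (fockNorm ξ⁻¹ (χ : Sect J Unit))
        (fun s => eLpNorm (a s) 2 (weighted J Unit ξ)) hχ.ne).le.trans_lt
        (ENNReal.mul_lt_top hχ h))
    refine le_trans (le_of_eq ?_) (lintegral_enorm_mul_le hξ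
      (χ : Sect J Unit).aestronglyMeasurable (ha.comp measurable_prodMk_left).aestronglyMeasurable)
    refine lintegral_congr fun x => ?_
    simp only [Function.uncurry]
    rw [enorm_mul, RCLike.enorm_conj]
  have h1 : ∀ x, ∫ s in Ioc 0 t, (starRingEnd ℂ) ((χ : Sect J Unit) x) * a s x =
      (starRingEnd ℂ) ((χ : Sect J Unit) x) * ∫ s in Ioc 0 t, a s x := fun x =>
    integral_const_mul _ _
  have h2 := hi.integral_prod_right
  have h3 := integral_integral_swap hi
  simp only [Function.uncurry, h1] at h2 h3
  exact ⟨h2, h3.symm⟩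

/-- For p ∈ τ the value χ(τ) is the value at τ \ p of χ with p inserted. The sum-integral formula
thus turns the pairing of χ with a sum over points into an integral over s of pairings with χₛ,
which is why creation is adjoint to annihilation. -/
theorem integral_conj_mul_sum (χ : GPlus J Unit) {c : ℝ → Chain J × J → ℂ}
    (hc : Measurable (Function.uncurry c)) {ξ t : ℝ} (hξ : 0 < ξ)
    (h : ∫⁻ s in Ioc 0 t, eLpNorm (c s) 2 (weighted J J ξ) ^ 2 < ∞) :
    Integrable (fun x => (starRingEnd ℂ) ((χ : Sect J Unit) x) *
      ∑ p ∈ x.1.points with p.1 ≤ t, c p.1 (x.1.erase p, p.2)) (fockMeasure J Unit) ∧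
    ∫ x, (starRingEnd ℂ) ((χ : Sect J Unit) x) *
        ∑ p ∈ x.1.points with p.1 ≤ t, c p.1 (x.1.erase p, p.2) ∂(fockMeasure J Unit) =
      ∫ s in Ioc 0 t, ∫ x, (starRingEnd ℂ) (pointVersion (χ : Sect J Unit) s x) * c s x
        ∂(fockMeasure J J) := by
  set G : ℝ × (Chain J × J) → ℂ := fun z =>
    (starRingEnd ℂ) (pointVersion (χ : Sect J Unit) z.1 z.2) * c z.1 z.2 with hG
  have hv := measurable_pointVersion (χ : Sect J Unit)
  have hm : Measurable G := (RCLike.continuous_conj.measurable.comp hv).mul hc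
  have hi : Integrable G ((volume.restrict (Ioc 0 t)).prod (fockMeasure J J)) := by
    refine ⟨hm.aestronglyMeasurable, ?_⟩
    rw [HasFiniteIntegral, lintegral_prod _ hm.enorm.aemeasurable]
    have h1 : ∀ s, ∫⁻ x, ‖G (s, x)‖ₑ ∂(fockMeasure J J) ≤
        eLpNorm (pointVersion (χ : Sect J Unit) s) 2 (weighted J J ξ⁻¹) *
          eLpNorm (c s) 2 (weighted J J ξ) := by
      intro s
      refine le_trans (le_of_eq ?_) (lintegral_enorm_mul_le hξ
        (hv.comp measurable_prodMk_left).aestronglyMeasurable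
        (hc.comp measurable_prodMk_left).aestronglyMeasurable)
      refine lintegral_congr fun x => ?_
      simp only [hG]
      rw [enorm_mul, RCLike.enorm_conj]
    refine (lintegral_mono h1).trans_lt ((ENNReal.lintegral_mul_le_Lp_mul_Lq _
      Real.HolderConjugate.two_two (measurable_eLpNorm_version hv _).aemeasurable
      (measurable_eLpNorm_version hc _).aemeasurable).trans_lt (ENNReal.mul_lt_top ?_ ?_))
    · refine ENNReal.rpow_lt_top_of_nonneg (by norm_num) ?_
      simp only [ENNReal.rpow_two]
      exact ((lintegral_atPoint_le χ t (inv_pos.2 hξ).le one_pos).trans_lt (ENNReal.pow_lt_top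
        (ENNReal.mul_lt_top ENNReal.ofReal_lt_top (fockNorm_lt_top χ (by positivity))))).ne
    · refine ENNReal.rpow_lt_top_of_nonneg (by norm_num) ?_
      simpa only [ENNReal.rpow_two] using h.ne
  have hsum : ∀ x : Chain J × Unit, ∑ p ∈ x.1.points with p.1 ≤ t, G (p.1, (x.1.erase p, p.2)) =
      (starRingEnd ℂ) ((χ : Sect J Unit) x) *
        ∑ p ∈ x.1.points with p.1 ≤ t, c p.1 (x.1.erase p, p.2) := by
    intro x
    rw [Finset.mul_sum]
    refine Finset.sum_congr rfl fun p hp => ?_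
    simp only [hG, pointVersion, Prod.mk.eta]
    rw [Chain.insert_erase (Finset.mem_filter.1 hp).1]
  have h2 := integrable_sum_erase_le hm hi
  simp only [hsum] at h2
  rw [integral_prod _ hi] at h2
  exact h2

/-- The duality of the QS integral with the elements of `𝒢⁺`. -/
theorem IsQSIntegral.pairing_eq {C : MatrixProcess J} {ξ ζ t : ℝ} (hξ : ξ ∈ Ioo (0 : ℝ) 1)
    (hζ : 1 < ζ) (h : C.IntegrableOn ζ ξ t) {φ : GPlus J Unit} {ψ : Sect J Unit}
    (hψ : IsQSIntegral C t φ ψ) (χ : GPlus J Unit) :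
    pairing (χ : Sect J Unit) ψ =
      ((∫ s in Ioc 0 t, pairing (χ : Sect J Unit) (C.time s φ : Sect J Unit)) +
        ∫ s in Ioc 0 t, pairing (χ : Sect J Unit) (C.annihilation s (atPoint φ s) : Sect J Unit)) +
      ((∫ s in Ioc 0 t, pairing (atPoint χ s : Sect J J) (C.creation s φ : Sect J J)) +
        ∫ s in Ioc 0 t, pairing (atPoint χ s : Sect J J)
          (C.number s (atPoint φ s) : Sect J J)) := by
  have hζ0 : 0 < ζ := one_pos.trans hζ
  obtain ⟨a, b, c, d, ha, hb, hc, hd, -, hψ⟩ := hψ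
  have hφ := fockNorm_lt_top φ hζ0.le
  have hφ1 := fockNorm_lt_top φ (add_pos hζ0 one_pos).le
  have ha1 := (lintegral_time_le (ξ := ξ) hζ0 ha).trans_lt (ENNReal.mul_lt_top h.1.2 hφ)
  have hb1 := (lintegral_annihilation_le (ξ := ξ) hζ0 one_pos hb).trans_lt
    (ENNReal.mul_lt_top (ENNReal.mul_lt_top ENNReal.ofReal_lt_top h.2.1.2) hφ1)
  have hc1 := (lintegral_creation_le (ξ := ξ) hζ0 hc).trans_lt
    (ENNReal.pow_lt_top (ENNReal.mul_lt_top h.2.2.1.2 hφ))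
  have hd1 := (lintegral_number_le (ξ := ξ) hζ0 one_pos hd h.2.2.2.2).trans_lt
    (ENNReal.pow_lt_top (ENNReal.mul_lt_top h.2.2.2.2
      (ENNReal.mul_lt_top ENNReal.ofReal_lt_top hφ1)))
  obtain ⟨ia, ea⟩ := integral_conj_mul_integral χ ha.1 hξ.1 ha1
  obtain ⟨ib, eb⟩ := integral_conj_mul_integral χ hb.1 hξ.1 hb1
  obtain ⟨ic, ec⟩ := integral_conj_mul_sum χ hc.1 hξ.1 hc1
  obtain ⟨id, ed⟩ := integral_conj_mul_sum χ hd.1 hξ.1 hd1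
  have hv := isVersion_atPoint χ t
  have ra : ∫ s in Ioc 0 t, pairing (χ : Sect J Unit) (C.time s φ : Sect J Unit) =
      ∫ s in Ioc 0 t, ∫ x, (starRingEnd ℂ) ((χ : Sect J Unit) x) * a s x
        ∂(fockMeasure J Unit) := by
    refine integral_congr_ae ?_
    filter_upwards [ha.2] with s hs using pairing_congr EventuallyEq.rfl hs.symm
  have rb : ∫ s in Ioc 0 t, pairing (χ : Sect J Unit)
      (C.annihilation s (atPoint φ s) : Sect J Unit) =
      ∫ s in Ioc 0 t, ∫ x, (starRingEnd ℂ) ((χ : Sect J Unit) x) * b s x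
        ∂(fockMeasure J Unit) := by
    refine integral_congr_ae ?_
    filter_upwards [hb.2] with s hs using pairing_congr EventuallyEq.rfl hs.symm
  have rc : ∫ s in Ioc 0 t, pairing (atPoint χ s : Sect J J) (C.creation s φ : Sect J J) =
      ∫ s in Ioc 0 t, ∫ x, (starRingEnd ℂ) (pointVersion (χ : Sect J Unit) s x) * c s x
        ∂(fockMeasure J J) := by
    refine integral_congr_ae ?_
    filter_upwards [hc.2, hv.2] with s hs hs' using pairing_congr hs'.symm hs.symm
  have rd : ∫ s in Ioc 0 t, pairing (atPoint χ s : Sect J J)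
      (C.number s (atPoint φ s) : Sect J J) =
      ∫ s in Ioc 0 t, ∫ x, (starRingEnd ℂ) (pointVersion (χ : Sect J Unit) s x) * d s x
        ∂(fockMeasure J J) := by
    refine integral_congr_ae ?_
    filter_upwards [hd.2, hv.2] with s hs hs' using pairing_congr hs'.symm hs.symm
  rw [ra, rb, rc, rd, ← ea, ← eb, ← ec, ← ed, ← integral_add ia ib, ← integral_add ic id,
    pairing_congr EventuallyEq.rfl hψ]
  refine Eq.trans ?_ (integral_add (ia.add ib) (ic.add id))
  refine integral_congr_ae ?_
  filter_upwards [ae_integrableOn_of_lintegral ha.1 hξ.1 t ha1,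
    ae_integrableOn_of_lintegral hb.1 hξ.1 t hb1] with x h1 h2
  rw [integral_add h1 h2, Finset.sum_add_distrib]
  ring

end Duality

/-! ### The adjoint process and its integral. -/

section Star

variable {J : Type u} [MeasurableSpace J] [Countable J] [DiscreteMeasurableSpace J]
  {ι : Type v} {κ : Type w} [MeasurableSpace ι] [MeasurableSpace κ]

theorem WeaklyMeasurable.adj {A : ℝ → (GPlus J ι →ₗ[ℂ] GDual J κ)} (hA : WeaklyMeasurable A)
    (h : ∀ᵐ s ∂(volume.restrict (Ioi (0 : ℝ))), IsAdjoint (A s) (adj (A s))) :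
    WeaklyMeasurable fun s => QSC.adj (A s) := by
  intro φ χ
  refine (RCLike.continuous_conj.measurable.comp_aemeasurable (hA χ φ)).congr ?_
  filter_upwards [h] with s hs
  simp only [Function.comp]
  rw [← hs φ χ, pairing_conj]

theorem LpBounded.adj {A : ℝ → (GPlus J ι →ₗ[ℂ] GDual J κ)} {p : ℝ≥0∞} {ζ ξ t : ℝ}
    (hA : LpBounded p ζ ξ t A) (hζ : 0 < ζ) (hξ : 0 < ξ)
    (h : ∀ᵐ s ∂(volume.restrict (Ioi (0 : ℝ))), IsAdjoint (A s) (adj (A s))) :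
    LpBounded p ξ⁻¹ ζ⁻¹ t fun s => QSC.adj (A s) := by
  have h' := ae_Ioc_of_ae_Ioi (t := t) h
  refine ⟨?_, ?_⟩
  · filter_upwards [hA.1, h'] with s h1 h2
    rwa [h2.opNorm_eq hζ hξ]
  · have : procNorm p ξ⁻¹ ζ⁻¹ t (fun s => QSC.adj (A s)) = procNorm p ζ ξ t A := by
      refine eLpNorm_congr_ae ?_
      filter_upwards [h'] with s h2 using h2.opNorm_eq hζ hξ
    rw [this]
    exact hA.2

theorem ae_Ioi_of_forall_nat {P : ℝ → Prop}
    (h : ∀ n : ℕ, ∀ᵐ s ∂(volume.restrict (Ioc (0 : ℝ) (n + 1))), P s) :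
    ∀ᵐ s ∂(volume.restrict (Ioi (0 : ℝ))), P s := by
  have hU : Ioi (0 : ℝ) = ⋃ n : ℕ, Ioc (0 : ℝ) (n + 1) := by
    ext s
    simp only [mem_Ioi, mem_iUnion, mem_Ioc]
    constructor
    · intro hs
      obtain ⟨n, hn⟩ := exists_nat_ge s
      exact ⟨n, hs, by linarith⟩
    · rintro ⟨n, hs, -⟩
      exact hs
  rw [hU, ae_restrict_iUnion_iff]
  exact h

/-- Boundedness for a single pair of exponents already yields an adjoint, so ξ = 1/2 is as good as
any; the intervals ]0, n + 1] exhaust the half-line. -/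
theorem MatrixProcess.LocallyIntegrable.ae_isAdjoint {C : MatrixProcess J}
    (hC : C.LocallyIntegrable) :
    (∀ᵐ s ∂(volume.restrict (Ioi (0 : ℝ))), IsAdjoint (C.time s) (adj (C.time s))) ∧
    (∀ᵐ s ∂(volume.restrict (Ioi (0 : ℝ))),
      IsAdjoint (C.annihilation s) (adj (C.annihilation s))) ∧
    (∀ᵐ s ∂(volume.restrict (Ioi (0 : ℝ))), IsAdjoint (C.creation s) (adj (C.creation s))) ∧
    (∀ᵐ s ∂(volume.restrict (Ioi (0 : ℝ))), IsAdjoint (C.number s) (adj (C.number s))) := by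
  have h : ∀ n : ℕ, ∃ ζ > 1, C.IntegrableOn ζ (1 / 2) (n + 1) := fun n =>
    hC.2 (1 / 2) (by norm_num) (n + 1) (by positivity)
  choose ζ hζ h using h
  have h2 : (0 : ℝ) < 1 / 2 := by norm_num
  exact ⟨ae_Ioi_of_forall_nat fun n => (h n).1.1.mono fun s hs => isAdjoint_adj (hζ n) h2 hs,
    ae_Ioi_of_forall_nat fun n => (h n).2.1.1.mono fun s hs => isAdjoint_adj (hζ n) h2 hs,
    ae_Ioi_of_forall_nat fun n => (h n).2.2.1.1.mono fun s hs => isAdjoint_adj (hζ n) h2 hs,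
    ae_Ioi_of_forall_nat fun n => (h n).2.2.2.1.mono fun s hs => isAdjoint_adj (hζ n) h2 hs⟩

theorem MatrixProcess.LocallyIntegrable.star_measurable {C : MatrixProcess J}
    (hC : C.LocallyIntegrable) : C.star.Measurable := by
  obtain ⟨h1, h2, h3, h4⟩ := hC.ae_isAdjoint
  exact ⟨hC.1.1.adj h1, hC.1.2.2.1.adj h3, hC.1.2.1.adj h2, hC.1.2.2.2.adj h4⟩

theorem MatrixProcess.LocallyIntegrable.star_integrableOn {C : MatrixProcess J}
    (hC : C.LocallyIntegrable) {ζ ξ t : ℝ} (hζ : 0 < ζ) (hξ : 0 < ξ)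
    (h : C.IntegrableOn ζ ξ t) : C.star.IntegrableOn ξ⁻¹ ζ⁻¹ t := by
  obtain ⟨h1, h2, h3, h4⟩ := hC.ae_isAdjoint
  exact ⟨h.1.adj hζ hξ h1, h.2.2.1.adj hζ hξ h3, h.2.1.adj hζ hξ h2, h.2.2.2.adj hζ hξ h4⟩

theorem conj_integral_pairing_adj {A : ℝ → (GPlus J ι →ₗ[ℂ] GDual J κ)} {t : ℝ}
    (f : ℝ → GPlus J ι) (g : ℝ → GPlus J κ)
    (hA : ∀ᵐ s ∂(volume.restrict (Ioi (0 : ℝ))), IsAdjoint (A s) (adj (A s))) :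
    (starRingEnd ℂ) (∫ s in Ioc 0 t, pairing (f s : Sect J ι) (adj (A s) (g s) : Sect J ι)) =
      ∫ s in Ioc 0 t, pairing (g s : Sect J κ) (A s (f s) : Sect J κ) := by
  rw [← integral_conj]
  refine integral_congr_ae ?_
  filter_upwards [ae_Ioc_of_ae_Ioi (t := t) hA] with s hs
  rw [pairing_conj, hs]

/-- Both sides expand by `IsQSIntegral.pairing_eq` into four integrals. Conjugation matches time
with time and number with number, and exchanges the creation and annihilation terms. -/
theorem pairing_qsIntegral_star {C : MatrixProcess J} (hC : C.LocallyIntegrable) {ξ ζ t : ℝ}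
    (hξ : ξ ∈ Ioo (0 : ℝ) 1) (hζ : 1 < ζ) (h : C.IntegrableOn ζ ξ t) {φ χ : GPlus J Unit}
    {ψ ψ' : Sect J Unit} (hψ : IsQSIntegral C t χ ψ) (hψ' : IsQSIntegral C.star t φ ψ') :
    pairing ψ' (χ : Sect J Unit) = pairing (φ : Sect J Unit) ψ := by
  obtain ⟨h1, h2, h3, h4⟩ := hC.ae_isAdjoint
  have hζ0 : 0 < ζ := one_pos.trans hζ
  rw [← pairing_conj, hψ'.pairing_eq ⟨inv_pos.2 hζ0, inv_lt_one_of_one_lt₀ hζ⟩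
    (one_lt_inv₀ hξ.1 |>.2 hξ.2) (hC.star_integrableOn hζ0 hξ.1 h) χ, hψ.pairing_eq hξ hζ h φ,
    map_add, map_add, map_add]
  simp only [MatrixProcess.star]
  rw [conj_integral_pairing_adj (fun _ => χ) (fun _ => φ) h1, conj_integral_pairing_adj (fun _ => χ) (fun s => atPoint φ s) h3,
    conj_integral_pairing_adj (fun s => atPoint χ s) (fun _ => φ) h2,
    conj_integral_pairing_adj (fun s => atPoint χ s) (fun s => atPoint φ s) h4]
  ring

end Star

/-! ### The inclusion of the test space -/

section Gram

theorem summable_mul_of_tsum_sq {I : Type*} {f g : I → ℂ} (hf : ∑' i, ‖f i‖ₑ ^ 2 < ∞)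
    (hg : ∑' i, ‖g i‖ₑ ^ 2 < ∞) : Summable fun i => f i * g i := by
  rw [← summable_norm_iff]
  have key : ∀ h : I → ℂ, ∑' i, ‖h i‖ₑ ^ 2 < ∞ → Summable fun i => ‖h i‖ ^ 2 := by
    intro h hh
    have := ENNReal.summable_toReal hh.ne
    simpa using this
  refine Summable.of_nonneg_of_le (fun _ => norm_nonneg _) (fun i => ?_) ((key f hf).add (key g hg))
  rw [norm_mul]
  nlinarith [sq_nonneg (‖f i‖ - ‖g i‖), sq_nonneg ‖f i‖, sq_nonneg ‖g i‖]

/-- The matrices of injective selfadjoint contractions of `ℓ²(I)`. -/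
structure IsGram {I : Type*} (T : I → I → ℂ) : Prop where
  tsum_sq_le : ∀ u : I → ℂ, ∑' i, ‖∑' k, T i k * u k‖ₑ ^ 2 ≤ ∑' k, ‖u k‖ₑ ^ 2
  eq_zero : ∀ u : I → ℂ, ∑' k, ‖u k‖ₑ ^ 2 < ∞ → (∀ i, ∑' k, T i k * u k = 0) → ∀ k, u k = 0
  conj_apply : ∀ i k, (starRingEnd ℂ) (T i k) = T k i

namespace IsGram

variable {I I' : Type*} {T : I → I → ℂ} {T' : I' → I' → ℂ}

/-- The image of a unit vector is a column of norm at most one, and by Hermitian symmetry rows and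
columns have equal norms. -/
theorem row_lt_top (hT : IsGram T) (i : I) : ∑' k, ‖T i k‖ₑ ^ 2 < ∞ := by
  classical
  have h := hT.tsum_sq_le (Pi.single i 1)
  have h1 : ∀ k, ∑' l, T k l * (Pi.single i 1 : I → ℂ) l = T k i := by
    intro k
    rw [tsum_eq_single i fun l hl => by simp [hl]]
    simp
  have h2 : ∑' k, ‖(Pi.single i 1 : I → ℂ) k‖ₑ ^ 2 = 1 := by
    rw [tsum_eq_single i fun l hl => by simp [hl]]
    simp
  rw [h2] at h
  refine lt_of_le_of_lt (le_trans (le_of_eq (tsum_congr fun k => ?_)) h) ENNReal.one_lt_top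
  rw [h1, ← hT.conj_apply i k, RCLike.enorm_conj]

theorem summable (hT : IsGram T) (i : I) {u : I → ℂ} (hu : ∑' k, ‖u k‖ₑ ^ 2 < ∞) :
    Summable fun k => T i k * u k :=
  summable_mul_of_tsum_sq (hT.row_lt_top i) hu

theorem of_unique [Unique I] (h : T default default = 1) : IsGram T where
  tsum_sq_le u := by simp [tsum_fintype, h]
  eq_zero u _ hu k := by
    have := hu default
    rw [Subsingleton.elim k default]
    simpa [tsum_fintype, h] using this
  conj_apply i k := by
    rw [Subsingleton.elim i default, Subsingleton.elim k default, h, map_one]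

theorem of_equiv (e : I' ≃ I) (h : IsGram fun i k => T (e i) (e k)) : IsGram T where
  tsum_sq_le u := by
    have := h.tsum_sq_le (u ∘ e)
    rw [← e.tsum_eq, ← e.tsum_eq (fun k => ‖u k‖ₑ ^ 2)]
    refine le_trans (le_of_eq (tsum_congr fun i => ?_)) this
    rw [← e.tsum_eq]
    rfl
  eq_zero u hu h0 k := by
    have := h.eq_zero (u ∘ e) (by rw [← e.tsum_eq] at hu; exact hu) (fun i => by
      rw [← h0 (e i), ← e.tsum_eq]
      rfl) (e.symm k)
    simpa using this
  conj_apply i k := by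
    have := h.conj_apply (e.symm i) (e.symm k)
    simpa using this

theorem tsum_prod_apply (hT : IsGram T) (hT' : IsGram T') {u : I × I' → ℂ}
    (hu : ∑' k, ‖u k‖ₑ ^ 2 < ∞) (i : I) (i' : I') :
    ∑' k : I × I', T i k.1 * T' i' k.2 * u k =
      ∑' k', T' i' k' * ∑' k, T i k * u (k, k') := by
  have hs : Summable fun k : I × I' => T i k.1 * T' i' k.2 * u k := by
    refine summable_mul_of_tsum_sq ?_ hu
    rw [ENNReal.tsum_prod']
    simp only [enorm_mul, mul_pow, ENNReal.tsum_mul_left, ENNReal.tsum_mul_right]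
    exact ENNReal.mul_lt_top (hT.row_lt_top i) (hT'.row_lt_top i')
  rw [← (Equiv.prodComm I' I).tsum_eq]
  refine ((Equiv.prodComm I' I).summable_iff.2 hs).tsum_prod.trans ?_
  refine tsum_congr fun k' => ?_
  rw [← tsum_mul_left]
  refine tsum_congr fun k => ?_
  simp only [Function.comp_apply, Equiv.prodComm_apply, Prod.swap_prod_mk]
  ring

/-- The tensor product factors as (1 ⊗ T')(T ⊗ 1) by `tsum_prod_apply`, and each factor acts slice
by slice as a contraction with trivial kernel. For families that are not square summable the
contraction bound is trivial. -/
theorem prod (hT : IsGram T) (hT' : IsGram T') :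
    IsGram fun (i k : I × I') => T i.1 k.1 * T' i.2 k.2 := by
  have hv : ∀ u : I × I' → ℂ, ∑' k', ∑' i, ‖∑' k, T i k * u (k, k')‖ₑ ^ 2 ≤ ∑' k, ‖u k‖ₑ ^ 2 := by
    intro u
    rw [ENNReal.tsum_prod', ENNReal.tsum_comm (f := fun a b => ‖u (a, b)‖ₑ ^ 2)]
    exact ENNReal.tsum_le_tsum fun k' => hT.tsum_sq_le fun k => u (k, k')
  refine ⟨fun u => ?_, fun u hu h0 => ?_, fun i k => ?_⟩
  · by_cases hu : ∑' k, ‖u k‖ₑ ^ 2 < ∞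
    · refine le_trans ?_ (hv u)
      rw [ENNReal.tsum_prod', ENNReal.tsum_comm (f := fun k' i => ‖∑' k, T i k * u (k, k')‖ₑ ^ 2)]
      refine ENNReal.tsum_le_tsum fun i => ?_
      refine le_trans (le_of_eq (tsum_congr fun i' => ?_))
        (hT'.tsum_sq_le fun k' => ∑' k, T i k * u (k, k'))
      rw [hT.tsum_prod_apply hT' hu]
    · rw [not_lt_top_iff.1 hu]
      exact le_top
  · have h1 : ∀ i k', ∑' k, T i k * u (k, k') = 0 := by
      intro i
      refine hT'.eq_zero _ ?_ fun i' => ?_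
      · refine lt_of_le_of_lt ?_ hu
        refine le_trans ?_ (hv u)
        exact ENNReal.tsum_le_tsum fun k' =>
          ENNReal.le_tsum (f := fun i => ‖∑' k, T i k * u (k, k')‖ₑ ^ 2) i
      · rw [← hT.tsum_prod_apply hT' hu]
        exact h0 (i, i')
    rintro ⟨k, k'⟩
    refine hT.eq_zero (fun k => u (k, k')) ?_ (fun i => h1 i k') k
    refine lt_of_le_of_lt ?_ hu
    rw [ENNReal.tsum_prod']
    exact ENNReal.tsum_le_tsum fun k => ENNReal.le_tsum (f := fun k' => ‖u (k, k')‖ₑ ^ 2) k'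
  · rw [map_mul, hT.conj_apply, hT'.conj_apply]

theorem pi {n : ℕ} {T : Fin n → I → I → ℂ} (hT : ∀ p, IsGram (T p)) :
    IsGram fun (i k : Fin n → I) => ∏ p, T p (i p) (k p) := by
  induction n with
  | zero => exact of_unique (by simp)
  | succ n ih =>
    refine of_equiv (Fin.consEquiv fun _ => I) ?_
    have := (hT 0).prod (ih (T := fun p => T p.succ) fun p => hT p.succ)
    simpa [Fin.consEquiv, Fin.prod_univ_succ] using this

end IsGram

variable {J : Type u} {K : Type v} [NormedAddCommGroup K] [InnerProductSpace ℂ K]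

theorem lp_enorm_sq (f : lp (fun _ : J => ℂ) 2) : ‖f‖ₑ ^ 2 = ∑' i, ‖f i‖ₑ ^ 2 := by
  have h := lp.norm_rpow_eq_tsum (p := 2) (by norm_num) f
  have hs : Summable fun i => ‖f i‖ ^ 2 := by
    have := (memℓp_gen_iff (p := 2) (by norm_num)).1 (lp.memℓp f)
    simpa using this
  simp only [ENNReal.toReal_ofNat, Real.rpow_ofNat] at h
  rw [← ofReal_norm, ← ENNReal.ofReal_pow (norm_nonneg _), h,
    ENNReal.ofReal_tsum_of_nonneg (fun _ => by positivity) hs]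
  refine tsum_congr fun i => ?_
  rw [ENNReal.ofReal_pow (norm_nonneg _), ofReal_norm]

variable [CompleteSpace K] (E : GelfandField J K) (t : ℝ)

/-- The Gram matrix is the matrix of the adjoint of `E.emb t` composed with `E.emb t`. Contractivity
and injectivity in `GelfandField.isGram` follow from those of `E.emb t`. -/
theorem GelfandField.tsum_gram (i : J) (f : lp (fun _ : J => ℂ) 2) :
    ∑' k, E.gram t i k * f k = ((E.emb t).adjoint (E.emb t f) : lp (fun _ : J => ℂ) 2) i := by
  classical
  have h1 := lp.hasSum_single (p := 2) (by norm_num) f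
  have h2 := ((innerSL ℂ (E.emb t (lp.single 2 i (1 : ℂ)))).comp (E.emb t)).hasSum h1
  have h3 : ((E.emb t).adjoint (E.emb t f) : lp (fun _ : J => ℂ) 2) i =
      inner ℂ (E.emb t (lp.single 2 i (1 : ℂ))) (E.emb t f) := by
    rw [← ContinuousLinearMap.adjoint_inner_right, lp.inner_single_left]
    simp
  rw [h3]
  refine HasSum.tsum_eq ?_
  convert! h2 using 2 with k
  simp only [ContinuousLinearMap.comp_apply, innerSL_apply_apply]
  have : (lp.single 2 k (f k) : lp (fun _ : J => ℂ) 2) = f k • lp.single 2 k (1 : ℂ) := by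
    rw [← lp.single_smul, smul_eq_mul, mul_one]
  rw [this, map_smul, inner_smul_right, GelfandField.gram, mul_comm]

theorem GelfandField.isGram : IsGram (E.gram t) := by
  have hn : ‖E.emb t‖ ≤ 1 := (E.emb t).opNorm_le_bound zero_le_one fun x => by
    simpa using E.norm_le t x
  have hlp : ∀ u : J → ℂ, ∑' k, ‖u k‖ₑ ^ 2 < ∞ → ∃ f : lp (fun _ : J => ℂ) 2, ∀ k, f k = u k := by
    intro u hu
    refine ⟨⟨u, memℓp_gen ?_⟩, fun k => rfl⟩
    have := ENNReal.summable_toReal hu.ne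
    simpa using this
  refine ⟨fun u => ?_, fun u hu h0 => ?_, fun i k => ?_⟩
  · by_cases hu : ∑' k, ‖u k‖ₑ ^ 2 < ∞
    · obtain ⟨f, hf⟩ := hlp u hu
      simp only [← hf, E.tsum_gram t, ← lp_enorm_sq]
      gcongr
      rw [← ofReal_norm, ← ofReal_norm]
      refine ENNReal.ofReal_le_ofReal ?_
      refine ((E.emb t).adjoint.le_of_opNorm_le (c := 1) ?_ _).trans ?_
      · rwa [LinearIsometryEquiv.norm_map]
      · rw [one_mul]
        exact E.norm_le t f
    · rw [not_lt_top_iff.1 hu]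
      exact le_top
  · obtain ⟨f, hf⟩ := hlp u hu
    simp only [← hf, E.tsum_gram t] at h0 ⊢
    have h1 : (E.emb t).adjoint (E.emb t f) = 0 := lp.ext (funext h0)
    have h2 : inner ℂ (E.emb t f) (E.emb t f) = 0 := by
      rw [← ContinuousLinearMap.adjoint_inner_right, h1, inner_zero_right]
    have h3 : f = 0 := E.injective t (by rw [inner_self_eq_zero.1 h2, map_zero])
    simp [h3]
  · rw [GelfandField.gram, GelfandField.gram, inner_conj_symm]

/-- Both vectors in the scalar product move with t, while measurability is assumed against fixed
vectors only. Parseval's identity in a countable orthonormal basis of K reduces to that case. -/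
theorem GelfandField.measurable_gram [Countable J] (i k : J) :
    Measurable fun t => E.gram t i k := by
  classical
  obtain ⟨w, b, hb⟩ := exists_hilbertBasis ℂ K
  -- Each of the countably many vectors `E.emb 0 eᵢ` has only countably many nonzero coefficients,
  -- and a basis vector orthogonal to all of them is orthogonal to a dense subspace, which is
  -- impossible for a unit vector.
  have hw : Countable w := by
    have hc : ∀ v : K, {j : w | inner ℂ (b j) v ≠ 0}.Countable := by
      intro v
      refine (b.summable_inner_mul_inner v v).countable_support.mono fun j hj => ?_
      simp only [mem_ofPred_eq, Function.mem_support, ne_eq, mul_eq_zero] at hj ⊢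
      rw [← inner_conj_symm, map_eq_zero]
      tauto
    have hU : (⋃ i : J, {j : w | inner ℂ (b j) (E.emb 0 (lp.single 2 i (1 : ℂ))) ≠ 0}) =
        Set.univ := by
      refine eq_univ_of_forall fun j => ?_
      by_contra hj
      simp only [mem_iUnion, mem_ofPred_eq, not_exists, not_not] at hj
      have h0 : ∀ x, inner ℂ (b j) (E.emb 0 x) = 0 := by
        intro x
        have h1 := lp.hasSum_single (p := 2) (by norm_num) x
        have h2 := ((innerSL ℂ (b j)).comp (E.emb 0)).hasSum h1
        refine h2.unique ?_
        convert! hasSum_zero using 2 with k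
        simp only [ContinuousLinearMap.comp_apply, innerSL_apply_apply]
        have : (lp.single 2 k (x k) : lp (fun _ : J => ℂ) 2) = x k • lp.single 2 k (1 : ℂ) := by
          rw [← lp.single_smul, smul_eq_mul, mul_one]
        rw [this, map_smul, inner_smul_right, hj, mul_zero]
      have h1 : (fun y : K => (inner ℂ (b j) y : ℂ)) = fun _ => 0 :=
        (E.dense 0).equalizer (by fun_prop) continuous_const (funext h0)
      have h2 := congrFun h1 (b j)
      simp only [inner_self_eq_zero] at h2
      have := b.orthonormal.1 j
      rw [h2, norm_zero] at this
      exact zero_ne_one this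
    have := countable_iUnion fun i => hc (E.emb 0 (lp.single 2 i (1 : ℂ)))
    rw [hU] at this
    exact countable_univ_iff.1 this
  have : (fun t => E.gram t i k) = fun t => ∑' j : w,
      inner ℂ (E.emb t (lp.single 2 i (1 : ℂ))) (b j) *
        inner ℂ (b j) (E.emb t (lp.single 2 k (1 : ℂ))) := by
    funext t
    rw [b.tsum_inner_mul_inner, GelfandField.gram]
  rw [this]
  refine Measurable.tsum fun j => Measurable.mul ?_ (E.measurable _ _)
  have h := Complex.continuous_conj.measurable.comp (E.measurable (lp.single 2 i (1 : ℂ)) (b j))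
  simpa [Function.comp_def] using h

end Gram

/-! ### Separating the times of a chain from its marks. -/

section Slices

variable {J : Type u} [Countable J] [MeasurableSpace J] [DiscreteMeasurableSpace J]

/-- The Lebesgue measure on `0 < t₁ < … < tₙ`. -/
def simplexMeasure (n : ℕ) : Measure (Fin n → ℝ) :=
  (Measure.pi fun _ => volume.restrict (Ioi (0 : ℝ))).restrict {t | StrictMono t}

instance (n : ℕ) : SFinite (simplexMeasure n) := by
  unfold simplexMeasure
  infer_instance

theorem measurableSet_strictMono (n : ℕ) : MeasurableSet {t : Fin n → ℝ | StrictMono t} := by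
  have : {t : Fin n → ℝ | StrictMono t} = {t | ∀ i j, i < j → t i < t j} := rfl
  rw [this]
  simp only [ofPred_forall]
  exact MeasurableSet.iInter fun i => MeasurableSet.iInter fun j => MeasurableSet.iInter fun _ =>
      measurableSet_lt (measurable_pi_apply _) (measurable_pi_apply _)

theorem ae_strictMono (n : ℕ) : ∀ᵐ t ∂(simplexMeasure n), StrictMono t :=
  ae_restrict_mem (measurableSet_strictMono n)

/-- The chain with times `t` and marks `k`. -/
def markedChain {n : ℕ} (t : Fin n → ℝ) (k : Fin n → J) : Chain J × Unit :=
  (chainOfTuple J n fun i => (t i, k i), ())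

theorem measurable_markedChain (n : ℕ) :
    Measurable fun q : (Fin n → ℝ) × (Fin n → J) => markedChain q.1 q.2 := by
  refine Measurable.prodMk ((measurable_chainOfTuple n).comp ?_) measurable_const
  exact measurable_pi_lambda _ fun i =>
    ((measurable_pi_apply i).comp measurable_fst).prodMk
      ((measurable_pi_apply i).comp measurable_snd)

theorem length_markedChain {n : ℕ} {t : Fin n → ℝ} (ht : StrictMono t) (k : Fin n → J) :
    (markedChain t k).1.length = n :=
  length_chainOfTuple fun _ _ h => ht.injective (congrArg Prod.fst h)

theorem pi_count (n : ℕ) :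
    (Measure.pi fun _ : Fin n => (Measure.count : Measure J)) = Measure.count := by
  refine Measure.ext_of_singleton fun k => ?_
  rw [Measure.pi_singleton]
  simp

theorem fockMeasure_unit_eq_map :
    fockMeasure J Unit = (chainMeasure J).map fun ω => (ω, ()) := by
  refine Measure.ext fun s hs => ?_
  rw [← lintegral_indicator_one hs, lintegral_fockMeasure_unit (measurable_one.indicator hs),
    Measure.map_apply (by fun_prop) hs, ← lintegral_indicator_one (hs.preimage (by fun_prop))]
  rfl

/-- The inclusion leaves the times alone and mixes the marks. Over fixed increasing times a section
is a family indexed by tuples of marks, on which the inclusion is a matrix. -/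
theorem fockMeasure_unit_eq_sum :
    fockMeasure J Unit = Measure.sum fun n =>
      ((simplexMeasure n).prod (Measure.count : Measure (Fin n → J))).map
        fun q => markedChain q.1 q.2 := by
  rw [fockMeasure_unit_eq_map, chainMeasure, Measure.map_sum (by fun_prop)]
  congr 1
  funext n
  rw [Measure.map_map (by fun_prop) (measurable_chainOfTuple n)]
  have h1 := measurePreserving_arrowProdEquivProdArrow ℝ J (Fin n)
    (fun _ => volume.restrict (Ioi (0 : ℝ))) (fun _ => Measure.count)
  rw [pi_count] at h1
  have h2 := h1.restrict_preimage (s := {t : Fin n → ℝ | StrictMono t} ×ˢ Set.univ)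
    ((measurableSet_strictMono n).prod MeasurableSet.univ)
  rw [← Measure.prod_restrict, Measure.restrict_univ] at h2
  rw [simplexMeasure, ← h2.map_eq, Measure.map_map (measurable_markedChain n) h2.measurable]
  congr 1
  refine congrArg _ (Set.ext fun x => ?_)
  simp [MeasurableEquiv.arrowProdEquivProdArrow]

theorem lintegral_fockMeasure_slices {F : Chain J × Unit → ℝ≥0∞} (hF : Measurable F) :
    ∫⁻ x, F x ∂(fockMeasure J Unit) =
      ∑' n, ∫⁻ t, ∑' k : Fin n → J, F (markedChain t k) ∂(simplexMeasure n) := by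
  rw [fockMeasure_unit_eq_sum, lintegral_sum_measure]
  refine tsum_congr fun n => ?_
  rw [lintegral_map hF (measurable_markedChain n),
    lintegral_prod (fun q : (Fin n → ℝ) × (Fin n → J) => F (markedChain q.1 q.2))
      (hF.comp (measurable_markedChain n)).aemeasurable]
  simp only [lintegral_count]

theorem ae_slices {p : Chain J × Unit → Prop} (h : ∀ᵐ x ∂(fockMeasure J Unit), p x) (n : ℕ) :
    ∀ᵐ t ∂(simplexMeasure n), ∀ k : Fin n → J, p (markedChain t k) := by
  rw [fockMeasure_unit_eq_sum, Measure.ae_sum_iff] at h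
  have h2 := Measure.ae_ae_of_ae_prod
    (ae_of_ae_map (measurable_markedChain n).aemeasurable (h n))
  filter_upwards [h2] with t ht
  exact Measure.ae_count_iff.1 ht

theorem ae_of_ae_slices {p : Chain J × Unit → Prop} (hp : MeasurableSet {x | p x})
    (h : ∀ n, ∀ᵐ t ∂(simplexMeasure n), ∀ k : Fin n → J, p (markedChain t k)) :
    ∀ᵐ x ∂(fockMeasure J Unit), p x := by
  rw [ae_iff]
  change fockMeasure J Unit {x | p x}ᶜ = 0
  rw [← lintegral_indicator_one hp.compl,
    lintegral_fockMeasure_slices (measurable_one.indicator hp.compl), ENNReal.tsum_eq_zero]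
  intro n
  rw [lintegral_eq_zero_iff' ]
  · filter_upwards [h n] with t ht
    simp [ht]
  · have : Measurable fun t : Fin n → ℝ =>
        ∑' k : Fin n → J, {x | p x}ᶜ.indicator (1 : Chain J × Unit → ℝ≥0∞) (markedChain t k) :=
      Measurable.tsum fun k => (measurable_one.indicator hp.compl).comp
        ((measurable_markedChain n).comp (measurable_id.prodMk measurable_const))
    exact this.aemeasurable

theorem integral_congr_slices {F G : Chain J × Unit → ℂ}
    (hF : Integrable F (fockMeasure J Unit)) (hG : Integrable G (fockMeasure J Unit))
    (h : ∀ n, ∀ᵐ t ∂(simplexMeasure n),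
      ∑' k : Fin n → J, F (markedChain t k) = ∑' k : Fin n → J, G (markedChain t k)) :
    ∫ x, F x ∂(fockMeasure J Unit) = ∫ x, G x ∂(fockMeasure J Unit) := by
  have key : ∀ H : Chain J × Unit → ℂ, Integrable H (fockMeasure J Unit) →
      ∫ x, H x ∂(fockMeasure J Unit) =
        ∑' n, ∫ t, ∑' k : Fin n → J, H (markedChain t k) ∂(simplexMeasure n) := by
    intro H hH
    rw [fockMeasure_unit_eq_sum] at hH ⊢
    rw [integral_sum_measure hH]
    refine tsum_congr fun n => ?_
    have h1 := hH.mono_measure (Measure.le_sum _ n)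
    have h2 := (integrable_map_measure h1.aestronglyMeasurable
      (measurable_markedChain n).aemeasurable).1 h1
    rw [integral_map (measurable_markedChain n).aemeasurable h1.aestronglyMeasurable]
    refine (integral_prod _ h2).trans (integral_congr_ae ?_)
    filter_upwards [h2.prod_right_ae] with t ht
    rw [integral_countable ht]
    simp [measureReal_def]
  rw [key F hF, key G hG]
  exact tsum_congr fun n => integral_congr_ae (h n)

theorem ae_tsum_enorm_sq_lt_top {η : ℝ} (hη : 0 < η) {φ : Sect J Unit}
    (h : fockNorm η φ < ∞) (n : ℕ) :
    ∀ᵐ t ∂(simplexMeasure n), ∑' k : Fin n → J, ‖φ (markedChain t k)‖ₑ ^ 2 < ∞ := by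
  have hm : Measurable fun x : Chain J × Unit => ENNReal.ofReal (η ^ x.1.length) * ‖φ x‖ₑ ^ 2 :=
    (measurable_weight η).mul (φ.measurable.enorm.pow_const 2)
  have h2 : fockNorm η φ ^ 2 < ∞ := ENNReal.pow_lt_top h
  rw [fockNorm, eLpNorm_weighted_sq, lintegral_fockMeasure_slices hm] at h2
  have h3 := (ENNReal.le_tsum n).trans_lt h2
  have h4 := ae_lt_top (Measurable.tsum fun k : Fin n → J => hm.comp
    ((measurable_markedChain n).comp (measurable_id.prodMk measurable_const))) h3.ne
  filter_upwards [h4, ae_strictMono n] with t ht hmono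
  simp only [Function.comp_apply, id_eq, length_markedChain hmono, ENNReal.tsum_mul_left] at ht
  refine lt_top_iff_ne_top.2 fun htop => ?_
  rw [htop, ENNReal.mul_top (ENNReal.ofReal_pos.2 (pow_pos hη n)).ne'] at ht
  exact ht.ne rfl

end Slices

/-! ### The inclusion as a contraction. -/

section Inclusion

variable {J : Type u} [Countable J] [MeasurableSpace J] [DiscreteMeasurableSpace J]
  {K : Type v} [NormedAddCommGroup K] [InnerProductSpace ℂ K] [CompleteSpace K]
  (E : GelfandField J K)

/-- The matrix of the inclusion over the chains with times `t`. -/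
def GelfandField.gramPi {n : ℕ} (t : Fin n → ℝ) (i k : Fin n → J) : ℂ :=
  ∏ p, E.gram (t p) (i p) (k p)

theorem GelfandField.isGram_gramPi {n : ℕ} (t : Fin n → ℝ) : IsGram (E.gramPi t) :=
  IsGram.pi fun p => E.isGram (t p)

theorem GelfandField.incl_chainOfTuple (φ : Sect J Unit) {n : ℕ} {x : Fin n → ℝ × J}
    (hx : Function.Injective x) :
    E.incl φ (chainOfTuple J n x, ()) = ∑' k : Fin n → J,
      E.gramPi (fun p => (x p).1) (fun p => (x p).2) k *
        φ (markedChain (fun p => (x p).1) k) := by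
  classical
  have hb : Function.Bijective fun i : Fin n =>
      (⟨x i, mem_points_chainOfTuple.2 ⟨i, rfl⟩⟩ : (chainOfTuple J n x).points) := by
    refine ⟨fun i j h => hx (congrArg Subtype.val h), ?_⟩
    rintro ⟨p, hp⟩
    obtain ⟨i, rfl⟩ := mem_points_chainOfTuple.1 hp
    exact ⟨i, rfl⟩
  let e := Equiv.ofBijective _ hb
  rw [GelfandField.incl, ← (e.arrowCongr (Equiv.refl J)).tsum_eq]
  refine tsum_congr fun k => ?_
  have h1 : ∀ i, (e.arrowCongr (Equiv.refl J)) k (e i) = k i := fun i => by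
    simp [Equiv.arrowCongr]
  congr 1
  · rw [← e.prod_comp, GelfandField.gramPi]
    exact Finset.prod_congr rfl fun i _ => by rw [h1]; rfl
  · refine congrArg φ (Prod.ext ?_ rfl)
    refine Chain.ext fun p => ?_
    rw [markedChain, mem_points_chainOfTuple, Chain.points]
    simp only [Finset.mem_image, Finset.mem_univ, true_and]
    constructor
    · rintro ⟨q, rfl⟩
      obtain ⟨i, rfl⟩ := e.surjective q
      exact ⟨i, by rw [h1]; rfl⟩
    · rintro ⟨i, rfl⟩
      exact ⟨e i, by rw [h1]; rfl⟩

theorem GelfandField.incl_markedChain (φ : Sect J Unit) {n : ℕ} {t : Fin n → ℝ}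
    (ht : StrictMono t) (i : Fin n → J) :
    E.incl φ (markedChain t i) = ∑' k : Fin n → J, E.gramPi t i k * φ (markedChain t k) :=
  E.incl_chainOfTuple φ fun _ _ h => ht.injective (congrArg Prod.fst h)

theorem GelfandField.measurable_incl (φ : Sect J Unit) : Measurable (E.incl φ) := by
  have h : Measurable fun ω : Chain J => E.incl φ (ω, ()) := by
    refine measurable_of_injective_tuples fun n => ⟨_, ?_, fun x hx => E.incl_chainOfTuple φ hx⟩
    refine Measurable.tsum fun k => Measurable.mul ?_ (φ.measurable.comp ?_)
    · refine Finset.measurable_fun_prod _ fun p _ => ?_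
      have : Measurable fun q : ℝ × J => E.gram q.1 q.2 (k p) :=
        measurable_from_prod_countable_left fun j => E.measurable_gram j (k p)
      exact this.comp (measurable_pi_apply p)
    · exact (measurable_markedChain n).comp (Measurable.prodMk
        (measurable_pi_lambda _ fun p => (measurable_pi_apply p).fst) measurable_const)
  exact h.comp measurable_fst

/-- The weight depends on the number of points only, hence is constant on each slice, and there the
matrix is a contraction. So the bound holds for every exponent. -/
theorem GelfandField.eLpNorm_incl_le (φ : Sect J Unit) (η : ℝ) :
    eLpNorm (E.incl φ) 2 (weighted J Unit η) ≤ fockNorm η φ := by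
  refine (ENNReal.pow_le_pow_left_iff two_ne_zero).1 ?_
  have hm : ∀ f : Chain J × Unit → ℂ, Measurable f → Measurable fun x : Chain J × Unit =>
      ENNReal.ofReal (η ^ x.1.length) * ‖f x‖ₑ ^ 2 := fun f hf =>
    (measurable_weight η).mul (hf.enorm.pow_const 2)
  rw [fockNorm, eLpNorm_weighted_sq, eLpNorm_weighted_sq,
    lintegral_fockMeasure_slices (hm _ (E.measurable_incl φ)),
    lintegral_fockMeasure_slices (hm _ φ.measurable)]
  refine ENNReal.tsum_le_tsum fun n => lintegral_mono_ae ?_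
  filter_upwards [ae_strictMono n] with t ht
  simp only [length_markedChain ht, ENNReal.tsum_mul_left, E.incl_markedChain φ ht]
  exact mul_le_mul' le_rfl ((E.isGram_gramPi t).tsum_sq_le _)

/-- Series add only where they converge, so finite norms are needed, and they give square
summability on almost every slice. Scalar multiples in `GelfandField.incl_smul` need no such
condition. -/
theorem GelfandField.incl_add {η : ℝ} (hη : 0 < η) {φ ψ : Sect J Unit}
    (hφ : fockNorm η φ < ∞) (hψ : fockNorm η ψ < ∞) :
    E.incl (φ + ψ) =ᵐ[fockMeasure J Unit] fun x => E.incl φ x + E.incl ψ x := by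
  refine ae_of_ae_slices (measurableSet_eq_fun (E.measurable_incl _)
    ((E.measurable_incl _).add (E.measurable_incl _))) fun n => ?_
  filter_upwards [ae_strictMono n, ae_tsum_enorm_sq_lt_top hη hφ n,
    ae_tsum_enorm_sq_lt_top hη hψ n, ae_slices (AEEqFun.coeFn_add φ ψ) n] with t ht h1 h2 h3 i
  simp only [E.incl_markedChain _ ht, h3, Pi.add_apply, mul_add]
  exact ((E.isGram_gramPi t).summable i h1).tsum_add ((E.isGram_gramPi t).summable i h2)

theorem GelfandField.incl_smul (c : ℂ) (φ : Sect J Unit) :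
    E.incl (c • φ) =ᵐ[fockMeasure J Unit] fun x => c * E.incl φ x := by
  refine ae_of_ae_slices (measurableSet_eq_fun (E.measurable_incl _)
    ((E.measurable_incl _).const_mul c)) fun n => ?_
  filter_upwards [ae_strictMono n, ae_slices (AEEqFun.coeFn_smul c φ) n] with t ht h3 i
  simp only [E.incl_markedChain _ ht, h3, Pi.smul_apply, smul_eq_mul, ← tsum_mul_left]
  exact tsum_congr fun k => by ring

/-- The inclusion as a linear map. -/
def GelfandField.inclMap : GPlus J Unit →ₗ[ℂ] GMinus J Unit where
  toFun φ := ⟨AEEqFun.mk (E.incl (φ : Sect J Unit))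
      (E.measurable_incl (φ : Sect J Unit)).aestronglyMeasurable, mem_GMinus.2 fun ξ hξ => by
        rw [fockNorm_mk]
        exact (E.eLpNorm_incl_le _ ξ).trans_lt (fockNorm_lt_top φ hξ.1.le)⟩
  map_add' φ ψ := by
    refine Subtype.ext (AEEqFun.ext ?_)
    refine (AEEqFun.coeFn_mk _ _).trans ((E.incl_add one_pos (fockNorm_lt_top φ zero_le_one)
      (fockNorm_lt_top ψ zero_le_one)).trans ?_)
    refine EventuallyEq.trans ?_ (AEEqFun.coeFn_add _ _).symm
    exact (AEEqFun.coeFn_mk _ _).symm.add (AEEqFun.coeFn_mk _ _).symm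
  map_smul' c φ := by
    refine Subtype.ext (AEEqFun.ext ?_)
    refine (AEEqFun.coeFn_mk _ _).trans ((E.incl_smul c φ).trans ?_)
    refine EventuallyEq.trans ?_ (AEEqFun.coeFn_smul _ _).symm
    exact (AEEqFun.coeFn_mk _ _).symm.const_smul c

theorem GelfandField.coeFn_inclMap (φ : GPlus J Unit) :
    (E.inclMap φ : Sect J Unit) =ᵐ[fockMeasure J Unit] E.incl φ :=
  AEEqFun.coeFn_mk _ _

theorem GelfandField.exists_incl (φ : GPlus J Unit) : ∃ ψ : GMinus J Unit,
    (ψ : Sect J Unit) =ᵐ[fockMeasure J Unit] E.incl φ :=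
  ⟨E.inclMap φ, E.coeFn_inclMap φ⟩

end Inclusion

/-! ### Continuity, existence and density -/

section Operators

variable {J : Type u} {ι : Type v} [MeasurableSpace J] [MeasurableSpace ι]

theorem withSeminorms_GPlus :
    WithSeminorms (show SeminormFamily ℂ (GPlus J ι) (Ioi (1 : ℝ)) from fun ζ =>
      fockSeminorm ζ (GPlus J ι) (iInf_le _ ζ)) :=
  ⟨rfl⟩

theorem withSeminorms_GMinus :
    WithSeminorms (show SeminormFamily ℂ (GMinus J ι) (Ioo (0 : ℝ) 1) from fun ξ =>
      fockSeminorm ξ (GMinus J ι) (iInf_le _ ξ)) :=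
  ⟨rfl⟩

theorem continuous_of_fockNorm_le (I : GPlus J ι →ₗ[ℂ] GMinus J ι)
    (h : ∀ η ∈ Ioo (0 : ℝ) 1, ∃ η' > 1, ∃ c < ∞, ∀ φ : GPlus J ι,
      fockNorm η (I φ : Sect J ι) ≤ c * fockNorm η' (φ : Sect J ι)) : Continuous I := by
  refine WithSeminorms.continuous_of_isBounded withSeminorms_GPlus withSeminorms_GMinus I ?_
  rintro ⟨η, hη⟩
  obtain ⟨η', hη', c, hc, hle⟩ := h η hη
  refine ⟨{⟨η', hη'⟩}, c.toNNReal, fun φ => ?_⟩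
  simp only [Finset.sup_singleton]
  change (fockNorm η (I φ : Sect J ι)).toReal ≤
    (c.toNNReal : ℝ) * (fockNorm η' (φ : Sect J ι)).toReal
  have hφ : fockNorm η' (φ : Sect J ι) ≠ ∞ := ne_of_lt
    (iInf_le (fun ζ : Ioi (1 : ℝ) => fockSpace J ι ζ) ⟨η', hη'⟩ φ.2)
  have := ENNReal.toReal_mono (ENNReal.mul_ne_top hc.ne hφ) (hle φ)
  rwa [ENNReal.toReal_mul] at this

end Operators

/-! ### Values of the integral in the projective limit and in the dual. -/

section Integral

variable {J : Type u} [Countable J] [MeasurableSpace J] [DiscreteMeasurableSpace J]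

/-- To reach a given η take ξ halfway between η and 1 and ε = (1 - η)/2, so that ξ - ε = η. The pair
(ζ, ξ) changes with η, but by uniqueness the integral does not, hence it lies in all 𝒢(η). -/
theorem MatrixProcess.LocallyIntegrable.exists_isQSIntegral {C : MatrixProcess J}
    (hC : C.LocallyIntegrable) {t : ℝ} (ht : 0 < t) (φ : GPlus J Unit) :
    ∃ ψ ∈ GMinus J Unit, IsQSIntegral C t φ ψ := by
  have key : ∀ η ∈ Ioo (0 : ℝ) 1, ∃ ψ, IsQSIntegral C t φ ψ ∧ fockNorm η ψ < ∞ := by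
    intro η hη
    have hξ : (1 + η) / 2 ∈ Ioo (0 : ℝ) 1 := ⟨by linarith [hη.1], by linarith [hη.2]⟩
    obtain ⟨ζ, hζ, h⟩ := hC.2 _ hξ t ht
    obtain ⟨ψ, hψ, hle⟩ := QSC.exists_isQSIntegral hC.1 hξ hζ h φ
    have hε : 0 < (1 - η) / 2 := by linarith [hη.2]
    have := hle ((1 - η) / 2) hε (by linarith [hη.1])
    rw [show (1 + η) / 2 - (1 - η) / 2 = η by ring] at this
    exact ⟨ψ, hψ, this.trans_lt (ENNReal.mul_lt_top (qsBound_lt_top h _)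
      (mem_GPlus.1 φ.2 _ (by linarith [show (1 : ℝ) < ζ from hζ])))⟩
  obtain ⟨ψ, hψ, -⟩ := key (1 / 2) (by norm_num)
  refine ⟨ψ, mem_GMinus.2 fun η hη => ?_, hψ⟩
  obtain ⟨ψ', hψ', hlt⟩ := key η hη
  rwa [hψ.unique hψ']

/-- The adjoint process takes values in 𝒢(1/ζ), and local integrability provides no ζ arbitrarily
close to one. The estimate therefore places the integral in some 𝒢(η) with η < 1, that is, in the
dual and not necessarily in 𝒢₋. -/
theorem MatrixProcess.LocallyIntegrable.exists_isQSIntegral_star {C : MatrixProcess J}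
    (hC : C.LocallyIntegrable) {t : ℝ} (ht : 0 < t) (φ : GPlus J Unit) :
    ∃ ψ ∈ GDual J Unit, IsQSIntegral C.star t φ ψ := by
  have hξ : (1 / 2 : ℝ) ∈ Ioo (0 : ℝ) 1 := by norm_num
  obtain ⟨ζ, hζ, h⟩ := hC.2 _ hξ t ht
  have hζ0 : 0 < ζ := zero_lt_one.trans hζ
  have hs := hC.star_integrableOn hζ0 hξ.1 h
  have hζi : ζ⁻¹ ∈ Ioo (0 : ℝ) 1 := ⟨inv_pos.2 hζ0, inv_lt_one_of_one_lt₀ hζ⟩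
  have h2 : (1 : ℝ) < (1 / 2)⁻¹ := by norm_num
  obtain ⟨ψ, hψ, hle⟩ := QSC.exists_isQSIntegral hC.star_measurable hζi h2 hs φ
  have hε : 0 < ζ⁻¹ / 2 := half_pos hζi.1
  have hlt := hle (ζ⁻¹ / 2) hε (half_lt_self hζi.1)
  refine ⟨ψ, ⟨ζ⁻¹ - ζ⁻¹ / 2, ⟨by linarith, by linarith [hζi.2]⟩, hlt.trans_lt
    (ENNReal.mul_lt_top (qsBound_lt_top hs _) (mem_GPlus.1 φ.2 _ (by linarith)))⟩, hψ⟩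

theorem fockNorm_le_qsBound {C : MatrixProcess J} (hC : C.Measurable) {ξ ζ t ε : ℝ}
    (hξ : ξ ∈ Ioo (0 : ℝ) 1) (hζ : 1 < ζ) (h : C.IntegrableOn ζ ξ t) (hε : 0 < ε) (hεξ : ε < ξ)
    {φ : GPlus J Unit} {ψ : Sect J Unit} (hψ : IsQSIntegral C t φ ψ) :
    fockNorm (ξ - ε) ψ ≤ qsBound C ζ ξ t ε * fockNorm (ζ + ε) (φ : Sect J Unit) := by
  obtain ⟨ψ', hψ', hle⟩ := exists_isQSIntegral hC hξ hζ h φ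
  rw [hψ.unique hψ']
  exact hle ε hε hεξ

end Integral
-- Density of the test space.
section Density

/-- Selfadjointness of the matrix. With f of finite support only a finite sum has to be exchanged
with a series. -/
theorem IsGram.tsum_conj_mul {I : Type*} {T : I → I → ℂ} (hT : IsGram T) {g f : I → ℂ}
    (hg : ∑' i, ‖g i‖ₑ ^ 2 < ∞) {s : Set I} (hs : s.Finite) (hf : ∀ k ∉ s, f k = 0) :
    ∑' i, (starRingEnd ℂ) (g i) * ∑' k, T i k * f k =
      ∑' k, (starRingEnd ℂ) (∑' i, T k i * g i) * f k := by
  lift s to Finset I using hs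
  have h1 : ∀ i, ∑' k, T i k * f k = ∑ k ∈ s, T i k * f k := fun i =>
    tsum_eq_sum fun k hk => by rw [hf k hk, mul_zero]
  have h3 : ∀ i k, T i k * (starRingEnd ℂ) (g i) = (starRingEnd ℂ) (T k i * g i) := fun i k => by
    rw [map_mul, hT.conj_apply]
  have h4 : ∀ k, Summable fun i => (starRingEnd ℂ) (T k i * g i) := fun k =>
    (hT.summable k hg).star
  have h5 : ∀ k, (starRingEnd ℂ) (∑' i, T k i * g i) = ∑' i, (starRingEnd ℂ) (T k i * g i) :=
    fun k => Complex.conj_tsum _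
  rw [tsum_eq_sum (s := s) (f := fun k => (starRingEnd ℂ) (∑' i, T k i * g i) * f k)
    fun k hk => by rw [hf k hk, mul_zero]]
  simp only [h1, Finset.mul_sum, h5, ← tsum_mul_right]
  rw [← Summable.tsum_finsetSum fun k _ => (h4 k).mul_right (f k)]
  refine tsum_congr fun i => Finset.sum_congr rfl fun k _ => ?_
  rw [← h3]
  ring

variable {J : Type u} [Countable J] [MeasurableSpace J] [DiscreteMeasurableSpace J]
  {K : Type v} [NormedAddCommGroup K] [InnerProductSpace ℂ K] [CompleteSpace K]
  (E : GelfandField J K)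

/-- Chains with at most `m` points, all with marks among the first ones. -/
def boundedChains (e : J → ℕ) (m : ℕ) : Set (Chain J × Unit) :=
  {x | x.1.length ≤ m ∧ ∀ p ∈ x.1.points, e p.2 ≤ m}

theorem measurableSet_boundedChains (e : J → ℕ) (m : ℕ) :
    MeasurableSet (boundedChains e m) := by
  refine (measurableSet_length_le m).inter (?_ : MeasurableSet (Prod.fst ⁻¹'
    {ω : Chain J | ∀ p ∈ ω.points, e p.2 ≤ m}))
  refine measurable_fst (measurableSet_chain.2 fun n => ?_)
  have : chainOfTuple J n ⁻¹' {ω : Chain J | ∀ p ∈ ω.points, e p.2 ≤ m} =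
      ⋂ i, {x | e (x i).2 ≤ m} := by
    ext x
    simp only [mem_preimage, mem_ofPred_eq, mem_points_chainOfTuple, forall_exists_index,
      forall_apply_eq_imp_iff, mem_iInter]
  rw [this]
  exact MeasurableSet.iInter fun i =>
    (Measurable.of_discrete (f := e)).comp (measurable_pi_apply i).snd measurableSet_Iic

theorem exists_mem_boundedChains (e : J → ℕ) (x : Chain J × Unit) :
    ∃ m, x ∈ boundedChains e m :=
  ⟨max x.1.length (x.1.points.sup fun p => e p.2), le_max_left _ _, fun _ hp =>
    (Finset.le_sup (f := fun p : ℝ × J => e p.2) hp).trans (le_max_right _ _)⟩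

theorem finite_boundedChains_slice {e : J → ℕ} (he : Function.Injective e) (m : ℕ) {n : ℕ}
    (t : Fin n → ℝ) : {k : Fin n → J | markedChain t k ∈ boundedChains e m}.Finite := by
  refine ((Set.Finite.pi fun _ : Fin n => (finite_Iic m).preimage he.injOn)).subset fun k hk => ?_
  exact fun i _ => hk.2 (t i, k i) (mem_points_chainOfTuple.2 ⟨i, rfl⟩)

/-- A section orthogonal to the range of the inclusion vanishes. -/
theorem GelfandField.eq_zero_of_integral_incl {ξ : ℝ} (hξ : ξ ∈ Ioo (0 : ℝ) 1) {g : Sect J Unit}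
    (hg : fockNorm ξ⁻¹ g < ∞)
    (h : ∀ φ : GPlus J Unit, ∫ x, (starRingEnd ℂ) (g x) * E.incl (φ : Sect J Unit) x
      ∂(fockMeasure J Unit) = 0) : g = 0 := by
  have hξi : 0 < ξ⁻¹ := inv_pos.2 hξ.1
  obtain ⟨e, he⟩ := exists_injective_nat J
  set v : Sect J Unit := AEEqFun.mk (E.incl g) (E.measurable_incl g).aestronglyMeasurable with hv
  have hvm : (v : Chain J × Unit → ℂ) =ᵐ[fockMeasure J Unit] E.incl g := AEEqFun.coeFn_mk _ _
  have hvn : fockNorm ξ⁻¹ v < ∞ := by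
    rw [hv, fockNorm_mk]
    exact (E.eLpNorm_incl_le g _).trans_lt hg
  have key : ∀ m, ∀ᵐ x ∂(fockMeasure J Unit), x ∈ boundedChains e m → E.incl g x = 0 := by
    intro m
    -- The test section is the image of g itself, cut off to be finitely supported on each slice.
    -- Moving the inclusion to the other factor turns orthogonality into the vanishing of the
    -- integral of ‖f‖².
    set f : Chain J × Unit → ℂ := (boundedChains e m).indicator (E.incl g) with hf
    have hfm : Measurable f := (E.measurable_incl g).indicator (measurableSet_boundedChains e m)
    set φ : Sect J Unit := AEEqFun.mk f hfm.aestronglyMeasurable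
    have hφf : (φ : Chain J × Unit → ℂ) =ᵐ[fockMeasure J Unit] f := AEEqFun.coeFn_mk _ _
    have hφ : φ ∈ GPlus J Unit := by
      refine mem_GPlus_of_bounded_length hξi hvn m (fun _ => 1) ?_
      filter_upwards [hφf, hvm] with x h1 h2
      rw [h1, h2, one_mul]
      refine ⟨fun hx => indicator_of_notMem (fun hx' => absurd hx'.1 (not_le.2 hx)) _, ?_⟩
      exact norm_indicator_le_norm_self _ _
    have hφn : fockNorm ξ φ < ∞ := fockNorm_lt_top ⟨φ, hφ⟩ hξ.1.le
    have hG : Integrable (fun x => (starRingEnd ℂ) (E.incl g x) * φ x) (fockMeasure J Unit) :=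
      integrable_conj_mul hξ.1 (E.measurable_incl g).aestronglyMeasurable φ.aestronglyMeasurable
        ((E.eLpNorm_incl_le g _).trans_lt hg) hφn
    have hF : Integrable (fun x => (starRingEnd ℂ) (g x) * E.incl φ x) (fockMeasure J Unit) :=
      integrable_conj_mul hξ.1 g.aestronglyMeasurable (E.measurable_incl φ).aestronglyMeasurable
        hg ((E.eLpNorm_incl_le φ _).trans_lt hφn)
    have h0 := integral_congr_slices hF hG fun n => by
      filter_upwards [ae_strictMono n, ae_tsum_enorm_sq_lt_top hξi hg n, ae_slices hφf n]
        with t ht h1 h2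
      simp only [E.incl_markedChain _ ht]
      refine (E.isGram_gramPi t).tsum_conj_mul h1 (finite_boundedChains_slice he m t) ?_
      intro k hk
      rw [h2, hf]
      exact indicator_of_notMem (show markedChain t k ∉ boundedChains e m from hk) _
    rw [h ⟨φ, hφ⟩] at h0
    have h1 : (fun x => (starRingEnd ℂ) (E.incl g x) * φ x) =ᵐ[fockMeasure J Unit]
        fun x => ((‖f x‖ ^ 2 : ℝ) : ℂ) := by
      filter_upwards [hφf] with x hx
      rw [hx, hf]
      by_cases hxs : x ∈ boundedChains e m
      · rw [indicator_of_mem hxs, Complex.conj_mul']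
        push_cast
        rfl
      · simp [indicator_of_notMem hxs]
    have h2 : Integrable (fun x => ‖f x‖ ^ 2) (fockMeasure J Unit) := by
      have := (hG.congr h1).re
      exact this
    rw [integral_congr_ae h1, integral_complex_ofReal, eq_comm, Complex.ofReal_eq_zero,
      integral_eq_zero_iff_of_nonneg (fun _ => by positivity) h2] at h0
    filter_upwards [h0] with x hx hxs
    simpa [hf, indicator_of_mem hxs] using hx
  have hz : ∀ᵐ x ∂(fockMeasure J Unit), E.incl g x = 0 := by
    filter_upwards [ae_all_iff.2 key] with x hx
    obtain ⟨m, hm⟩ := exists_mem_boundedChains e x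
    exact hx m hm
  refine AEEqFun.ext (EventuallyEq.trans ?_ AEEqFun.coeFn_zero.symm)
  -- The image of g vanishes, so on almost every slice the injectivity of the matrix forces g to
  -- vanish.
  refine ae_of_ae_slices (measurableSet_eq_fun g.measurable measurable_const) fun n => ?_
  filter_upwards [ae_strictMono n, ae_tsum_enorm_sq_lt_top hξi hg n, ae_slices hz n] with t ht h1 h2
  refine (E.isGram_gramPi t).eq_zero _ h1 fun i => ?_
  rw [← E.incl_markedChain _ ht, h2]

/-- The inclusion, with values in the Hilbert space `𝒢(ξ)`. -/
def GelfandField.inclL2 {ξ : ℝ} (hξ : ξ ∈ Ioo (0 : ℝ) 1) :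
    GPlus J Unit →ₗ[ℂ] Lp ℂ 2 (weighted J Unit ξ) where
  toFun φ := (memLp_weighted (mem_GMinus.1 (E.inclMap φ).2 ξ hξ)).toLp _
  map_add' φ ψ := by
    rw [← MemLp.toLp_add]
    refine MemLp.toLp_congr _ _ ((weighted_ac ξ).ae_eq ?_)
    rw [map_add]
    exact AEEqFun.coeFn_add (E.inclMap φ : Sect J Unit) (E.inclMap ψ : Sect J Unit)
  map_smul' c φ := by
    rw [RingHom.id_apply, ← MemLp.toLp_const_smul]
    refine MemLp.toLp_congr _ _ ((weighted_ac ξ).ae_eq ?_)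
    rw [map_smul]
    exact AEEqFun.coeFn_smul c (E.inclMap φ : Sect J Unit)

/-- If g is orthogonal to the range in 𝒢(ξ), then ξ^|τ| g(τ) lies in 𝒢(1/ξ) and annihilates the
range under the unweighted pairing, so it is zero. -/
theorem GelfandField.range_inclL2_dense {ξ : ℝ} (hξ : ξ ∈ Ioo (0 : ℝ) 1) :
    (LinearMap.range (E.inclL2 hξ)).topologicalClosure = ⊤ := by
  rw [Submodule.topologicalClosure_eq_top_iff, Submodule.eq_bot_iff]
  intro g hg
  have hm : AEStronglyMeasurable (fun x : Chain J × Unit => ((ξ ^ x.1.length : ℝ) : ℂ) * g x)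
      (fockMeasure J Unit) := (measurable_pow_length ξ).aestronglyMeasurable.mul
        ((Lp.aestronglyMeasurable g).mono_ac (fockMeasure_ac hξ.1))
  have hmk := AEEqFun.coeFn_mk _ hm
  have h0 : (AEEqFun.mk _ hm : Sect J Unit) = 0 := by
    refine E.eq_zero_of_integral_incl hξ ?_ fun φ => ?_
    · rw [fockNorm_mul_weight hξ.1 hmk]
      exact (Lp.memLp g).2
    · have h1 : inner ℂ g (E.inclL2 hξ φ) = 0 := Submodule.inner_left_of_mem_orthogonal
        (LinearMap.mem_range_self (E.inclL2 hξ) φ) hg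
      rw [inner_weighted hξ.1.le] at h1
      rw [← h1]
      refine integral_congr_ae ?_
      have h2 : E.inclL2 hξ φ =ᵐ[fockMeasure J Unit] (E.inclMap φ : Sect J Unit) :=
        (fockMeasure_ac hξ.1).ae_eq
          (MemLp.coeFn_toLp (memLp_weighted (mem_GMinus.1 (E.inclMap φ).2 ξ hξ)))
      filter_upwards [hmk, h2, E.coeFn_inclMap φ] with x h3 h4 h5
      rw [h3, h4, h5]
  rw [Lp.eq_zero_iff_ae_eq_zero]
  refine (weighted_ac ξ).ae_eq ?_
  rw [h0] at hmk
  filter_upwards [hmk, AEEqFun.coeFn_zero (μ := fockMeasure J Unit) (β := ℂ)] with x h1 h2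
  rw [h2] at h1
  have h3 : ((ξ ^ x.1.length : ℝ) : ℂ) ≠ 0 := Complex.ofReal_ne_zero.2 (pow_pos hξ.1 _).ne'
  exact (mul_eq_zero.1 h1.symm).resolve_left h3

theorem GelfandField.exists_fockNorm_sub_lt {ξ : ℝ} (hξ : ξ ∈ Ioo (0 : ℝ) 1)
    (ψ : GMinus J Unit) {r : ℝ} (hr : 0 < r) :
    ∃ φ : GPlus J Unit, (fockNorm ξ ((E.inclMap φ - ψ : GMinus J Unit) : Sect J Unit)).toReal < r
      := by
  have hψ := memLp_weighted (mem_GMinus.1 ψ.2 ξ hξ)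
  have h1 : hψ.toLp _ ∈ (LinearMap.range (E.inclL2 hξ)).topologicalClosure := by
    rw [E.range_inclL2_dense hξ]
    trivial
  obtain ⟨_, ⟨φ, rfl⟩, hlt⟩ := Metric.mem_closure_iff.1 h1 r hr
  refine ⟨φ, lt_of_le_of_lt (le_of_eq ?_) hlt⟩
  rw [dist_comm, dist_eq_norm, Lp.norm_def]
  refine congrArg ENNReal.toReal (eLpNorm_congr_ae ?_)
  refine EventuallyEq.trans ?_ (Lp.coeFn_sub _ _).symm
  refine ((weighted_ac ξ).ae_eq (AEEqFun.coeFn_sub (E.inclMap φ : Sect J Unit)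
    (ψ : Sect J Unit))).trans ?_
  exact (MemLp.coeFn_toLp (memLp_weighted (mem_GMinus.1 (E.inclMap φ).2 ξ hξ))).symm.sub
    (MemLp.coeFn_toLp hψ).symm

theorem GelfandField.dense_incl : Dense {ψ : GMinus J Unit | ∃ φ : GPlus J Unit,
    (ψ : Sect J Unit) =ᵐ[fockMeasure J Unit] E.incl φ} := by
  intro ψ
  rw [mem_closure_iff_nhds]
  intro U hU
  obtain ⟨s, r, hr, hs⟩ := (withSeminorms_GMinus.mem_nhds_iff ψ U).1 hU
  classical
  -- The norms increase with the exponent, so the largest exponent in the neighbourhood controls the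
  -- others; 1/2 is added only to have a nonempty set.
  obtain ⟨ξ, -, hξ⟩ := (Insert.insert ⟨1 / 2, by norm_num⟩ s : Finset (Ioo (0 : ℝ) 1)).exists_max_image
    id ⟨_, Finset.mem_insert_self _ _⟩
  obtain ⟨φ, hφ⟩ := E.exists_fockNorm_sub_lt ξ.2 ψ hr
  refine ⟨E.inclMap φ, hs ?_, φ, E.coeFn_inclMap φ⟩
  rw [Seminorm.mem_ball]
  refine lt_of_le_of_lt ?_ hφ
  refine Seminorm.finset_sup_apply_le ENNReal.toReal_nonneg fun η hη => ?_
  exact ENNReal.toReal_mono (mem_GMinus.1 (E.inclMap φ - ψ).2 ξ ξ.2).ne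
    (fockNorm_mono η.2.1.le (hξ η (Finset.mem_insert_of_mem hη)) _)

end Density

end QSC

end

theorem theorem1 {J : Type*} [Countable J] [MeasurableSpace J] [DiscreteMeasurableSpace J]
    {K : Type*} [NormedAddCommGroup K] [InnerProductSpace ℂ K] [CompleteSpace K]
    (E : GelfandField J K)
    (C : MatrixProcess J) (hC : C.LocallyIntegrable) :
    -- the inclusion of the test space is well defined and dense
    ((∀ φ : GPlus J Unit, ∃ ψ : GMinus J Unit,
        (ψ : Sect J Unit) =ᵐ[fockMeasure J Unit] E.incl φ) ∧
      Dense {ψ : GMinus J Unit | ∃ φ : GPlus J Unit,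
        (ψ : Sect J Unit) =ᵐ[fockMeasure J Unit] E.incl φ}) ∧
    -- the adjoint process: existence, equality of norms, integrability
    (∀ᵐ s ∂(volume.restrict (Ioi (0 : ℝ))),
      IsAdjoint (C.time s) (C.star.time s) ∧
      IsAdjoint (C.annihilation s) (C.star.creation s) ∧
      IsAdjoint (C.creation s) (C.star.annihilation s) ∧
      IsAdjoint (C.number s) (C.star.number s) ∧
      ∀ ξ ∈ Ioo (0 : ℝ) 1, ∀ ζ > 1,
        opNorm ξ⁻¹ ζ⁻¹ (fun φ => (C.star.time s φ : Sect J Unit)) =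
          opNorm ζ ξ (fun φ => (C.time s φ : Sect J Unit)) ∧
        opNorm ξ⁻¹ ζ⁻¹ (fun φ => (C.star.creation s φ : Sect J J)) =
          opNorm ζ ξ (fun φ => (C.annihilation s φ : Sect J Unit)) ∧
        opNorm ξ⁻¹ ζ⁻¹ (fun φ => (C.star.annihilation s φ : Sect J Unit)) =
          opNorm ζ ξ (fun φ => (C.creation s φ : Sect J J)) ∧
        opNorm ξ⁻¹ ζ⁻¹ (fun φ => (C.star.number s φ : Sect J J)) =
          opNorm ζ ξ (fun φ => (C.number s φ : Sect J J))) ∧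
    C.star.Measurable ∧
    (∀ ξ ∈ Ioo (0 : ℝ) 1, ∀ ζ > 1, ∀ t > 0,
      C.IntegrableOn ζ ξ t → C.star.IntegrableOn ξ⁻¹ ζ⁻¹ t) ∧
    -- the integral, its continuity, the estimate and the adjoint
    ∀ t > 0, ∃ I : GPlus J Unit →ₗ[ℂ] GMinus J Unit,
      (∀ (φ : GPlus J Unit) (ψ : Sect J Unit),
        IsQSIntegral C t φ ψ ↔ ψ = (I φ : Sect J Unit)) ∧
      Continuous I ∧
      (∀ ξ ∈ Ioo (0 : ℝ) 1, ∀ ζ > 1, C.IntegrableOn ζ ξ t →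
        ∀ ε : ℝ, 0 < ε → ε < ξ → ∀ ηm ηp : ℝ, 0 < ηm → ηm ≤ ξ - ε → ζ + ε ≤ ηp →
          opNorm ηp ηm (fun φ => (I φ : Sect J Unit)) ≤
            procNorm 1 ζ ξ t C.time +
            ENNReal.ofReal (1 / √ε) *
              (procNorm 2 ζ ξ t C.annihilation + procNorm 2 ζ ξ t C.creation) +
            ENNReal.ofReal (1 / ε) * procNorm ∞ ζ ξ t C.number) ∧
      ∃ I' : GPlus J Unit →ₗ[ℂ] GDual J Unit,
        (∀ (φ : GPlus J Unit) (ψ : Sect J Unit),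
          IsQSIntegral C.star t φ ψ ↔ ψ = (I' φ : Sect J Unit)) ∧
        ∀ φ χ : GPlus J Unit,
          pairing (I' φ : Sect J Unit) (χ : Sect J Unit) =
            pairing (φ : Sect J Unit) (I χ : Sect J Unit) := by
  refine ⟨⟨E.exists_incl, E.dense_incl⟩, ?_, hC.star_measurable,
    fun ξ hξ ζ hζ t _ h => hC.star_integrableOn (zero_lt_one.trans hζ) hξ.1 h, fun t ht => ?_⟩
  · obtain ⟨h1, h2, h3, h4⟩ := hC.ae_isAdjoint
    filter_upwards [h1, h2, h3, h4] with s h1 h2 h3 h4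
    refine ⟨h1, h2, h3, h4, fun ξ hξ ζ hζ => ?_⟩
    have hζ0 : 0 < ζ := zero_lt_one.trans hζ
    exact ⟨h1.opNorm_eq hζ0 hξ.1, h2.opNorm_eq hζ0 hξ.1, h3.opNorm_eq hζ0 hξ.1,
      h4.opNorm_eq hζ0 hξ.1⟩
  obtain ⟨I, hI⟩ := exists_linearMap_isQSIntegral (C := C) (t := t) (GMinus J Unit)
    fun φ => hC.exists_isQSIntegral ht φ
  obtain ⟨I', hI'⟩ := exists_linearMap_isQSIntegral (C := C.star) (t := t) (GDual J Unit)
    fun φ => hC.exists_isQSIntegral_star ht φ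
  have hIφ : ∀ φ, IsQSIntegral C t φ (I φ : Sect J Unit) := fun φ => (hI φ _).2 rfl
  refine ⟨I, hI, continuous_of_fockNorm_le I fun η hη => ?_, ?_, I', hI', fun φ χ => ?_⟩
  -- Again ξ - ε = η with ξ halfway between η and 1; the source norm is then the one with exponent ζ
  -- + ε > 1.
  · have hξ : (1 + η) / 2 ∈ Ioo (0 : ℝ) 1 := ⟨by linarith [hη.1], by linarith [hη.2]⟩
    obtain ⟨ζ, hζ, h⟩ := hC.2 _ hξ t ht
    have hε : 0 < (1 - η) / 2 := by linarith [hη.2]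
    refine ⟨ζ + (1 - η) / 2, by linarith [show (1 : ℝ) < ζ from hζ], _,
      qsBound_lt_top h ((1 - η) / 2), fun φ => ?_⟩
    have := fockNorm_le_qsBound hC.1 hξ hζ h hε (by linarith [hη.1]) (hIφ φ)
    rwa [show (1 + η) / 2 - (1 - η) / 2 = η by ring] at this
  · intro ξ hξ ζ hζ h ε hε hεξ ηm ηp hηm hm hp
    refine opNorm_le fun φ => ?_
    refine (fockNorm_mono hηm.le hm _).trans
      ((fockNorm_le_qsBound hC.1 hξ hζ h hε hεξ (hIφ φ)).trans ?_)
    have : (1 : ℝ) < ζ := hζ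
    exact mul_le_mul' le_rfl (fockNorm_mono (by linarith) hp _)
  -- The adjoint relation does not involve exponents, so any one admissible pair may be used.
  · obtain ⟨ζ, hζ, h⟩ := hC.2 (1 / 2) (by norm_num) t ht
    exact pairing_qsIntegral_star hC (by norm_num) hζ h (hIφ χ) ((hI' φ _).2 rfl)
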